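/- Let $M$ be a smooth $n$-dimensional (Hausdorff) manifold, $X_1,\dots,X_l$ smooth vector fields on $M$, $T>0$, $u,\Delta u\in L^1([0,T],\mathbb R^l)$, and let $q:[0,T]\to M$ be a trajectory of the linear control system $\dot q(t)=\sum_{i=1}^l u_i(t)X_i(q(t))$, $q(0)=q_0$. All ODEs are understood in the sense of Carathéodory. Let $\mathrm{End}^t$ be the end-point map, which sends a control $v$ to the value at time $t$ of the trajectory on $[0,T]$ with control $v$ starting at $q_0$. For all $s$ close to $0$ the control $u+s\Delta u$ has exactly one trajectory on $[0,T]$ starting at $q_0$; moreover, for each $t\in[0,T]$, $\mathrm{End}^t[u]=q(t)$ and $s\mapsto \mathrm{End}^t[u+s\Delta u]$ is smooth at $s=0$. For a multi-index $\alpha=(a_1,\dots,a_k)\in\mathbb N^k$ put $|\alpha|=\sum_i a_i$, $w(\alpha)=\sum_i i\,a_i$, $\alpha!=\prod_i a_i!$, and for vectors $\vec b=(b^{(1)},\dots,b^{(k)})$ and an $|\alpha|$-linear map $\Phi$ put $\Phi[\vec b^{\,\alpha}]=\Phi[b^{(1)},\dots,b^{(1)},\dots,b^{(k)},\dots,b^{(k)}]$,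 with $b^{(i)}$ repeated $a_i$ times. Choose local coordinates along $q$: a subdivision $0=\tau_0\le\dots\le\tau_N=T$ and charts $e_0,\dots,e_{N-1}$ such that $q([\tau_j,\tau_{j+1}])$ lies in the domain of $e_j$ (if one chart contains the whole trajectory, one may take $N=1$). On $[\tau_j,\tau_{j+1}]$ write everything in the chart $e_j$, so that $T_{q(t)}M\simeq\mathbb R^n$, the fields $X_i$ become maps with derivatives $\mathrm D^sX_i$, and $b^{(k)}(t)=\frac1{k!}\partial_s^k|_{s=0}\,e_j(\mathrm{End}^t[u+s\Delta u])$. For $a=1,\dots,n$ and $k\ge1$ let $\Phi^{(k)}_a(t)$ be symmetric $k$-linear forms on $T_{q(t)}M$ such that * $\{\Phi^{(1)}_a(0)\}_{a=1,\dots,n}$ is a basis of $T^*_{q(0)}M$, and $\Phi^{(k)}_a(0)=0$ for $k\ge2$; * on each $[\tau_j,\tau_{j+1}]$, for all $k\ge1$, $a$ and all $b$, $$\dot\Phi^{(k)}_a(t)[b,\dots,b]+\sum_i u_i(t)\sum_{s=1}^k\binom ks\,\Phi^{(k-s+1)}_a(t)\big[\mathrm D^s_{q(t)}X_i[b,\dots,b],b,\dots,b\big]=0;$$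 * at $\tau_1,\dots,\tau_{N-1}$, where the chart changes, the forms change like the derivatives of a function: for all $k\ge 1$ and $a$, $\sum_{w(\alpha)=k}\frac1{\alpha!}\Phi^{(|\alpha|)}_a[\vec b^{\,\alpha}]$ has the same value in both charts when $\vec b$ is the $k$-jet, expressed in the respective chart, of a smooth curve in $M$ through $q(\tau_j)$. Such forms exist for every initial basis. For any such forms define $$q^{(k)}_a(t)=\sum_{w(\alpha)=k}\frac1{\alpha!}\Phi^{(|\alpha|)}_a(t)[\vec b(t)^{\alpha}],\qquad \vec b(t)=(b^{(1)}(t),\dots,b^{(k)}(t)).$$ Then for every $k\ge1$ and $t\in[0,T]$ the assignment $(b^{(1)},\dots,b^{(k)})\mapsto(q^{(1)},\dots,q^{(k)})$, with $q^{(m)}_a=\sum_{w(\alpha)=m}\frac1{\alpha!}\Phi_a^{(|\alpha|)}(t)[\vec b^{\,\alpha}]$, is a bijection $(\mathbb R^n)^k\to(\mathbb R^n)^k$ with smooth inverse. Moreover the functions $q^{(k)}_a$ take the same value in both charts at every $\tau_j$, $0<j<N$, and satisfy on each $[\tau_j,\tau_{j+1}]$ the ODE $$\dot q^{(k)}_a(t)=\sum_i\Delta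 u_i(t)\sum_{w(\alpha)+w(\beta)=k-1}\frac1{\alpha!}\frac1{\beta!}\,\Phi^{(|\alpha|+1)}_a(t)\big[\mathrm D^{|\beta|}_{q(t)}X_i[\vec b(t)^{\beta}],\vec b(t)^{\alpha}\big].$$ -/

import Mathlib

open Set Filter Topology MeasureTheory
open scoped Manifold ContDiff

/-- `f` solves `f' = g` on `[a, b]` in the sense of Carathéodory: `g` is integrable on `[a, b]` and
`f` is its indefinite integral (that is, `f` is absolutely continuous with `f' = g` a.e.). -/
def SolvesODE {F : Type*} [NormedAddCommGroup F] [NormedSpace ℝ F]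
    (f g : ℝ → F) (a b : ℝ) : Prop :=
  IntervalIntegrable g volume a b ∧ ∀ t ∈ Icc a b, f t = f a + ∫ τ in a..t, g τ

/-! ### Multi-indices -/

/-- Absolute value `|α| = a₁ + ⋯ + a_k` of `α = (a₁, …, a_k)`; the entry `a_{i+1}` is `α i`. -/
abbrev multiAbs {k : ℕ} (α : Fin k → ℕ) : ℕ := ∑ i, α i

/-- Weight `w(α) = ∑ i · a_i`. -/
def multiWeight {k : ℕ} (α : Fin k → ℕ) : ℕ := ∑ i : Fin k, ((i : ℕ) + 1) * α i

/-- `α! = a₁! ⋯ a_k!`. -/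
def multiFactorial {k : ℕ} (α : Fin k → ℕ) : ℕ := ∏ i, (α i).factorial

/-- The finite set of multi-indices `(a₁, …, a_k)` of weight `w`. -/
def multiIndices (k w : ℕ) : Finset (Fin k → ℕ) :=
  (Fintype.piFinset fun _ => Finset.range (w + 1)).filter fun α => multiWeight α = w

theorem mem_multiIndices {k w : ℕ} {α : Fin k → ℕ} :
    α ∈ multiIndices k w ↔ multiWeight α = w := by
  simp only [multiIndices, Finset.mem_filter, Fintype.mem_piFinset, Finset.mem_range,
    and_iff_right_iff_imp]
  intro h i
  have h1 : ((i : ℕ) + 1) * α i ≤ multiWeight α :=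
    Finset.single_le_sum (f := fun i : Fin k => ((i : ℕ) + 1) * α i)
      (fun _ _ => Nat.zero_le _) (Finset.mem_univ i)
  have h2 : α i ≤ ((i : ℕ) + 1) * α i := Nat.le_mul_of_pos_left _ (Nat.succ_pos _)
  omega

/-- The argument list `b^α = (b₁, …, b₁, b₂, …, b₂, …, b_k, …, b_k)`, with `b_i` repeated `a_i`
times; the vector `b_{i+1}` is `b i`. -/
def multiPow {V : Type*} {k : ℕ} (b : Fin k → V) (α : Fin k → ℕ) : Fin (multiAbs α) → V :=
  fun j => b (finSigmaFinEquiv.symm j).1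

/-! ### The control system and its end-point map -/

section System

variable {n l : ℕ} {M : Type*} [TopologicalSpace M] [ChartedSpace (EuclideanSpace ℝ (Fin n)) M]

/-- The vector field `X` in the local coordinates `e`, as a map defined on `e.target ⊆ ℝⁿ`. -/
noncomputable def localField (X : (p : M) → TangentSpace (𝓡 n) p)
    (e : OpenPartialHomeomorph M (EuclideanSpace ℝ (Fin n))) (x : EuclideanSpace ℝ (Fin n)) :
    EuclideanSpace ℝ (Fin n) :=
  mfderiv (𝓡 n) (𝓡 n) e (e.symm x) (X (e.symm x))

/-- `q` is on `[0, T]` a (Carathéodory) trajectory of `q' = ∑ vᵢ Xᵢ(q)`, `q(0) = q₀`: it is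
continuous and solves the ODE in every chart, on every time interval which it spends there. -/
def IsTrajectory (X : Fin l → (p : M) → TangentSpace (𝓡 n) p) (v : ℝ → Fin l → ℝ) (q₀ : M) (T : ℝ)
    (q : ℝ → M) : Prop :=
  ContinuousOn q (Icc 0 T) ∧ q 0 = q₀ ∧
    ∀ e ∈ IsManifold.maximalAtlas (𝓡 n) ∞ M, ∀ a b : ℝ, 0 ≤ a → a ≤ b → b ≤ T →
      (∀ t ∈ Icc a b, q t ∈ e.source) →
      SolvesODE (fun t => e (q t)) (fun t => ∑ i, v t i • localField (X i) e (e (q t))) a b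

open Classical in
/-- The end-point map `End^t : v ↦ q(t)`, where `q` is the trajectory on `[0, T]` with control `v`
starting at `q₀` (with the value `q₀` if there is no such trajectory). -/
noncomputable def endPoint (X : Fin l → (p : M) → TangentSpace (𝓡 n) p) (q₀ : M) (T : ℝ)
    (v : ℝ → Fin l → ℝ) (t : ℝ) : M :=
  if h : ∃ q, IsTrajectory X v q₀ T q then h.choose t else q₀

/-- The `i`-th expansion coefficient at `s = 0`, in the chart `e`, of a curve `γ` in `M`:
`e(γ(s)) = e(γ(0)) + ∑ sⁱ γ⁽ⁱ⁾`. -/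
noncomputable def taylorCoeff (e : OpenPartialHomeomorph M (EuclideanSpace ℝ (Fin n))) (γ : ℝ → M)
    (i : ℕ) : EuclideanSpace ℝ (Fin n) :=
  ((i.factorial : ℝ)⁻¹) • iteratedDeriv i (fun s => e (γ s)) 0

/-- The `k`-jet at `s = 0` of a curve in the chart `e`: the tuple `(γ⁽¹⁾, …, γ⁽ᵏ⁾)`. -/
noncomputable def jetCoeffs (e : OpenPartialHomeomorph M (EuclideanSpace ℝ (Fin n))) (γ : ℝ → M)
    (k : ℕ) : Fin k → EuclideanSpace ℝ (Fin n) :=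
  fun i => taylorCoeff e γ (i + 1)

/-- A choice of local coordinates along a curve `q` on `[0, T]`: a subdivision
`0 = τ₀ ≤ τ₁ ≤ ⋯ ≤ τ_N = T` and smooth charts `e j` of `M`, `j < N`, such that `q` stays in the
domain of `e j` during `[τ_j, τ_{j+1}]`. (`N = 1` means: one chart containing the whole curve.) -/
structure CoordinatesAlong (n : ℕ) {M : Type*} [TopologicalSpace M]
    [ChartedSpace (EuclideanSpace ℝ (Fin n)) M] (q : ℝ → M) (T : ℝ) where
  N : ℕ
  τ : ℕ → ℝ
  e : ℕ → OpenPartialHomeomorph M (EuclideanSpace ℝ (Fin n))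
  τ_zero : τ 0 = 0
  τ_last : τ N = T
  τ_le : ∀ j < N, τ j ≤ τ (j + 1)
  e_mem : ∀ j < N, e j ∈ IsManifold.maximalAtlas (𝓡 n) ∞ M
  q_mem : ∀ j < N, ∀ t ∈ Icc (τ j) (τ (j + 1)), q t ∈ (e j).source

end System

/-! ### Adapted coordinates -/

section Adapted

variable {n l : ℕ}

/-- `∑_{w(α) = k} (1/α!) Φ^{|α|}[b^α]` for `b = (b₁, …, b_k)`. -/
noncomputable def gradedPoly (Φ : (m : ℕ) → EuclideanSpace ℝ (Fin n) [×m]→L[ℝ] ℝ) (k : ℕ)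
    (b : Fin k → EuclideanSpace ℝ (Fin n)) : ℝ :=
  ∑ α ∈ multiIndices k k, ((multiFactorial α : ℝ)⁻¹) * Φ (multiAbs α) (multiPow b α)

/-- The assignment `(b₁, …, b_k) ↦ (q⁽¹⁾, …, q⁽ᵏ⁾)`, where
`q⁽ᵐ⁾_a = ∑_{w(α) = m} (1/α!) Φ_a^{|α|}[(b₁, …, b_m)^α]`. -/
noncomputable def jetMap (Φ : (m : ℕ) → Fin n → EuclideanSpace ℝ (Fin n) [×m]→L[ℝ] ℝ) (k : ℕ)
    (b : Fin k → EuclideanSpace ℝ (Fin n)) : Fin k → Fin n → ℝ :=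
  fun m a => gradedPoly (fun r => Φ r a) (m + 1)
    (fun i : Fin (m + 1) => b (Fin.castLE (Nat.succ_le_of_lt m.isLt) i))

/-- `∑ᵢ uᵢ ∑_{s=1}^k (k choose s) Φ^{k-s+1}[D^s_x Yᵢ[b, …, b], b, …, b]`. -/
noncomputable def formsRHS (Y : Fin l → EuclideanSpace ℝ (Fin n) → EuclideanSpace ℝ (Fin n))
    (u : Fin l → ℝ) (x : EuclideanSpace ℝ (Fin n))
    (Φ : (m : ℕ) → EuclideanSpace ℝ (Fin n) [×m]→L[ℝ] ℝ) (k : ℕ)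
    (b : EuclideanSpace ℝ (Fin n)) : ℝ :=
  ∑ i, u i * ∑ s ∈ Finset.Icc 1 k, (k.choose s : ℝ) *
    Φ (k - s + 1)
      (Matrix.vecCons (iteratedFDeriv ℝ s (Y i) x fun _ => b) fun _ : Fin (k - s) => b)

/-- `∑ᵢ Δuᵢ ∑_{w(α) + w(β) = k-1} (1/α!) (1/β!) Φ^{|α|+1}[D^{|β|}_x Yᵢ[b^β], b^α]`. -/
noncomputable def coordsRHS (Y : Fin l → EuclideanSpace ℝ (Fin n) → EuclideanSpace ℝ (Fin n))
    (Δu : Fin l → ℝ) (x : EuclideanSpace ℝ (Fin n))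
    (Φ : (m : ℕ) → EuclideanSpace ℝ (Fin n) [×m]→L[ℝ] ℝ) (k : ℕ)
    (b : Fin k → EuclideanSpace ℝ (Fin n)) : ℝ :=
  ∑ i, Δu i * ∑ w ∈ Finset.HasAntidiagonal.antidiagonal (k - 1),
    ∑ α ∈ multiIndices k w.1, ∑ β ∈ multiIndices k w.2,
      ((multiFactorial α : ℝ)⁻¹) * ((multiFactorial β : ℝ)⁻¹) *
        Φ (multiAbs α + 1)
          (Matrix.vecCons (iteratedFDeriv ℝ (multiAbs β) (Y i) x (multiPow b β)) (multiPow b α))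

variable {M : Type*} [TopologicalSpace M] [ChartedSpace (EuclideanSpace ℝ (Fin n)) M]

/-- The families of forms which define adapted coordinates along the trajectory `q` with control
`u`. Here `Φ j k a t` is the form `Φ⁽ᵏ⁾_a(t)` on `T_{q(t)}M ≅ ℝⁿ` in the chart `e j`, for
`t ∈ [τ_j, τ_{j+1}]`; only `k ≥ 1` matters. When the chart changes at `τ_{j+1}`, the forms change
like the derivatives of a function do: the value of `∑_{w(α)=k} (1/α!) Φ_a^{|α|}[b^α]` on the jet
of a curve through `q(τ_{j+1})` is the same in both charts. -/
structure IsAdaptedForms (X : Fin l → (p : M) → TangentSpace (𝓡 n) p) (u : ℝ → Fin l → ℝ) {T : ℝ}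
    (q : ℝ → M) (C : CoordinatesAlong n q T)
    (Φ : ℕ → (k : ℕ) → Fin n → ℝ → EuclideanSpace ℝ (Fin n) [×k]→L[ℝ] ℝ) : Prop where
  symm : ∀ j < C.N, ∀ k ≥ 1, ∀ a, ∀ t ∈ Icc (C.τ j) (C.τ (j + 1)), ∀ (σ : Equiv.Perm (Fin k))
    (v : Fin k → EuclideanSpace ℝ (Fin n)), Φ j k a t (v ∘ σ) = Φ j k a t v
  init_linearIndependent : LinearIndependent ℝ fun a => Φ 0 1 a 0
  init_span : Submodule.span ℝ (range fun a => Φ 0 1 a 0) = ⊤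
  init_zero : ∀ k ≥ 2, ∀ a, Φ 0 k a 0 = 0
  ode : ∀ j < C.N, ∀ k ≥ 1, ∀ a, ∀ b : EuclideanSpace ℝ (Fin n),
    SolvesODE (fun t => Φ j k a t fun _ => b)
      (fun t => -formsRHS (fun i => localField (X i) (C.e j)) (u t) (C.e j (q t))
        (fun m => Φ j m a t) k b)
      (C.τ j) (C.τ (j + 1))
  change_chart : ∀ j, j + 1 < C.N → ∀ k ≥ 1, ∀ a, ∀ γ : ℝ → M, γ 0 = q (C.τ (j + 1)) →
    ContMDiffAt 𝓘(ℝ, ℝ) (𝓡 n) ∞ γ 0 →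
    gradedPoly (fun m => Φ (j + 1) m a (C.τ (j + 1))) k (jetCoeffs (C.e (j + 1)) γ k) =
      gradedPoly (fun m => Φ j m a (C.τ (j + 1))) k (jetCoeffs (C.e j) γ k)

end Adapted

/-! The forms `Φ⁽ᵏ⁾_a(t)` behave like the derivatives at `q(t)` of a function `f_a(t, ·)`. Their
equation says, as an identity of Taylor jets at `q(t)`, that `∂ₜ f_a + ∑ uᵢ Xᵢ f_a = 0`: the
function is carried along by the flow of the reference control. The number `q⁽ᵏ⁾_a(t)` is the `k`-th
Taylor coefficient in `s` of `f_a(t, End^t[u + s Δu])`. When this expression is differentiated in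
`t`, the terms with `uᵢ` cancel and `s ∑ Δuᵢ (Xᵢ f_a)(End^t[u + s Δu])` is left. The factor `s`
lowers the order by one, which produces the weight `k - 1`, and the formula of Faà di Bruno expands
the rest.

In a chart this is made precise with polynomials. `sum_fieldTerm_sub_isBigO` identifies the equation
of the forms with a truncated directional derivative, `fderiv_expansionCoeff_formsEval_eq_coordsRHS`
carries out the cancellation, and `solvesODE_gradedPoly` combines it with the chain rule for
absolutely continuous functions.

Smoothness in `s` comes from the implicit function theorem for the integral equation in `C([a, b],
ℝⁿ)` (`exists_contDiffAt_solution_family`). The partial derivative there is `1` minus a Volterra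
operator, which is invertible by `isUnit_one_sub_of_volterra`. One-chart families are concatenated
along a subdivision, and uniqueness (`IsTrajectoryOn.eqOn`) identifies them with the end-point map.
Since whole curves depend smoothly on `s`, the equations of the coefficients `b⁽ʳ⁾` follow by taking
Taylor coefficients of the integral equation itself.

Reversibility is triangularity: `q⁽ᵏ⁾` is `Φ⁽¹⁾[b⁽ᵏ⁾]` plus a polynomial in the lower `b⁽ʳ⁾`
(`gradedPoly_succ`), and `Φ⁽¹⁾` remains a basis because its pairing with solutions of the linearised
equation is constant (`exists_forall_eq_of_solvesODE`). The forms exist because their equations are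
linear and triangular in the degree (`exists_forms`), and jets of functions can be pulled back by
chart changes (`exists_forms_chart_change`). -/

section AbsolutelyContinuous

/-! ### Calculus of Carathéodory solutions -/

variable {F : Type*} [NormedAddCommGroup F]
variable {G : Type*} [NormedAddCommGroup G]

theorem AbsolutelyContinuousOnInterval.of_dist_le {f : ℝ → F} {g : ℝ → G} {a b : ℝ} (K : ℝ)
    (hg : AbsolutelyContinuousOnInterval g a b)
    (h : ∀ x ∈ uIcc a b, ∀ y ∈ uIcc a b, dist (f x) (f y) ≤ K * dist (g x) (g y)) :
    AbsolutelyContinuousOnInterval f a b := by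
  refine squeeze_zero' ?_ ?_ (by simpa using Tendsto.const_mul K hg)
  · exact Eventually.of_forall fun _ => Finset.sum_nonneg fun _ _ => dist_nonneg
  · filter_upwards [mem_inf_of_right (mem_principal_self _)] with E hE
    rw [Finset.mul_sum]
    exact Finset.sum_le_sum fun i hi => h _ (hE.1 i hi).1 _ (hE.1 i hi).2

theorem IntervalIntegrable.mono_Icc {g : ℝ → F} {a b c d : ℝ}
    (h : IntervalIntegrable g volume a b) (hab : a ≤ b) (hc : c ∈ Icc a b) (hd : d ∈ Icc a b) :
    IntervalIntegrable g volume c d :=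
  h.mono_set (by rw [uIcc_of_le hab]; exact uIcc_subset_Icc hc hd)

variable [NormedSpace ℝ F] [NormedSpace ℝ G]

/-- The increments are dominated by those of the real function `∫ ‖g‖`, for which absolute
continuity is the scalar theorem. -/
theorem IntervalIntegrable.absolutelyContinuous_integral {g : ℝ → F} {a b : ℝ} (hab : a ≤ b)
    (h : IntervalIntegrable g volume a b) :
    AbsolutelyContinuousOnInterval (fun x => ∫ v in a..x, g v) a b := by
  refine (h.norm.absolutelyContinuousOnInterval_intervalIntegral
    (left_mem_uIcc)).of_dist_le 1 fun x hx y hy => ?_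
  rw [uIcc_of_le hab] at hx hy
  have ha : a ∈ Icc a b := ⟨le_rfl, hab⟩
  rw [one_mul, dist_comm (∫ v in a..x, g v), dist_comm (∫ v in a..x, ‖g v‖), dist_eq_norm,
    Real.dist_eq,
    intervalIntegral.integral_interval_sub_left (h.mono_Icc hab ha hy) (h.mono_Icc hab ha hx),
    intervalIntegral.integral_interval_sub_left (h.norm.mono_Icc hab ha hy)
      (h.norm.mono_Icc hab ha hx)]
  exact intervalIntegral.norm_integral_le_abs_integral_norm

theorem SolvesODE.congr {f f' g g' : ℝ → F} {a b : ℝ} (hab : a ≤ b) (h : SolvesODE f g a b)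
    (hf : ∀ t ∈ Icc a b, f' t = f t) (hg : ∀ᵐ t, t ∈ Icc a b → g' t = g t) :
    SolvesODE f' g' a b := by
  refine ⟨h.1.congr_ae ?_, fun t ht => ?_⟩
  · rw [EventuallyEq, ae_restrict_iff' measurableSet_uIoc]
    filter_upwards [hg] with t ht h'
    rw [uIoc_of_le hab] at h'
    exact (ht (Ioc_subset_Icc_self h')).symm
  · rw [hf t ht, hf a ⟨le_rfl, hab⟩, h.2 t ht]
    congr 1
    refine intervalIntegral.integral_congr_ae ?_
    filter_upwards [hg] with s hs h'
    rw [uIoc_of_le ht.1] at h'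
    exact (hs ⟨h'.1.le, h'.2.trans ht.2⟩).symm

theorem SolvesODE.absolutelyContinuous {f g : ℝ → F} {a b : ℝ} (hab : a ≤ b)
    (h : SolvesODE f g a b) : AbsolutelyContinuousOnInterval f a b := by
  refine (h.1.absolutelyContinuous_integral hab).of_dist_le 1 fun x hx y hy => ?_
  rw [uIcc_of_le hab] at hx hy
  rw [h.2 x hx, h.2 y hy, dist_add_left, one_mul]

theorem SolvesODE.continuousOn {f g : ℝ → F} {a b : ℝ} (hab : a ≤ b)
    (h : SolvesODE f g a b) : ContinuousOn f (Icc a b) := by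
  simpa [uIcc_of_le hab] using (h.absolutelyContinuous hab).continuousOn

theorem SolvesODE.ae_hasDerivAt [CompleteSpace F] {f g : ℝ → F} {a b : ℝ} (hab : a ≤ b)
    (h : SolvesODE f g a b) : ∀ᵐ t, t ∈ Icc a b → HasDerivAt f (g t) t := by
  have h₁ : ∀ᵐ x : ℝ, x ≠ a := by simp [ae_iff, measure_singleton]
  have h₂ : ∀ᵐ x : ℝ, x ≠ b := by simp [ae_iff, measure_singleton]
  filter_upwards [h.1.ae_hasDerivAt_integral, h₁, h₂] with t ht hta htb hm
  have h3 := (ht (by rwa [uIcc_of_le hab]) a left_mem_uIcc).const_add (f a)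
  refine h3.congr_of_eventuallyEq ?_
  filter_upwards [Icc_mem_nhds (lt_of_le_of_ne hm.1 hta.symm) (lt_of_le_of_ne hm.2 htb)] with s hs
  exact h.2 s hs

/-- The difference between `f` and the indefinite integral of `g` is absolutely continuous with
derivative zero almost everywhere, hence constant. -/
theorem SolvesODE.of_absolutelyContinuous [CompleteSpace F] {f g : ℝ → F} {a b : ℝ} (hab : a ≤ b)
    (hg : IntervalIntegrable g volume a b) (hf : AbsolutelyContinuousOnInterval f a b)
    (h : ∀ᵐ t, t ∈ Icc a b → HasDerivAt f (g t) t) : SolvesODE f g a b := by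
  refine ⟨hg, ?_⟩
  obtain ⟨C, hC⟩ := (hf.fun_sub (hg.absolutelyContinuous_integral hab)).const_of_ae_hasDerivAt_zero
    (by
      filter_upwards [h, hg.ae_hasDerivAt_integral] with t h1 h2 hm
      have := (h1 (by rwa [uIcc_of_le hab] at hm)).sub (h2 hm a left_mem_uIcc)
      rwa [sub_self] at this)
  rw [uIcc_of_le hab] at hC
  intro t ht
  have h1 := hC t ht
  have h2 := hC a ⟨le_rfl, hab⟩
  simp only [intervalIntegral.integral_same, sub_zero] at h2
  rw [← h2] at h1
  rw [← h1]; abel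

theorem IntervalIntegrable.clm_apply_of_continuousOn {A : ℝ → F →L[ℝ] G} {g : ℝ → F} {a b : ℝ}
    (hab : a ≤ b) (hA : ContinuousOn A (Icc a b)) (hg : IntervalIntegrable g volume a b) :
    IntervalIntegrable (fun t => A t (g t)) volume a b := by
  rw [intervalIntegrable_iff_integrableOn_Ioc_of_le hab] at hg ⊢
  obtain ⟨C, hC⟩ := isCompact_Icc.exists_bound_of_continuousOn hA
  refine (hg.norm.const_mul C).mono'
    ((ContinuousLinearMap.id ℝ (F →L[ℝ] G)).aestronglyMeasurable_comp₂
      ((hA.mono Ioc_subset_Icc_self).aestronglyMeasurable measurableSet_Ioc)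
      hg.aestronglyMeasurable) ?_
  rw [ae_restrict_iff' measurableSet_Ioc]
  refine Eventually.of_forall fun t ht => ((A t).le_opNorm _).trans ?_
  gcongr
  exact hC t (Ioc_subset_Icc_self ht)

/-- Chain rule for Carathéodory solutions. -/
theorem SolvesODE.comp_contDiffOn [CompleteSpace F] [CompleteSpace G] {f g : ℝ → F} {a b : ℝ}
    (hab : a ≤ b)
    (h : SolvesODE f g a b) {ψ : F → G} {U : Set F} (hU : IsOpen U) (hψ : ContDiffOn ℝ 1 ψ U)
    (hfU : ∀ t ∈ Icc a b, f t ∈ U) :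
    SolvesODE (fun t => ψ (f t)) (fun t => fderiv ℝ ψ (f t) (g t)) a b := by
  have hfc := h.continuousOn hab
  have hd : ∀ x ∈ U, ContDiffAt ℝ 1 ψ x := fun x hx => hψ.contDiffAt (hU.mem_nhds hx)
  refine .of_absolutelyContinuous hab ?_ ?_ ?_
  · refine IntervalIntegrable.clm_apply_of_continuousOn hab ?_ h.1
    intro t ht
    have := ((hd _ (hfU t ht)).fderiv_right (m := 0) (by simp)).continuousAt
    exact this.comp_continuousWithinAt (hfc t ht)
  · have hK : IsCompact (f '' Icc a b) := isCompact_Icc.image_of_continuousOn hfc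
    have hl : LocallyLipschitzOn (f '' Icc a b) ψ := by
      rintro _ ⟨t, ht, rfl⟩
      obtain ⟨K, s, hs, hL⟩ := (hd _ (hfU t ht)).exists_lipschitzOnWith
      exact ⟨K, s, mem_nhdsWithin_of_mem_nhds hs, hL⟩
    obtain ⟨K, hL⟩ := hl.exists_lipschitzOnWith_of_compact hK
    refine (h.absolutelyContinuous hab).of_dist_le K fun x hx y hy => ?_
    rw [uIcc_of_le hab] at hx hy
    exact hL.dist_le_mul _ (mem_image_of_mem f hx) _ (mem_image_of_mem f hy)
  · filter_upwards [h.ae_hasDerivAt hab] with t ht hm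
    have := ((hd _ (hfU t hm)).differentiableAt (by simp)).hasFDerivAt
    exact this.comp_hasDerivAt t (ht hm)

theorem SolvesODE.comp_contDiff [CompleteSpace F] [CompleteSpace G] {f g : ℝ → F} {a b : ℝ}
    (hab : a ≤ b) (h : SolvesODE f g a b) {ψ : F → G} (hψ : ContDiff ℝ 1 ψ) :
    SolvesODE (fun t => ψ (f t)) (fun t => fderiv ℝ ψ (f t) (g t)) a b :=
  h.comp_contDiffOn hab isOpen_univ hψ.contDiffOn fun _ _ => mem_univ _

theorem SolvesODE.clm [CompleteSpace F] [CompleteSpace G] {f g : ℝ → F} {a b : ℝ}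
    (hab : a ≤ b) (h : SolvesODE f g a b) (A : F →L[ℝ] G) :
    SolvesODE (fun t => A (f t)) (fun t => A (g t)) a b := by
  simpa using h.comp_contDiff hab A.contDiff

theorem SolvesODE.mono {f g : ℝ → F} {a b c d : ℝ} (h : SolvesODE f g a b) (hac : a ≤ c)
    (hcd : c ≤ d) (hdb : d ≤ b) : SolvesODE f g c d := by
  have hab := hac.trans (hcd.trans hdb)
  have ha : a ∈ Icc a b := ⟨le_rfl, hab⟩
  have hc : c ∈ Icc a b := ⟨hac, hcd.trans hdb⟩
  refine ⟨h.1.mono_Icc hab hc ⟨hac.trans hcd, hdb⟩, fun t ht => ?_⟩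
  have ht' : t ∈ Icc a b := ⟨hac.trans ht.1, ht.2.trans hdb⟩
  rw [h.2 t ht', h.2 c hc, add_assoc, intervalIntegral.integral_add_adjacent_intervals
    (h.1.mono_Icc hab ha hc) (h.1.mono_Icc hab hc ht')]

theorem SolvesODE.trans {f g : ℝ → F} {a b c : ℝ} (hab : a ≤ b) (hbc : b ≤ c)
    (h : SolvesODE f g a b) (h' : SolvesODE f g b c) : SolvesODE f g a c := by
  refine ⟨h.1.trans h'.1, fun t ht => ?_⟩
  rcases le_total t b with htb | htb
  · exact h.2 t ⟨ht.1, htb⟩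
  · rw [h'.2 t ⟨htb, ht.2⟩, h.2 b ⟨hab, le_rfl⟩, add_assoc,
      intervalIntegral.integral_add_adjacent_intervals h.1
        (h'.1.mono_Icc hbc ⟨le_rfl, hbc⟩ ⟨htb, ht.2⟩)]

theorem SolvesODE.prodMk [CompleteSpace F] [CompleteSpace G] {f g : ℝ → F} {f' g' : ℝ → G} {a b : ℝ}
    (hab : a ≤ b)
    (h : SolvesODE f g a b) (h' : SolvesODE f' g' a b) :
    SolvesODE (fun t => (f t, f' t)) (fun t => (g t, g' t)) a b := by
  have hi : IntervalIntegrable (fun t => (g t, g' t)) volume a b := by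
    have h1 := h.1; have h2 := h'.1
    rw [intervalIntegrable_iff_integrableOn_Ioc_of_le hab] at h1 h2 ⊢
    exact h1.prodMk h2
  refine ⟨hi, fun t ht => ?_⟩
  have hm := hi.mono_Icc hab ⟨le_rfl, hab⟩ ht
  have e1 := (ContinuousLinearMap.fst ℝ F G).intervalIntegral_comp_comm hm
  have e2 := (ContinuousLinearMap.snd ℝ F G).intervalIntegral_comp_comm hm
  ext1
  · simpa [h.2 t ht] using e1
  · simpa [h'.2 t ht] using e2

theorem SolvesODE.pi {ι : Type*} [Fintype ι] {V : ι → Type*} [∀ i, NormedAddCommGroup (V i)]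
    [∀ i, NormedSpace ℝ (V i)] [∀ i, CompleteSpace (V i)] {f g : ℝ → ∀ i, V i} {a b : ℝ}
    (hab : a ≤ b) (h : ∀ i, SolvesODE (fun t => f t i) (fun t => g t i) a b) :
    SolvesODE f g a b := by
  have hi : IntervalIntegrable g volume a b := by
    rw [intervalIntegrable_iff_integrableOn_Ioc_of_le hab]
    refine Integrable.of_eval fun i => ?_
    have := (h i).1
    rwa [intervalIntegrable_iff_integrableOn_Ioc_of_le hab] at this
  refine ⟨hi, fun t ht => ?_⟩
  have hm := hi.mono_Icc hab ⟨le_rfl, hab⟩ ht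
  funext i
  have e1 := (ContinuousLinearMap.proj (R := ℝ) (φ := V) i).intervalIntegral_comp_comm hm
  have := (h i).2 t ht
  simpa [this] using e1

end AbsolutelyContinuous

/-! ### Grönwall's inequality and Volterra operators -/

section Volterra

variable {E : Type*} [NormedAddCommGroup E] [NormedSpace ℝ E]

/-- With `G = ∫ g`, the function `exp (2G)` has derivative `2 g exp (2G)`, so `∫ g exp (2G) = (exp
(2G) - 1) / 2`. The exponent `2` is chosen to gain the factor `1/2`, which makes Volterra operators
contractions in the weighted norm. -/
theorem integral_mul_exp_le {g : ℝ → ℝ} {a b : ℝ} (hab : a ≤ b)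
    (hg : IntervalIntegrable g volume a b) (hg0 : ∀ t, 0 ≤ g t) {h : ℝ → ℝ} {S : ℝ}
    (hh : ContinuousOn h (Icc a b)) (hS : 0 ≤ S)
    (hle : ∀ t ∈ Icc a b, h t ≤ S * Real.exp (2 * ∫ τ in a..t, g τ)) {t : ℝ} (ht : t ∈ Icc a b) :
    ∫ τ in a..t, g τ * h τ ≤ S / 2 * Real.exp (2 * ∫ τ in a..t, g τ) := by
  have hG : SolvesODE (fun t => ∫ τ in a..t, g τ) g a b := ⟨hg, fun t _ => by simp⟩
  have hψ : ContDiff ℝ 1 fun x : ℝ => Real.exp (2 * x) := by fun_prop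
  have hsol := hG.comp_contDiff hab hψ
  have hfd : ∀ x y : ℝ, fderiv ℝ (fun x : ℝ => Real.exp (2 * x)) x y = 2 * (y * Real.exp (2 * x)) := by
    intro x y
    have : HasDerivAt (fun x : ℝ => Real.exp (2 * x)) (Real.exp (2 * x) * (2 * 1)) x :=
      ((hasDerivAt_id x).const_mul 2).exp
    rw [this.hasFDerivAt.fderiv]
    simp; ring
  simp only [hfd] at hsol
  have h1 := hsol.2 t ht
  rw [intervalIntegral.integral_const_mul] at h1
  simp only [intervalIntegral.integral_same, mul_zero, Real.exp_zero] at h1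
  have hi := hsol.1.const_mul (1 / 2 * S)
  have hm := hi.mono_Icc hab ⟨le_rfl, hab⟩ ht
  have hgh : IntervalIntegrable (fun τ => g τ * h τ) volume a b :=
    hg.mul_continuousOn (by rwa [uIcc_of_le hab])
  have := intervalIntegral.integral_mono_on ht.1 (hgh.mono_Icc hab ⟨le_rfl, hab⟩ ht) hm
    (fun x hx => by
      have := mul_le_mul_of_nonneg_left (hle x ⟨hx.1, hx.2.trans ht.2⟩) (hg0 x)
      calc _ ≤ _ := this
        _ = _ := by ring)
  refine this.trans ?_
  rw [intervalIntegral.integral_const_mul, intervalIntegral.integral_const_mul]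
  nlinarith [Real.exp_pos (2 * ∫ τ in a..t, g τ)]

theorem continuousOn_integral {g : ℝ → E} {a b : ℝ} (hab : a ≤ b)
    (hg : IntervalIntegrable g volume a b) :
    ContinuousOn (fun t => ∫ τ in a..t, g τ) (Icc a b) := by
  simpa [uIcc_of_le hab] using (hg.absolutelyContinuous_integral hab).continuousOn

/-- Grönwall's inequality with an integrable coefficient, homogeneous case. -/
theorem eq_zero_of_le_integral_mul {g : ℝ → ℝ} {a b : ℝ} (hab : a ≤ b)
    (hg : IntervalIntegrable g volume a b) (hg0 : ∀ t, 0 ≤ g t) {φ : ℝ → ℝ}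
    (hφ : ContinuousOn φ (Icc a b)) (hφ0 : ∀ t ∈ Icc a b, 0 ≤ φ t)
    (hle : ∀ t ∈ Icc a b, φ t ≤ ∫ τ in a..t, g τ * φ τ) : ∀ t ∈ Icc a b, φ t = 0 := by
  set G : ℝ → ℝ := fun t => ∫ τ in a..t, g τ with hG
  have hc : ContinuousOn (fun t => φ t * Real.exp (-(2 * G t))) (Icc a b) :=
    hφ.mul ((continuousOn_integral hab hg).const_smul (2 : ℝ)).neg.rexp
  -- At a maximum point of `φ exp (-2G)` the hypothesis and the preceding estimate give `S ≤ S / 2`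
  -- for the maximal value `S ≥ 0`.
  obtain ⟨m, hm, hmax⟩ := isCompact_Icc.exists_isMaxOn ⟨a, le_rfl, hab⟩ hc
  set S := φ m * Real.exp (-(2 * G m)) with hS
  have hS0 : 0 ≤ S := mul_nonneg (hφ0 m hm) (Real.exp_pos _).le
  have hb : ∀ t ∈ Icc a b, φ t ≤ S * Real.exp (2 * G t) := by
    intro t ht
    have : φ t * Real.exp (-(2 * G t)) ≤ S := hmax ht
    calc φ t = φ t * Real.exp (-(2 * G t)) * Real.exp (2 * G t) := by
          rw [mul_assoc, ← Real.exp_add]; simp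
      _ ≤ _ := by gcongr
  have h1 := (hle m hm).trans (integral_mul_exp_le hab hg hg0 hφ hS0 hb hm)
  have h2 : S ≤ S / 2 := by
    calc S ≤ S / 2 * Real.exp (2 * G m) * Real.exp (-(2 * G m)) := by
          rw [hS]; gcongr
      _ = S / 2 := by rw [mul_assoc, ← Real.exp_add]; simp
  have h3 : S = 0 := by linarith
  intro t ht
  have := hb t ht
  rw [h3, zero_mul] at this
  exact le_antisymm this (hφ0 t ht)

/-- Pointwise multiplication by a continuous scalar function, as an operator. -/
noncomputable def smulOperator {K : Type*} [TopologicalSpace K] [CompactSpace K] (c : C(K, ℝ)) :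
    C(K, E) →L[ℝ] C(K, E) :=
  LinearMap.mkContinuous
    { toFun := fun h => ⟨fun t => c t • h t, by fun_prop⟩
      map_add' := fun h h' => by ext; simp
      map_smul' := fun r h => by ext t; exact smul_comm _ _ _ } ‖c‖ fun h => by
    rw [ContinuousMap.norm_le _ (by positivity)]
    intro t
    simp only [LinearMap.coe_mk, AddHom.coe_mk, ContinuousMap.coe_mk, norm_smul]
    gcongr
    · exact c.norm_coe_le_norm t
    · exact h.norm_coe_le_norm t

@[simp]
theorem smulOperator_apply {K : Type*} [TopologicalSpace K] [CompactSpace K] (c : C(K, ℝ))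
    (h : C(K, E)) (t : K) : smulOperator c h t = c t • h t := rfl

/-- A Volterra operator `h ↦ ∫ₐᵗ A(τ) h(τ) dτ` does not have the eigenvalue `1`. -/
theorem isUnit_one_sub_of_volterra [CompleteSpace E] {a b : ℝ} (hab : a ≤ b) {g : ℝ → ℝ}
    (hg : IntervalIntegrable g volume a b) (hg0 : ∀ t, 0 ≤ g t)
    (K : C(Icc a b, E) →L[ℝ] C(Icc a b, E))
    (hK : ∀ h t, ‖K h t‖ ≤ ∫ τ in a..t, g τ * ‖IccExtend hab h τ‖) : IsUnit (1 - K) := by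
  have hGc : Continuous fun t : Icc a b => ∫ τ in a..(t : ℝ), g τ :=
    (continuousOn_integral hab hg).domRestrict
  -- Conjugating by the weight `exp (-2G)` amounts to using a weighted sup norm. In it `K` has norm
  -- at most `1/2`, so the Neumann series converges whatever the size of `∫ g`.
  let w : C(Icc a b, ℝ) := ⟨fun t => Real.exp (-(2 * ∫ τ in a..(t : ℝ), g τ)), by fun_prop⟩
  let w' : C(Icc a b, ℝ) := ⟨fun t => Real.exp (2 * ∫ τ in a..(t : ℝ), g τ), by fun_prop⟩
  let W : C(Icc a b, E) →L[ℝ] C(Icc a b, E) := smulOperator w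
  let W' : C(Icc a b, E) →L[ℝ] C(Icc a b, E) := smulOperator w'
  have hww : ∀ t, w t * w' t = 1 := fun t => by
    change Real.exp _ * Real.exp _ = 1
    rw [← Real.exp_add]; simp
  have h1 : W * W' = 1 := by
    ext h t
    simp [W, W', smul_smul, hww t]
  have h2 : W' * W = 1 := by
    ext h t
    simp [W, W', smul_smul, mul_comm (w' t), hww t]
  have hbound : ‖W * K * W'‖ ≤ 1 / 2 := by
    refine ContinuousLinearMap.opNorm_le_bound _ (by norm_num) fun h => ?_
    rw [ContinuousMap.norm_le _ (by positivity)]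
    intro t
    have hcont : Continuous (IccExtend hab (W' h)) := (W' h).continuous.Icc_extend'
    have hle : ∀ τ ∈ Icc a b, ‖IccExtend hab (W' h) τ‖
        ≤ ‖h‖ * Real.exp (2 * ∫ σ in a..τ, g σ) := by
      intro τ hτ
      rw [IccExtend_of_mem hab _ hτ]
      change ‖Real.exp _ • h ⟨τ, hτ⟩‖ ≤ _
      rw [norm_smul, Real.norm_of_nonneg (Real.exp_pos _).le, mul_comm]
      gcongr
      exact h.norm_coe_le_norm _
    have h3 := (hK (W' h) t).trans (integral_mul_exp_le hab hg hg0 hcont.norm.continuousOn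
      (norm_nonneg h) hle t.2)
    change ‖Real.exp _ • K (W' h) t‖ ≤ _
    rw [norm_smul, Real.norm_of_nonneg (Real.exp_pos _).le]
    calc _ ≤ Real.exp (-(2 * ∫ τ in a..(t : ℝ), g τ)) *
            (‖h‖ / 2 * Real.exp (2 * ∫ τ in a..(t : ℝ), g τ)) := by gcongr
      _ = 1 / 2 * ‖h‖ *
          (Real.exp (-(2 * ∫ τ in a..(t : ℝ), g τ)) * Real.exp (2 * ∫ τ in a..(t : ℝ), g τ)) := by
        ring
      _ = 1 / 2 * ‖h‖ := by rw [← Real.exp_add]; simp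
  have hu : IsUnit (1 - W * K * W') :=
    isUnit_one_sub_of_norm_lt_one (x := W * K * W')
      (hbound.trans_lt (by norm_num : (1 / 2 : ℝ) < 1))
  let U : (C(Icc a b, E) →L[ℝ] C(Icc a b, E))ˣ := ⟨W, W', h1, h2⟩
  have : 1 - K = W' * (1 - W * K * W') * W := by
    rw [mul_sub, sub_mul, mul_one, h2, mul_assoc W, ← mul_assoc W', h2, one_mul, mul_assoc, h2,
      mul_one]
  rw [this]
  exact (U⁻¹.isUnit.mul hu).mul U.isUnit

end Volterra

/-! ### Integral and composition operators on `C(K, E)` -/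

section Operators

universe v

/-- `h ↦ ∫ₐᵗ w(τ) h(τ) dτ` as an operator on `C([a, b], E)`. -/
noncomputable def integralOperator {E : Type*} [NormedAddCommGroup E] [NormedSpace ℝ E] {a b : ℝ}
    (hab : a ≤ b) (w : ℝ → ℝ) (hw : IntervalIntegrable w volume a b) :
    C(Icc a b, E) →L[ℝ] C(Icc a b, E) :=
  have hi (h : C(Icc a b, E)) :
      IntervalIntegrable (fun τ => w τ • IccExtend hab h τ) volume a b :=
    hw.smul_continuousOn h.continuous.Icc_extend'.continuousOn
  have hc (h : C(Icc a b, E)) :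
      Continuous fun t : Icc a b => ∫ τ in a..t, w τ • IccExtend hab h τ :=
    (continuousOn_integral hab (hi h)).domRestrict
  LinearMap.mkContinuous
    { toFun := fun h => ⟨fun t => ∫ τ in a..t, w τ • IccExtend hab h τ, hc h⟩
      map_add' := fun h h' => by
        ext t
        have ht := t.2
        simp only [ContinuousMap.coe_mk, ContinuousMap.add_apply]
        rw [← intervalIntegral.integral_add ((hi h).mono_Icc hab ⟨le_rfl, hab⟩ ht)
          ((hi h').mono_Icc hab ⟨le_rfl, hab⟩ ht)]
        simp [IccExtend]
      map_smul' := fun r h => by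
        ext t
        simp only [ContinuousMap.coe_mk, ContinuousMap.smul_apply, RingHom.id_apply]
        rw [← intervalIntegral.integral_smul]
        simp [IccExtend, smul_comm r] }
    (∫ τ in a..b, |w τ|) fun h => by
      have hpos : 0 ≤ ∫ τ in a..b, |w τ| :=
        intervalIntegral.integral_nonneg hab fun _ _ => abs_nonneg _
      rw [ContinuousMap.norm_le _ (by positivity)]
      intro t
      have ht := t.2
      simp only [LinearMap.coe_mk, AddHom.coe_mk, ContinuousMap.coe_mk]
      refine (intervalIntegral.norm_integral_le_integral_norm ht.1).trans ?_
      calc ∫ τ in a..(t : ℝ), ‖w τ • IccExtend hab h τ‖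
          ≤ ∫ τ in a..(t : ℝ), |w τ| * ‖h‖ := by
            refine intervalIntegral.integral_mono_on ht.1
              ((hi h).norm.mono_Icc hab ⟨le_rfl, hab⟩ ht)
              ((hw.norm.mul_const _).mono_Icc hab ⟨le_rfl, hab⟩ ht) fun τ _ => ?_
            rw [norm_smul, Real.norm_eq_abs]
            gcongr
            exact h.norm_coe_le_norm _
        _ ≤ ∫ τ in a..b, |w τ| * ‖h‖ := by
            refine intervalIntegral.integral_mono_interval le_rfl ht.1 ht.2 ?_
              (hw.norm.mul_const _)
            exact Eventually.of_forall fun τ => by positivity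
        _ = _ := by rw [intervalIntegral.integral_mul_const]

@[simp]
theorem integralOperator_apply {E : Type*} [NormedAddCommGroup E] [NormedSpace ℝ E] {a b : ℝ}
    (hab : a ≤ b) (w : ℝ → ℝ) (hw : IntervalIntegrable w volume a b) (h : C(Icc a b, E))
    (t : Icc a b) :
    integralOperator hab w hw h t = ∫ τ in a..t, w τ • IccExtend hab h τ := rfl

/-- Pointwise application `A ↦ (h ↦ (t ↦ A(t) h(t)))`. -/
noncomputable def pointwiseApply (K : Type*) [TopologicalSpace K] [CompactSpace K]
    (E F : Type*) [NormedAddCommGroup E] [NormedSpace ℝ E] [NormedAddCommGroup F]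
    [NormedSpace ℝ F] : C(K, E →L[ℝ] F) →L[ℝ] C(K, E) →L[ℝ] C(K, F) :=
  LinearMap.mkContinuous₂
    (LinearMap.mk₂ ℝ (fun (A : C(K, E →L[ℝ] F)) (h : C(K, E)) =>
        (⟨fun t => A t (h t), by fun_prop⟩ : C(K, F)))
      (fun _ _ _ => by ext; simp) (fun _ _ _ => by ext; simp) (fun _ _ _ => by ext; simp)
      (fun _ _ _ => by ext; simp)) 1 fun A h => by
    rw [ContinuousMap.norm_le _ (by positivity)]
    intro t
    rw [one_mul]
    exact ((A t).le_opNorm _).trans (mul_le_mul (A.norm_coe_le_norm t) (h.norm_coe_le_norm t)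
      (norm_nonneg _) (norm_nonneg A))

@[simp]
theorem pointwiseApply_apply {K : Type*} [TopologicalSpace K] [CompactSpace K]
    {E F : Type*} [NormedAddCommGroup E] [NormedSpace ℝ E] [NormedAddCommGroup F]
    [NormedSpace ℝ F] (A : C(K, E →L[ℝ] F)) (h : C(K, E)) (t : K) :
    pointwiseApply K E F A h t = A t (h t) := rfl

/-- The map `h ↦ DY ∘ (x + h)` is continuous in the sup norm, so for small `k` the derivative of `Y`
varies by less than `ε` on every segment from `x t` to `x t + k t`. The mean value inequality at
each `t` then gives an error at most `ε ‖k‖`, uniformly in `t`. -/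
theorem hasFDerivAt_continuousMap_comp {K : Type*} [TopologicalSpace K] [CompactSpace K]
    {E F : Type*} [NormedAddCommGroup E] [NormedSpace ℝ E] [NormedAddCommGroup F]
    [NormedSpace ℝ F] (Y : C(E, F)) (DY : C(E, E →L[ℝ] F)) (h : ∀ x, HasFDerivAt Y (DY x) x)
    (x : C(K, E)) :
    HasFDerivAt (fun x : C(K, E) => Y.comp x) (pointwiseApply K E F (DY.comp x)) x := by
  rw [hasFDerivAt_iff_isLittleO_nhds_zero, Asymptotics.isLittleO_iff]
  intro ε hε
  have hc : Continuous fun h : C(K, E) => DY.comp (x + h) :=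
    (ContinuousMap.continuous_postcomp DY).comp (by fun_prop)
  have h0 := (Metric.tendsto_nhds_nhds (α := C(K, E)) (β := C(K, E →L[ℝ] F))).1 (hc.tendsto 0) ε hε
  obtain ⟨δ, hδ, hd⟩ := h0
  filter_upwards [Metric.ball_mem_nhds 0 hδ] with k hk
  rw [ContinuousMap.norm_le _ (by positivity)]
  intro t
  have hmv := (convex_segment (x t) (x t + k t)).norm_image_sub_le_of_norm_hasFDerivWithin_le'
    (f := Y) (f' := DY) (φ := DY (x t)) (C := ε)
    (fun y _ => (h y).hasFDerivWithinAt) (fun y hy => by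
      rw [segment_eq_image_lineMap] at hy
      obtain ⟨θ, hθ, rfl⟩ := hy
      have hm : dist (θ • k) 0 < δ := by
        rw [dist_zero_right, norm_smul]
        rw [mem_ball_zero_iff] at hk
        refine lt_of_le_of_lt ?_ hk
        rw [Real.norm_of_nonneg hθ.1]
        exact mul_le_of_le_one_left (norm_nonneg _) hθ.2
      have := hd hm
      have h2 := (ContinuousMap.dist_apply_le_dist t).trans this.le
      rw [dist_eq_norm (E := E →L[ℝ] F)] at h2
      simpa [AffineMap.lineMap_apply, add_comm] using h2)
    (left_mem_segment ℝ _ _) (right_mem_segment ℝ _ _)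
  rw [add_sub_cancel_left] at hmv
  refine le_trans (by simpa using hmv) ?_
  gcongr
  exact k.norm_coe_le_norm t

/-- The derivative is a continuous linear function of the composition operator of `DY`, so induction
on the order applies. It replaces `F` by `E →L[ℝ] F`; `E` and `F` share a universe so that this
space stays in the range of the induction hypothesis. -/
theorem contDiff_continuousMap_comp {K : Type*} [TopologicalSpace K] [CompactSpace K]
    {E F : Type v} [NormedAddCommGroup E] [NormedSpace ℝ E] [NormedAddCommGroup F]
    [NormedSpace ℝ F] (Y : C(E, F)) (hY : ContDiff ℝ ∞ Y) :
    ContDiff ℝ ∞ fun x : C(K, E) => Y.comp x := by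
  rw [contDiff_infty]
  intro n
  induction n generalizing F with
  | zero =>
    exact contDiff_zero.2 (ContinuousMap.continuous_postcomp Y)
  | succ n ih =>
    have hfd : ContDiff ℝ ∞ (fderiv ℝ Y) := hY.fderiv_right (by simp)
    let DY : C(E, E →L[ℝ] F) := ⟨fderiv ℝ Y, hfd.continuous⟩
    rw [Nat.cast_add, Nat.cast_one, contDiff_succ_iff_hasFDerivAt]
    have h1 := ih DY hfd
    have h2 := ContinuousLinearMap.contDiff (𝕜 := ℝ) (E := C(K, E →L[ℝ] F))
      (F := C(K, E) →L[ℝ] C(K, F)) (n := n) (pointwiseApply K E F)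
    refine ⟨fun x => pointwiseApply K E F (DY.comp x), h2.comp h1, fun x => ?_⟩
    exact hasFDerivAt_continuousMap_comp Y DY
      (fun x => (hY.differentiable (by simp) x).hasFDerivAt) x

end Operators

/-! ### Smooth dependence of solutions on the parameter -/

section SmoothFamily

universe v

variable {E : Type v} [NormedAddCommGroup E] [NormedSpace ℝ E] {l : ℕ}

/-- This is unique solvability of the linear equation with coefficients `∑ uᵢ Aᵢ`, obtained from the
Volterra bound with density `∑ ‖Aᵢ‖ |uᵢ|`. It provides the invertible derivative for the implicit
function theorem and, later, solutions of linear equations. -/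
theorem isUnit_one_sub_sum_integralOperator [CompleteSpace E] {a b : ℝ} (hab : a ≤ b)
    {u : ℝ → Fin l → ℝ} (hu : ∀ i, IntervalIntegrable (fun t => u t i) volume a b)
    (A : Fin l → C(Icc a b, E →L[ℝ] E)) :
    IsUnit (1 - ∑ i, (integralOperator hab (fun t => u t i) (hu i)).comp
      (pointwiseApply (Icc a b) E E (A i))) := by
  have hint (i : Fin l) (h : C(Icc a b, E)) : IntervalIntegrable
      (fun τ => ‖A i‖ * |u τ i| * ‖IccExtend hab h τ‖) volume a b := by
    have := ((hu i).norm.const_mul ‖A i‖).mul_continuousOn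
      (g := fun τ => ‖IccExtend hab h τ‖) h.continuous.Icc_extend'.norm.continuousOn
    simpa using this
  refine isUnit_one_sub_of_volterra hab (g := fun t => ∑ i, ‖A i‖ * |u t i|)
    (by
      have := IntervalIntegrable.sum (μ := volume) (a := a) (b := b) Finset.univ
        (f := fun i t => ‖A i‖ * |u t i|) fun i _ => (hu i).norm.const_mul ‖A i‖
      simpa [Finset.sum_fn] using this)
    (fun t => Finset.sum_nonneg fun _ _ => by positivity) _ fun h t => ?_
  have ht := t.2
  have e1 : (∑ i, (integralOperator hab (fun t => u t i) (hu i)).comp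
      (pointwiseApply (Icc a b) E E (A i))) h t = ∑ i, integralOperator hab (fun t => u t i) (hu i)
        (pointwiseApply (Icc a b) E E (A i) h) t := by
    simp [ContinuousMap.sum_apply]
  rw [e1]
  refine (norm_sum_le _ _).trans ?_
  simp_rw [Finset.sum_mul]
  rw [intervalIntegral.integral_finsetSum fun i _ =>
    (hint i h).mono_Icc hab ⟨le_rfl, hab⟩ ht]
  refine Finset.sum_le_sum fun i _ => ?_
  rw [integralOperator_apply]
  refine intervalIntegral.norm_integral_le_of_norm_le ht.1 (Eventually.of_forall fun τ hτ => ?_)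
    ((hint i h).mono_Icc hab ⟨le_rfl, hab⟩ ht)
  have hτ' : τ ∈ Icc a b := ⟨hτ.1.le, hτ.2.trans ht.2⟩
  rw [IccExtend_of_mem hab _ hτ', IccExtend_of_mem hab _ hτ', pointwiseApply_apply, norm_smul,
    Real.norm_eq_abs, mul_comm ‖A i‖, mul_assoc]
  gcongr
  exact ((A i _).le_opNorm _).trans (by gcongr; exact (A i).norm_coe_le_norm _)

/-- The solutions of `x' = ∑ (uᵢ + s Δuᵢ) Yᵢ(x)`, `x(a) = γ(s)` near a given solution for `s = 0`
depend smoothly on the parameter `s`, as elements of the Banach space `C([a, b], E)`. -/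
theorem exists_contDiffAt_solution_family [CompleteSpace E] {a b : ℝ} (hab : a ≤ b)
    {u Δu : ℝ → Fin l → ℝ} (hu : ∀ i, IntervalIntegrable (fun t => u t i) volume a b)
    (hΔu : ∀ i, IntervalIntegrable (fun t => Δu t i) volume a b)
    (Y : Fin l → C(E, E)) (hY : ∀ i, ContDiff ℝ ∞ (Y i)) {γ : ℝ → E} (hγ : ContDiffAt ℝ ∞ γ 0)
    (x₀ : C(Icc a b, E))
    (hx₀ : x₀ = ContinuousMap.const _ (γ 0) +
      ∑ i, integralOperator hab (fun t => u t i) (hu i) ((Y i).comp x₀)) :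
    ∃ x : ℝ → C(Icc a b, E), ContDiffAt ℝ ∞ x 0 ∧ x 0 = x₀ ∧
      ∀ᶠ s in 𝓝 0, x s = ContinuousMap.const _ (γ s) +
        ∑ i, (integralOperator hab (fun t => u t i) (hu i) ((Y i).comp (x s)) +
          s • integralOperator hab (fun t => Δu t i) (hΔu i) ((Y i).comp (x s))) := by
  let cst : E →L[ℝ] C(Icc a b, E) := ContinuousLinearMap.const ℝ (Icc a b)
  -- The zeros of `F` are the solutions of the integral equation with control `u + s Δu` and initial
  -- value `γ s`.
  let F : ℝ × C(Icc a b, E) → C(Icc a b, E) := fun p => p.2 - cst (γ p.1) -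
    ∑ i, (integralOperator hab (fun t => u t i) (hu i) ((Y i).comp p.2) +
      p.1 • integralOperator hab (fun t => Δu t i) (hΔu i) ((Y i).comp p.2))
  have hN (i : Fin l) : ContDiff ℝ ∞ fun p : ℝ × C(Icc a b, E) => (Y i).comp p.2 :=
    (contDiff_continuousMap_comp (K := Icc a b) (Y i) (hY i)).comp contDiff_snd
  have hFc : ContDiffAt ℝ ∞ F (0, x₀) := by
    have h1 : ContDiffAt ℝ ∞ (fun p : ℝ × C(Icc a b, E) => cst (γ p.1)) (0, x₀) :=
      cst.contDiff.contDiffAt.comp _ (ContDiffAt.comp (0, x₀) (f := Prod.fst) hγ contDiffAt_fst)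
    have h2 (i : Fin l) (w : ℝ → ℝ) (hw : IntervalIntegrable w volume a b) :
        ContDiff ℝ ∞ fun p : ℝ × C(Icc a b, E) =>
          integralOperator hab w hw ((Y i).comp p.2) :=
      (ContinuousLinearMap.contDiff (E := C(Icc a b, E)) (F := C(Icc a b, E))
        (integralOperator hab w hw)).comp (hN i)
    refine (contDiffAt_snd.sub h1).sub (ContDiffAt.sum fun i _ => ?_)
    exact ((h2 i _ (hu i)).add (contDiff_fst.smul (h2 i _ (hΔu i)))).contDiffAt
  let DY (i : Fin l) : C(E, E →L[ℝ] E) :=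
    ⟨fderiv ℝ (Y i), ((hY i).fderiv_right (m := ∞) (by simp)).continuous⟩
  -- At `s = 0` the terms with `Δu` vanish, so the partial derivative in `x` is `1` minus the
  -- Volterra operator of the linearised reference system.
  have hpart : HasFDerivAt (fun x => F (0, x))
      (1 - ∑ i, (integralOperator hab (fun t => u t i) (hu i)).comp
        (pointwiseApply (Icc a b) E E ((DY i).comp x₀))) x₀ := by
    have h3 (i : Fin l) := hasFDerivAt_continuousMap_comp (K := Icc a b) (Y i) (DY i)
      (fun x => ((hY i).differentiable (by simp) x).hasFDerivAt) x₀
    have h4 (i : Fin l) : HasFDerivAt (fun x : C(Icc a b, E) =>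
        integralOperator hab (fun t => u t i) (hu i) ((Y i).comp x))
        ((integralOperator hab (fun t => u t i) (hu i)).comp
        (pointwiseApply (Icc a b) E E ((DY i).comp x₀))) x₀ :=
      (ContinuousLinearMap.hasFDerivAt (E := C(Icc a b, E)) (F := C(Icc a b, E))
        (integralOperator hab (fun t => u t i) (hu i))).comp x₀ (h3 i)
    have h5 := ((hasFDerivAt_id x₀).sub_const (cst (γ 0))).sub
      (HasFDerivAt.fun_sum (u := Finset.univ) fun i _ => h4 i)
    have e : (fun x => F (0, x)) = (fun x : C(Icc a b, E) => id x - cst (γ 0)) - fun x =>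
        ∑ i, integralOperator hab (fun t => u t i) (hu i) ((Y i).comp x) := by
      funext x
      simp [F]
    rw [e]
    exact h5
  have hinv : (fderiv ℝ F (0, x₀) ∘L .inr ℝ ℝ C(Icc a b, E)).IsInvertible := by
    have h6 : HasFDerivAt (fun x => F (0, x)) (fderiv ℝ F (0, x₀) ∘L .inr ℝ ℝ C(Icc a b, E)) x₀ :=
      (hFc.differentiableAt (by simp)).hasFDerivAt.comp x₀ (hasFDerivAt_prodMk_right 0 x₀)
    rw [h6.unique hpart]
    obtain ⟨U, hU⟩ := isUnit_one_sub_sum_integralOperator hab hu fun i => (DY i).comp x₀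
    rw [← hU]
    exact ⟨ContinuousLinearEquiv.unitsEquiv ℝ _ U, rfl⟩
  obtain ⟨x, hx, hx0, hxF⟩ : ∃ x : ℝ → C(Icc a b, E), ContDiffAt ℝ ∞ x 0 ∧ x 0 = x₀ ∧
      ∀ᶠ s in 𝓝 0, F (s, x s) = F (0, x₀) :=
    ⟨hFc.implicitFunction (by simp) hinv, hFc.contDiffAt_implicitFunction (by simp) hinv,
      hFc.implicitFunction_apply_self (by simp) hinv,
      hFc.eventually_apply_implicitFunction (by simp) hinv⟩
  refine ⟨x, hx, hx0, ?_⟩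
  have h0 : F (0, x₀) = 0 := by
    simp only [F, zero_smul, add_zero]
    nth_rw 1 [hx₀]
    rw [sub_sub, sub_eq_zero]
    rfl
  filter_upwards [hxF] with s hs
  rw [h0] at hs
  have hc : cst (γ s) = ContinuousMap.const _ (γ s) := rfl
  simp only [F, sub_sub, sub_eq_zero, hc] at hs
  exact hs

end SmoothFamily

/-! ### Vector fields in charts -/

section LocalFields

variable {n : ℕ} {M : Type*} [TopologicalSpace M] [ChartedSpace (EuclideanSpace ℝ (Fin n)) M]

theorem contDiffOn_chart_change {e e' : OpenPartialHomeomorph M (EuclideanSpace ℝ (Fin n))}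
    (he : e ∈ IsManifold.maximalAtlas (𝓡 n) ∞ M) (he' : e' ∈ IsManifold.maximalAtlas (𝓡 n) ∞ M) :
    ContDiffOn ℝ ∞ (fun x => e' (e.symm x)) (e.symm.trans e').source := by
  have h1 : ContMDiffOn (𝓡 n) (𝓡 n) ∞ e' e'.source := contMDiffOn_of_mem_maximalAtlas he'
  have h2 : ContMDiffOn (𝓡 n) (𝓡 n) ∞ e.symm e.target := contMDiffOn_symm_of_mem_maximalAtlas he
  rw [← contMDiffOn_iff_contDiffOn]
  refine h1.comp (h2.mono ?_) ?_
  · intro x hx; exact hx.1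
  · intro x hx; exact hx.2

/-- Near `p` the chart `e'` is the transition map after `e`, so the chain rule for `mfderiv` relates
the two local fields. -/
theorem localField_chart_change (X : (p : M) → TangentSpace (𝓡 n) p)
    {e e' : OpenPartialHomeomorph M (EuclideanSpace ℝ (Fin n))}
    (he : e ∈ IsManifold.maximalAtlas (𝓡 n) ∞ M) (he' : e' ∈ IsManifold.maximalAtlas (𝓡 n) ∞ M)
    {p : M} (hp : p ∈ e.source) (hp' : p ∈ e'.source) :
    fderiv ℝ (fun x => e' (e.symm x)) (e p) (localField X e (e p)) = localField X e' (e' p) := by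
  have h1 : MDifferentiableAt (𝓡 n) (𝓡 n) e p :=
    (contMDiffAt_of_mem_maximalAtlas he hp).mdifferentiableAt (by simp)
  have hc := contDiffOn_chart_change he he'
  have hmem : e p ∈ (e.symm.trans e').source := by
    simp [hp, hp']
  have hd : DifferentiableAt ℝ (fun x => e' (e.symm x)) (e p) :=
    (hc.contDiffAt ((e.symm.trans e').open_source.mem_nhds hmem)).differentiableAt (by simp)
  have h2 : MDifferentiableAt (𝓡 n) (𝓡 n) (fun x => e' (e.symm x)) (e p) :=
    hd.mdifferentiableAt
  have h3 := mfderiv_comp_apply p h2 h1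
  have h4 : mfderiv (𝓡 n) (𝓡 n) ((fun x => e' (e.symm x)) ∘ e) p = mfderiv (𝓡 n) (𝓡 n) e' p := by
    refine Filter.EventuallyEq.mfderiv_eq ?_
    filter_upwards [e.open_source.mem_nhds hp] with y hy
    simp [hy]
  unfold localField
  rw [e.left_inv hp, e'.left_inv hp', ← mfderiv_eq_fderiv]
  exact (h3 (X p)).symm.trans (DFunLike.congr_fun h4 (X p))

variable [IsManifold (𝓡 n) ∞ M]

/-- The local field is the fibre component of the tangent map of `e` applied to the smooth section
`X` along `e.symm`. -/
theorem contDiffOn_localField {X : (p : M) → TangentSpace (𝓡 n) p}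
    (hX : ContMDiff (𝓡 n) (𝓡 n).tangent ∞ (fun p => (⟨p, X p⟩ : TangentBundle (𝓡 n) M)))
    {e : OpenPartialHomeomorph M (EuclideanSpace ℝ (Fin n))}
    (he : e ∈ IsManifold.maximalAtlas (𝓡 n) ∞ M) :
    ContDiffOn ℝ ∞ (localField X e) e.target := by
  have : IsManifold (𝓡 n) (1 : WithTop ℕ∞) M := .of_le (n := ∞) (by simp)
  have h1 : ContMDiffOn (𝓡 n) (𝓡 n) ∞ e e.source := contMDiffOn_of_mem_maximalAtlas he
  have h2 : ContMDiffOn (𝓡 n) (𝓡 n) ∞ e.symm e.target := contMDiffOn_symm_of_mem_maximalAtlas he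
  have h3 := h1.contMDiffOn_tangentMapWithin (m := ∞) (by simp) e.open_source.uniqueMDiffOn
  have h4 : ContMDiffOn (𝓡 n) (𝓡 n).tangent ∞
      (fun x => (⟨e.symm x, X (e.symm x)⟩ : TangentBundle (𝓡 n) M)) e.target :=
    hX.comp_contMDiffOn h2
  have h5 := (contMDiff_snd_tangentBundle_modelSpace (n := ∞) (EuclideanSpace ℝ (Fin n))
    (𝓡 n)).comp_contMDiffOn (h3.comp h4 fun x hx => e.map_target hx)
  rw [← contMDiffOn_iff_contDiffOn]
  refine h5.congr fun x hx => ?_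
  exact (DFunLike.congr_fun (mfderivWithin_of_isOpen (I := 𝓡 n) (I' := 𝓡 n) (f := e)
    e.open_source (e.map_target hx)) (X (e.symm x))).symm

end LocalFields

/-! ### Restriction, concatenation and chart independence of trajectories -/

section Trajectories

variable {n l : ℕ} {M : Type*} [TopologicalSpace M] [ChartedSpace (EuclideanSpace ℝ (Fin n)) M]

/-- `q` is a trajectory of `q' = ∑ vᵢ Xᵢ(q)` on the time interval `[a, b]`. -/
def IsTrajectoryOn (X : Fin l → (p : M) → TangentSpace (𝓡 n) p) (v : ℝ → Fin l → ℝ) (a b : ℝ)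
    (q : ℝ → M) : Prop :=
  ContinuousOn q (Icc a b) ∧
    ∀ e ∈ IsManifold.maximalAtlas (𝓡 n) ∞ M, ∀ c d : ℝ, a ≤ c → c ≤ d → d ≤ b →
      (∀ t ∈ Icc c d, q t ∈ e.source) →
      SolvesODE (fun t => e (q t)) (fun t => ∑ i, v t i • localField (X i) e (e (q t))) c d

variable {X : Fin l → (p : M) → TangentSpace (𝓡 n) p} {v : ℝ → Fin l → ℝ} {a b c : ℝ}

theorem isTrajectory_iff {q₀ : M} {T : ℝ} {q : ℝ → M} :
    IsTrajectory X v q₀ T q ↔ q 0 = q₀ ∧ IsTrajectoryOn X v 0 T q := by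
  unfold IsTrajectory IsTrajectoryOn
  tauto

theorem IsTrajectoryOn.mono {q : ℝ → M} (h : IsTrajectoryOn X v a b q) {a' b' : ℝ} (ha : a ≤ a')
    (hb : b' ≤ b) : IsTrajectoryOn X v a' b' q :=
  ⟨h.1.mono (Icc_subset_Icc ha hb), fun e he c d hc hcd hd =>
    h.2 e he c d (ha.trans hc) hcd (hd.trans hb)⟩

theorem IsTrajectoryOn.congr {q q' : ℝ → M} (h : IsTrajectoryOn X v a b q)
    (hq : EqOn q' q (Icc a b)) : IsTrajectoryOn X v a b q' := by
  refine ⟨h.1.congr hq, fun e he c d hc hcd hd hs => ?_⟩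
  have hq' : EqOn q' q (Icc c d) := hq.mono (Icc_subset_Icc hc hd)
  refine (h.2 e he c d hc hcd hd fun t ht => hq' ht ▸ hs t ht).congr hcd
    (fun t ht => by rw [hq' ht]) (Eventually.of_forall fun t ht => by rw [hq' ht])

theorem IsTrajectoryOn.trans {q : ℝ → M} (hab : a ≤ b) (hbc : b ≤ c)
    (h : IsTrajectoryOn X v a b q)
    (h' : IsTrajectoryOn X v b c q) : IsTrajectoryOn X v a c q := by
  refine ⟨?_, fun e he c' d' hc hcd hd hs => ?_⟩
  · rw [← Icc_union_Icc_eq_Icc hab hbc]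
    exact h.1.union_of_isClosed h'.1 isClosed_Icc isClosed_Icc
  · rcases le_total b c' with h1 | h1
    · exact h'.2 e he c' d' h1 hcd hd hs
    rcases le_total d' b with h2 | h2
    · exact h.2 e he c' d' hc hcd h2 hs
    exact (h.2 e he c' b hc h1 le_rfl fun t ht => hs t ⟨ht.1, ht.2.trans h2⟩).trans h1 h2
      (h'.2 e he b d' le_rfl h2 hd fun t ht => hs t ⟨h1.trans ht.1, ht.2⟩)

/-- The equation in one chart implies the equation in every other one, by the Carathéodory chain
rule applied to the transition map and by the transformation law of the fields. -/
theorem IsTrajectoryOn.of_chart (hab : a ≤ b) {q : ℝ → M}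
    {e : OpenPartialHomeomorph M (EuclideanSpace ℝ (Fin n))}
    (he : e ∈ IsManifold.maximalAtlas (𝓡 n) ∞ M) (hq : ∀ t ∈ Icc a b, q t ∈ e.source)
    (h : SolvesODE (fun t => e (q t)) (fun t => ∑ i, v t i • localField (X i) e (e (q t))) a b) :
    IsTrajectoryOn X v a b q := by
  refine ⟨?_, fun e' he' c d hc hcd hd hs => ?_⟩
  · have h1 : ContinuousOn (fun t => e.symm (e (q t))) (Icc a b) :=
      e.continuousOn_symm.comp (h.continuousOn hab) fun t ht => e.map_source (hq t ht)
    exact h1.congr fun t ht => (e.left_inv (hq t ht)).symm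
  · have hsub : ∀ t ∈ Icc c d, q t ∈ e.source := fun t ht => hq t ⟨hc.trans ht.1, ht.2.trans hd⟩
    have h2 := (h.mono hc hcd hd).comp_contDiffOn hcd (e.symm.trans e').open_source
      ((contDiffOn_chart_change he he').of_le (by simp)) fun t ht => by
        simp [hsub t ht, hs t ht]
    refine h2.congr hcd (fun t ht => ?_) (Eventually.of_forall fun t ht => ?_)
    · rw [e.left_inv (hsub t ht)]
    · simp only [map_sum, map_smul]
      refine Finset.sum_congr rfl fun i _ => ?_
      rw [localField_chart_change (X i) he he' (hsub t ht) (hs t ht)]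

end Trajectories

/-! ### Uniqueness of trajectories -/

section Uniqueness

variable {n l : ℕ} {M : Type*} [TopologicalSpace M] [ChartedSpace (EuclideanSpace ℝ (Fin n)) M]
  [IsManifold (𝓡 n) ∞ M] {X : Fin l → (p : M) → TangentSpace (𝓡 n) p}

/-- Local uniqueness for Carathéodory solutions of a control system with Lipschitz fields. -/
theorem SolvesODE.eqOn_of_lipschitz {E : Type*} [NormedAddCommGroup E] [NormedSpace ℝ E]
    {a b : ℝ} (hab : a ≤ b)
    {v : ℝ → Fin l → ℝ} (hv : ∀ i, IntervalIntegrable (fun t => v t i) volume a b)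
    {Y : Fin l → E → E} {L : NNReal} {s : Set E} (hY : ∀ i, LipschitzOnWith L (Y i) s)
    {x x' : ℝ → E} (hx : SolvesODE x (fun t => ∑ i, v t i • Y i (x t)) a b)
    (hx' : SolvesODE x' (fun t => ∑ i, v t i • Y i (x' t)) a b)
    (hs : ∀ t ∈ Icc a b, x t ∈ s) (hs' : ∀ t ∈ Icc a b, x' t ∈ s) (h0 : x a = x' a) :
    EqOn x x' (Icc a b) := by
  have hcont : ContinuousOn (fun t => ‖x t - x' t‖) (Icc a b) :=
    ((hx.continuousOn hab).sub (hx'.continuousOn hab)).norm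
  have hg : IntervalIntegrable (fun t => ∑ i, |v t i| * (L : ℝ)) volume a b := by
    have := IntervalIntegrable.sum (μ := volume) (a := a) (b := b) Finset.univ
      (f := fun i t => |v t i| * (L : ℝ)) fun i _ => (hv i).norm.mul_const _
    simpa [Finset.sum_fn] using this
  have hgi : IntervalIntegrable (fun t => (∑ i, |v t i| * (L : ℝ)) * ‖x t - x' t‖) volume a b :=
    hg.mul_continuousOn (by rwa [uIcc_of_le hab])
  have := eq_zero_of_le_integral_mul hab hg
    (fun t => Finset.sum_nonneg fun _ _ => by positivity) hcont (fun _ _ => norm_nonneg _)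
    fun t ht => by
      have h1 := hx.1.mono_Icc hab ⟨le_rfl, hab⟩ ht
      have h2 := hx'.1.mono_Icc hab ⟨le_rfl, hab⟩ ht
      rw [hx.2 t ht, hx'.2 t ht, h0, add_sub_add_left_eq_sub,
        ← intervalIntegral.integral_sub h1 h2]
      refine intervalIntegral.norm_integral_le_of_norm_le ht.1 (Eventually.of_forall fun τ hτ => ?_)
        (hgi.mono_Icc hab ⟨le_rfl, hab⟩ ht)
      have hτ' : τ ∈ Icc a b := ⟨hτ.1.le, hτ.2.trans ht.2⟩
      rw [← Finset.sum_sub_distrib, Finset.sum_mul]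
      refine (norm_sum_le _ _).trans (Finset.sum_le_sum fun i _ => ?_)
      rw [← smul_sub, norm_smul, Real.norm_eq_abs, mul_assoc]
      gcongr
      exact (hY i).norm_sub_le (hs τ hτ') (hs' τ hτ')
  intro t ht
  exact sub_eq_zero.1 (norm_eq_zero.1 (this t ht))

/-- A continuation argument: the set of agreement is closed because `M` is Hausdorff, and from any
of its points agreement extends to the right by local uniqueness in a chart, where the smooth fields
are Lipschitz near the point. -/
theorem IsTrajectoryOn.eqOn [T2Space M]
    (hX : ∀ i, ContMDiff (𝓡 n) (𝓡 n).tangent ∞ (fun p => (⟨p, X i p⟩ : TangentBundle (𝓡 n) M)))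
    {v : ℝ → Fin l → ℝ} {a b : ℝ} (hab : a ≤ b)
    (hv : ∀ i, IntervalIntegrable (fun t => v t i) volume a b) {q q' : ℝ → M}
    (hq : IsTrajectoryOn X v a b q) (hq' : IsTrajectoryOn X v a b q') (h0 : q a = q' a) :
    EqOn q q' (Icc a b) := by
  change Icc a b ⊆ {t | q t = q' t}
  have hcl : IsClosed ({t | q t = q' t} ∩ Icc a b) := by
    have h1 : ContinuousOn (fun t => (q t, q' t)) (Icc a b) := hq.1.prodMk hq'.1
    have h2 := h1.preimage_isClosed_of_isClosed isClosed_Icc (isClosed_diagonal (X := M))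
    rw [inter_comm]
    exact h2
  refine hcl.Icc_subset_of_forall_exists_gt h0 ?_
  rintro t ⟨heq, ht⟩ y hy
  have htm : t ∈ Icc a b := ⟨ht.1, ht.2.le⟩
  set e := chartAt (EuclideanSpace ℝ (Fin n)) (q t) with he
  have hem : e ∈ IsManifold.maximalAtlas (𝓡 n) ∞ M := IsManifold.chart_mem_maximalAtlas _
  have hpe : q t ∈ e.source := mem_chart_source _ _
  have hlip : ∃ L : NNReal, ∃ s ∈ 𝓝 (e (q t)), ∀ i, LipschitzOnWith L (localField (X i) e) s := by
    have h1 (i : Fin l) := ((contDiffOn_localField (hX i) hem).contDiffAt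
      (e.open_target.mem_nhds (e.map_source hpe))).of_le (m := 1) (by simp)
    choose L s hs hL using fun i => (h1 i).exists_lipschitzOnWith
    refine ⟨∑ i, L i, ⋂ i, s i, (Filter.iInter_mem).2 hs, fun i => ?_⟩
    exact ((hL i).mono (iInter_subset _ i)).weaken
      (Finset.single_le_sum (fun _ _ => zero_le) (Finset.mem_univ i))
  obtain ⟨L, s, hs, hL⟩ := hlip
  have key (r : ℝ → M) (hr : IsTrajectoryOn X v a b r) (hrt : r t = q t) :
      ∀ᶠ τ in 𝓝[Icc a b] t, r τ ∈ e.source ∧ e (r τ) ∈ s := by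
    have hc : ContinuousWithinAt r (Icc a b) t := hr.1 t htm
    have h2 : e.source ∩ e ⁻¹' s ∈ 𝓝 (r t) := by
      rw [hrt]
      exact inter_mem (e.open_source.mem_nhds hpe) ((e.continuousAt hpe).preimage_mem_nhds hs)
    exact hc h2
  have hev := (key q hq rfl).and (key q' hq' (by exact heq.symm))
  obtain ⟨ε, hε, hball⟩ := Metric.mem_nhdsWithin_iff.1 hev
  -- Up to time `d` both trajectories stay in the chart and in the set `s` where the fields are
  -- Lipschitz; the bounds `b` and `y` are those demanded by the continuation criterion.
  set d := min (min b y) (t + ε / 2) with hd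
  have htd : t < d := lt_min (lt_min ht.2 hy) (by linarith)
  have hdb : d ≤ b := (min_le_left _ _).trans (min_le_left _ _)
  have hdy : d ≤ y := (min_le_left _ _).trans (min_le_right _ _)
  have hin : ∀ τ ∈ Icc t d, (q τ ∈ e.source ∧ e (q τ) ∈ s) ∧ (q' τ ∈ e.source ∧ e (q' τ) ∈ s) := by
    intro τ hτ
    refine hball ⟨?_, ht.1.trans hτ.1, hτ.2.trans hdb⟩
    rw [Metric.mem_ball, Real.dist_eq, abs_of_nonneg (sub_nonneg.2 hτ.1)]
    have := hτ.2.trans (min_le_right _ _)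
    linarith
  have h1 := hq.2 e hem t d ht.1 htd.le hdb fun τ hτ => (hin τ hτ).1.1
  have h2 := hq'.2 e hem t d ht.1 htd.le hdb fun τ hτ => (hin τ hτ).2.1
  have h3 := h1.eqOn_of_lipschitz htd.le
    (fun i => (hv i).mono_Icc hab htm ⟨ht.1.trans htd.le, hdb⟩) hL h2
    (fun τ hτ => (hin τ hτ).1.2) (fun τ hτ => (hin τ hτ).2.2) (by rw [heq])
  have hdm : d ∈ Icc t d := ⟨htd.le, le_rfl⟩
  exact ⟨d, e.injOn (hin d hdm).1.1 (hin d hdm).2.1 (h3 hdm), htd, hdy⟩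

end Uniqueness

/-! ### Extension of smooth maps by a cutoff -/

section Cutoff

/-- A smooth map on an open set can be extended from a neighbourhood of a compact subset to the
whole space. -/
theorem exists_contDiff_eqOn_nhds_of_isCompact {E F : Type*} [NormedAddCommGroup E]
    [NormedSpace ℝ E] [FiniteDimensional ℝ E] [NormedAddCommGroup F] [NormedSpace ℝ F]
    {K U : Set E} (hK : IsCompact K) (hU : IsOpen U) (hKU : K ⊆ U) :
    ∃ V, IsOpen V ∧ K ⊆ V ∧ V ⊆ U ∧ ∀ Y : E → F, ContDiffOn ℝ ∞ Y U →
      ∃ Y' : E → F, ContDiff ℝ ∞ Y' ∧ EqOn Y' Y V := by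
  obtain ⟨t, ht, hKt, htU⟩ := exists_compact_between hK hU hKU
  obtain ⟨χ, h1, h0, -⟩ := exists_contMDiffMap_one_nhds_of_subset_interior (n := ⊤) 𝓘(ℝ, E)
    hK.isClosed hKt
  -- The set depends only on the cutoff, not on the map to be extended, so one neighbourhood serves
  -- all the fields at once.
  refine ⟨interior {x | χ x = 1} ∩ U, isOpen_interior.inter hU, ?_, inter_subset_right,
    fun Y hY => ⟨fun x => χ x • Y x, ?_, ?_⟩⟩
  · exact subset_inter (subset_interior_iff_mem_nhdsSet.2 h1) hKU
  · rw [contDiff_iff_contDiffAt]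
    intro x
    by_cases hx : x ∈ U
    · exact χ.contMDiff.contDiff.contDiffAt.smul (hY.contDiffAt (hU.mem_nhds hx))
    · have hxt : tᶜ ∈ 𝓝 x := ht.isClosed.isOpen_compl.mem_nhds fun h => hx (htU h)
      refine (contDiffAt_const (c := (0 : F))).congr_of_eventuallyEq ?_
      filter_upwards [hxt] with y hy
      rw [h0 y hy, zero_smul]
  · intro x hx
    have hx1 : x ∈ {x | χ x = 1} := interior_subset hx.1
    have : χ x = 1 := hx1
    simp [this]

end Cutoff

/-! ### Smooth families of trajectories inside one chart -/

section Families

variable {n l : ℕ} {M : Type*} [TopologicalSpace M] [ChartedSpace (EuclideanSpace ℝ (Fin n)) M]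
  {X : Fin l → (p : M) → TangentSpace (𝓡 n) p}

/-- The curves in the family of `exists_local_family` are trajectories. -/
theorem isTrajectoryOn_of_integral_eq {u Δu : ℝ → Fin l → ℝ} {a b : ℝ} (hab : a ≤ b)
    (hu : ∀ i, IntervalIntegrable (fun t => u t i) volume a b)
    (hΔu : ∀ i, IntervalIntegrable (fun t => Δu t i) volume a b)
    {e : OpenPartialHomeomorph M (EuclideanSpace ℝ (Fin n))}
    (he : e ∈ IsManifold.maximalAtlas (𝓡 n) ∞ M)
    {Y : Fin l → C(EuclideanSpace ℝ (Fin n), EuclideanSpace ℝ (Fin n))}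
    {V : Set (EuclideanSpace ℝ (Fin n))} (hV : V ⊆ e.target)
    (hY : ∀ i, EqOn (Y i) (localField (X i) e) V) {x : C(Icc a b, EuclideanSpace ℝ (Fin n))}
    (hxV : ∀ t, x t ∈ V) {x₀ : EuclideanSpace ℝ (Fin n)} {s : ℝ}
    (hx : x = ContinuousMap.const _ x₀ +
        ∑ i, (integralOperator hab (fun t => u t i) (hu i) ((Y i).comp x) +
          s • integralOperator hab (fun t => Δu t i) (hΔu i) ((Y i).comp x))) :
    IsTrajectoryOn X (u + s • Δu) a b (fun t => e.symm (IccExtend hab x t)) ∧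
      e.symm (IccExtend hab x a) = e.symm x₀ := by
  have ha : a ∈ Icc a b := ⟨le_rfl, hab⟩
  have hi (i : Fin l) : IntervalIntegrable
      (fun τ => u τ i • IccExtend hab ((Y i).comp x) τ) volume a b :=
    (hu i).smul_continuousOn ((Y i).comp x).continuous.Icc_extend'.continuousOn
  have hi' (i : Fin l) : IntervalIntegrable
      (fun τ => Δu τ i • IccExtend hab ((Y i).comp x) τ) volume a b :=
    (hΔu i).smul_continuousOn ((Y i).comp x).continuous.Icc_extend'.continuousOn
  have hsum (i : Fin l) : IntervalIntegrable (fun τ => u τ i • IccExtend hab ((Y i).comp x) τ +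
      s • Δu τ i • IccExtend hab ((Y i).comp x) τ) volume a b := (hi i).add ((hi' i).smul s)
  have hint : ∀ t ∈ Icc a b, IccExtend hab x t = x₀ + ∫ τ in a..t, ∑ i,
      (u τ i • IccExtend hab ((Y i).comp x) τ + s • Δu τ i • IccExtend hab ((Y i).comp x) τ) := by
    intro t ht
    rw [intervalIntegral.integral_finsetSum fun i _ => (hsum i).mono_Icc hab ha ht]
    rw [IccExtend_of_mem hab _ ht]
    nth_rw 1 [hx]
    simp only [ContinuousMap.add_apply, ContinuousMap.const_apply, ContinuousMap.sum_apply,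
      integralOperator_apply, ContinuousMap.smul_apply]
    congr 1
    refine Finset.sum_congr rfl fun i _ => ?_
    have hs : IntervalIntegrable (fun τ => s • Δu τ i • IccExtend hab ((Y i).comp x) τ)
      volume a t := ((hi' i).smul s).mono_Icc hab ha ht
    rw [intervalIntegral.integral_add ((hi i).mono_Icc hab ha ht) hs,
      intervalIntegral.integral_smul]
  have hxa : IccExtend hab x a = x₀ := by simpa using hint a ha
  have hxV' : ∀ t, IccExtend hab x t ∈ V := fun t => hxV _
  refine ⟨.of_chart hab he (fun t _ => e.map_target (hV (hxV' t))) ?_, by rw [hxa]⟩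
  have hsol : SolvesODE (IccExtend hab x) (fun τ => ∑ i,
      (u τ i • IccExtend hab ((Y i).comp x) τ + s • Δu τ i • IccExtend hab ((Y i).comp x) τ))
      a b := by
    refine ⟨?_, fun t ht => by rw [hxa]; exact hint t ht⟩
    have := IntervalIntegrable.sum (μ := volume) (a := a) (b := b) Finset.univ fun i _ => hsum i
    simpa [Finset.sum_fn] using this
  refine hsol.congr hab (fun t _ => e.right_inv (hV (hxV' t)))
    (Eventually.of_forall fun t ht => Finset.sum_congr rfl fun i _ => ?_)
  rw [e.right_inv (hV (hxV' t)), ← hY i (hxV' t), smul_smul, ← add_smul]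
  simp [IccExtend_of_mem hab _ ht]

variable [IsManifold (𝓡 n) ∞ M]

/-- In a chart `e` containing `q([a, b])`, the trajectories with controls `u + s Δu` starting at
`γ(s)` form a smooth curve `s ↦ x s` in `C([a, b], ℝⁿ)`. -/
theorem exists_local_family
    (hX : ∀ i, ContMDiff (𝓡 n) (𝓡 n).tangent ∞ (fun p => (⟨p, X i p⟩ : TangentBundle (𝓡 n) M)))
    {u Δu : ℝ → Fin l → ℝ} {a b : ℝ} (hab : a ≤ b)
    (hu : ∀ i, IntervalIntegrable (fun t => u t i) volume a b)
    (hΔu : ∀ i, IntervalIntegrable (fun t => Δu t i) volume a b)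
    {e : OpenPartialHomeomorph M (EuclideanSpace ℝ (Fin n))}
    (he : e ∈ IsManifold.maximalAtlas (𝓡 n) ∞ M) {q : ℝ → M} (hq : IsTrajectoryOn X u a b q)
    (hqe : ∀ t ∈ Icc a b, q t ∈ e.source) {γ : ℝ → M} (hγ : ContMDiffAt 𝓘(ℝ, ℝ) (𝓡 n) ∞ γ 0)
    (hγ0 : γ 0 = q a) :
    ∃ (Y : Fin l → C(EuclideanSpace ℝ (Fin n), EuclideanSpace ℝ (Fin n)))
      (V : Set (EuclideanSpace ℝ (Fin n))) (x : ℝ → C(Icc a b, EuclideanSpace ℝ (Fin n))),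
      (∀ i, ContDiff ℝ ∞ (Y i)) ∧ IsOpen V ∧ V ⊆ e.target ∧
      (∀ i, EqOn (Y i) (localField (X i) e) V) ∧ ContDiffAt ℝ ∞ x 0 ∧
      (∀ t, x 0 t = e (q t)) ∧ (∀ᶠ s in 𝓝 0, ∀ t, x s t ∈ V) ∧
      ∀ᶠ s in 𝓝 0, x s = ContinuousMap.const _ (e (γ s)) +
        ∑ i, (integralOperator hab (fun t => u t i) (hu i) ((Y i).comp (x s)) +
          s • integralOperator hab (fun t => Δu t i) (hΔu i) ((Y i).comp (x s))) := by
  have ha : a ∈ Icc a b := ⟨le_rfl, hab⟩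
  have hsol := hq.2 e he a b le_rfl hab le_rfl hqe
  have hcont : ContinuousOn (fun t => e (q t)) (Icc a b) := hsol.continuousOn hab
  let x₀ : C(Icc a b, EuclideanSpace ℝ (Fin n)) :=
    ⟨fun t => e (q t), hcont.domRestrict⟩
  -- The fields are extended to all of `ℝⁿ`, so that `x ↦ Y ∘ x` is defined on the whole Banach
  -- space; on `V`, a neighbourhood of the reference curve, nothing changes.
  obtain ⟨V, hV, hKV, hVU, hext⟩ := exists_contDiff_eqOn_nhds_of_isCompact
    (F := EuclideanSpace ℝ (Fin n))
    (isCompact_Icc.image_of_continuousOn hcont) e.open_target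
    (by rintro _ ⟨t, ht, rfl⟩; exact e.map_source (hqe t ht))
  choose Y hY hYV using fun i => hext _ (contDiffOn_localField (hX i) he)
  let Yc : Fin l → C(EuclideanSpace ℝ (Fin n), EuclideanSpace ℝ (Fin n)) :=
    fun i => ⟨Y i, (hY i).continuous⟩
  have hqV : ∀ t ∈ Icc a b, e (q t) ∈ V := fun t ht => hKV (mem_image_of_mem _ ht)
  have hγe : ContDiffAt ℝ ∞ (fun s => e (γ s)) 0 := by
    rw [← contMDiffAt_iff_contDiffAt]
    refine ContMDiffAt.comp (0 : ℝ) (g := e) ?_ hγ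
    rw [hγ0]
    exact contMDiffAt_of_mem_maximalAtlas he (hqe a ha)
  have hx₀ : x₀ = ContinuousMap.const _ (e (γ 0)) +
      ∑ i, integralOperator hab (fun t => u t i) (hu i) ((Yc i).comp x₀) := by
    ext1 t
    simp only [ContinuousMap.add_apply, ContinuousMap.const_apply, ContinuousMap.sum_apply,
      integralOperator_apply, hγ0]
    have h1 : x₀ t = e (q t) := rfl
    have hi (i : Fin l) : IntervalIntegrable
        (fun τ => u τ i • IccExtend hab ((Yc i).comp x₀) τ) volume a b :=
      (hu i).smul_continuousOn ((Yc i).comp x₀).continuous.Icc_extend'.continuousOn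
    rw [h1, ← intervalIntegral.integral_finsetSum fun i _ => (hi i).mono_Icc hab ha t.2]
    refine (hsol.2 t t.2).trans ?_
    congr 1
    refine intervalIntegral.integral_congr fun τ hτ => Finset.sum_congr rfl fun i _ => ?_
    rw [uIcc_of_le t.2.1] at hτ
    have hτ' : τ ∈ Icc a b := ⟨hτ.1, hτ.2.trans t.2.2⟩
    rw [IccExtend_of_mem hab _ hτ', ← hYV i (hqV τ hτ')]
    rfl
  obtain ⟨x, hx, hx0, hxs⟩ := exists_contDiffAt_solution_family hab hu hΔu Yc hY hγe x₀ hx₀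
  refine ⟨Yc, V, x, hY, hV, hVU, hYV, hx, fun t => by rw [hx0]; rfl, ?_, hxs⟩
  -- Curves with values in `V` form an open set in the compact-open topology, so for small `s` the
  -- whole curve `x s` stays where the extended fields are the original ones.
  have hopen : IsOpen {f : C(Icc a b, EuclideanSpace ℝ (Fin n)) | MapsTo f univ V} :=
    ContinuousMap.isOpen_setOfPred_mapsTo isCompact_univ hV
  have := hx.continuousAt.preimage_mem_nhds (hopen.mem_nhds (x := x 0) (by
    rw [hx0]; exact fun t _ => hqV t t.2))
  filter_upwards [this] with s hs t
  exact hs (mem_univ t)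

end Families

theorem ContDiffAt.continuousMap_apply {K : Type*} [TopologicalSpace K] [CompactSpace K]
    {E P : Type*} [NormedAddCommGroup E] [NormedSpace ℝ E] [NormedAddCommGroup P] [NormedSpace ℝ P]
    {n : WithTop ℕ∞} {x : P → C(K, E)} {s : P} (hx : ContDiffAt ℝ n x s) (t : K) :
    ContDiffAt ℝ n (fun s => x s t) s :=
  ContDiffAt.comp s (ContinuousLinearMap.contDiff (E := C(K, E)) (F := E)
    (ContinuousMap.evalCLM ℝ t)).contDiffAt hx

/-! ### The end-point map and its smoothness -/

section EndPoint

variable {n l : ℕ} {M : Type*} [TopologicalSpace M] [ChartedSpace (EuclideanSpace ℝ (Fin n)) M]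
  {X : Fin l → (p : M) → TangentSpace (𝓡 n) p}

/-- Near `s = 0` there are trajectories on `[a, b]` with controls `u + s Δu` starting at any given
smooth curve `γ(s)` with `γ(0) = q(a)`, and they depend smoothly on `s`. -/
def HasSmoothVariations (X : Fin l → (p : M) → TangentSpace (𝓡 n) p) (u Δu : ℝ → Fin l → ℝ)
    (q : ℝ → M) (a b : ℝ) : Prop :=
  ∀ γ : ℝ → M, ContMDiffAt 𝓘(ℝ, ℝ) (𝓡 n) ∞ γ 0 → γ 0 = q a →
    ∃ y : ℝ → ℝ → M, (∀ᶠ s in 𝓝 0, IsTrajectoryOn X (u + s • Δu) a b (y s) ∧ y s a = γ s) ∧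
      ∀ t ∈ Icc a b, y 0 t = q t ∧ ContMDiffAt 𝓘(ℝ, ℝ) (𝓡 n) ∞ (fun s => y s t) 0

/-- The value at `b` of the first family is again a smooth curve of initial points. Gluing works
because the definition admits an arbitrary smooth `γ` rather than a fixed starting point. -/
theorem HasSmoothVariations.trans {u Δu : ℝ → Fin l → ℝ} {q : ℝ → M} {a b c : ℝ} (hab : a ≤ b)
    (hbc : b ≤ c) (h : HasSmoothVariations X u Δu q a b) (h' : HasSmoothVariations X u Δu q b c) :
    HasSmoothVariations X u Δu q a c := by
  intro γ hγ hγ0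
  obtain ⟨y, hy, hys⟩ := h γ hγ hγ0
  have hb : b ∈ Icc a b := ⟨hab, le_rfl⟩
  obtain ⟨z, hz, hzs⟩ := h' (fun s => y s b) (hys b hb).2 (hys b hb).1
  refine ⟨fun s t => if t ≤ b then y s t else z s t, ?_, fun t ht => ?_⟩
  · filter_upwards [hy, hz] with s h1 h2
    refine ⟨.trans hab hbc (h1.1.congr fun t ht => by simp [ht.2])
      (h2.1.congr fun t ht => ?_), by simp [hab, h1.2]⟩
    rcases eq_or_lt_of_le ht.1 with rfl | hlt
    · simp [h2.2]
    · simp [not_le.2 hlt]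
  · by_cases htb : t ≤ b
    · simpa [htb] using hys t ⟨ht.1, htb⟩
    · simpa [htb] using hzs t ⟨(not_le.1 htb).le, ht.2⟩

variable [IsManifold (𝓡 n) ∞ M]

theorem hasSmoothVariations_of_chart
    (hX : ∀ i, ContMDiff (𝓡 n) (𝓡 n).tangent ∞ (fun p => (⟨p, X i p⟩ : TangentBundle (𝓡 n) M)))
    {u Δu : ℝ → Fin l → ℝ} {a b : ℝ} (hab : a ≤ b)
    (hu : ∀ i, IntervalIntegrable (fun t => u t i) volume a b)
    (hΔu : ∀ i, IntervalIntegrable (fun t => Δu t i) volume a b)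
    {e : OpenPartialHomeomorph M (EuclideanSpace ℝ (Fin n))}
    (he : e ∈ IsManifold.maximalAtlas (𝓡 n) ∞ M) {q : ℝ → M} (hq : IsTrajectoryOn X u a b q)
    (hqe : ∀ t ∈ Icc a b, q t ∈ e.source) : HasSmoothVariations X u Δu q a b := by
  intro γ hγ hγ0
  obtain ⟨Y, V, x, -, -, hV, hYV, hx, hx0, hxV, hxs⟩ :=
    exists_local_family hX hab hu hΔu he hq hqe hγ hγ0
  refine ⟨fun s t => e.symm (IccExtend hab (x s) t), ?_, fun t ht => ?_⟩
  · have hγs : ∀ᶠ s in 𝓝 0, γ s ∈ e.source := by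
      refine hγ.continuousAt (e.open_source.mem_nhds ?_)
      rw [hγ0]
      exact hqe a ⟨le_rfl, hab⟩
    filter_upwards [hxV, hxs, hγs] with s h1 h2 h3
    have := isTrajectoryOn_of_integral_eq hab hu hΔu he hV hYV h1 h2
    rwa [e.left_inv h3] at this
  · simp only [IccExtend_of_mem hab _ ht, hx0]
    refine ⟨e.left_inv (hqe t ht), ?_⟩
    have hxt := hx.continuousMap_apply ⟨t, ht⟩
    refine ContMDiffAt.comp (0 : ℝ) (g := e.symm) ?_ hxt.contMDiffAt
    rw [hx0]
    exact contMDiffAt_symm_of_mem_maximalAtlas he (e.map_source (hqe t ht))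

theorem hasSmoothVariations
    (hX : ∀ i, ContMDiff (𝓡 n) (𝓡 n).tangent ∞ (fun p => (⟨p, X i p⟩ : TangentBundle (𝓡 n) M)))
    {u Δu : ℝ → Fin l → ℝ} {a b : ℝ} (hab : a ≤ b)
    (hu : ∀ i, IntervalIntegrable (fun t => u t i) volume a b)
    (hΔu : ∀ i, IntervalIntegrable (fun t => Δu t i) volume a b) {q : ℝ → M}
    (hq : IsTrajectoryOn X u a b q) : HasSmoothVariations X u Δu q a b := by
  let c (p : M) : Set (Icc a b) :=
    (fun t : Icc a b => q t) ⁻¹' (chartAt (EuclideanSpace ℝ (Fin n)) p).source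
  have hqc : Continuous fun t : Icc a b => q t := hq.1.domRestrict
  -- By compactness the interval is subdivided so that `q` stays in one chart on each piece; the
  -- pieces are concatenated.
  obtain ⟨τ, hτ0, hmono, ⟨m, hm⟩, hc⟩ := exists_monotone_Icc_subset_open_cover_Icc hab (c := c)
    (fun p => (chartAt _ p).open_source.preimage hqc)
    (fun t _ => mem_iUnion.2 ⟨q t, mem_chart_source _ _⟩)
  have hle (k : ℕ) : (τ k : ℝ) ≤ τ (k + 1) := hmono k.le_succ
  have step (k : ℕ) : HasSmoothVariations X u Δu q (τ k) (τ (k + 1)) := by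
    obtain ⟨p, hp⟩ := hc k
    refine hasSmoothVariations_of_chart hX (hle k)
      (fun i => (hu i).mono_Icc hab (τ k).2 (τ (k + 1)).2)
      (fun i => (hΔu i).mono_Icc hab (τ k).2 (τ (k + 1)).2)
      (IsManifold.chart_mem_maximalAtlas p) (hq.mono (τ k).2.1 (τ (k + 1)).2.2) fun t ht => ?_
    exact hp (a := ⟨t, (τ k).2.1.trans ht.1, ht.2.trans (τ (k + 1)).2.2⟩) ⟨ht.1, ht.2⟩
  have all (k : ℕ) : HasSmoothVariations X u Δu q a (τ k) := by
    induction k with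
    | zero =>
      -- The induction starts from the degenerate interval `[a, a]`, treated in the chart at `q a`.
      have h0 : (τ 0 : ℝ) = a := by rw [hτ0]
      have h1 := hasSmoothVariations_of_chart (u := u) (Δu := Δu) (q := q) hX (le_refl a)
        (by simp) (by simp) (IsManifold.chart_mem_maximalAtlas (q a)) (hq.mono le_rfl hab)
        (fun t ht => by
          obtain rfl : t = a := le_antisymm ht.2 ht.1
          exact mem_chart_source _ _)
      rwa [h0]
    | succ k ih => exact ih.trans (τ k).2.1 (hle k) (step k)
  have := all m
  rwa [hm m le_rfl] at this

variable [T2Space M] {T : ℝ} {u Δu : ℝ → Fin l → ℝ} {q₀ : M}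

/-- Uniqueness makes the choice in the definition of `endPoint` immaterial on `[0, T]`. -/
theorem IsTrajectory.eqOn_endPoint
    (hX : ∀ i, ContMDiff (𝓡 n) (𝓡 n).tangent ∞ (fun p => (⟨p, X i p⟩ : TangentBundle (𝓡 n) M)))
    (hT : 0 ≤ T) (hu : ∀ i, IntervalIntegrable (fun t => u t i) volume 0 T) {q : ℝ → M}
    (hq : IsTrajectory X u q₀ T q) :
    IsTrajectory X u q₀ T (endPoint X q₀ T u) ∧ EqOn q (endPoint X q₀ T u) (Icc 0 T) := by
  have hex : ∃ q, IsTrajectory X u q₀ T q := ⟨q, hq⟩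
  have h1 : endPoint X q₀ T u = hex.choose := by
    funext t
    simp [endPoint, dif_pos hex]
  have h2 := hex.choose_spec
  rw [← h1] at h2
  refine ⟨h2, ?_⟩
  rw [isTrajectory_iff] at hq h2
  exact hq.2.eqOn hX hT hu h2.2 (hq.1.trans h2.1.symm)

theorem endPoint_smooth
    (hX : ∀ i, ContMDiff (𝓡 n) (𝓡 n).tangent ∞ (fun p => (⟨p, X i p⟩ : TangentBundle (𝓡 n) M)))
    (hT : 0 ≤ T) (hu : ∀ i, IntervalIntegrable (fun t => u t i) volume 0 T)
    (hΔu : ∀ i, IntervalIntegrable (fun t => Δu t i) volume 0 T) {q : ℝ → M}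
    (hq : IsTrajectory X u q₀ T q) :
    (∀ᶠ s : ℝ in 𝓝 0,
      IsTrajectory X (u + s • Δu) q₀ T (endPoint X q₀ T (u + s • Δu)) ∧
      ∀ q', IsTrajectory X (u + s • Δu) q₀ T q' →
        EqOn q' (endPoint X q₀ T (u + s • Δu)) (Icc 0 T)) ∧
    (∀ t ∈ Icc 0 T, endPoint X q₀ T u t = q t ∧
      ContMDiffAt 𝓘(ℝ, ℝ) (𝓡 n) ∞ (fun s : ℝ => endPoint X q₀ T (u + s • Δu) t) 0) := by
  have hus (s : ℝ) (i : Fin l) : IntervalIntegrable (fun t => (u + s • Δu) t i) volume 0 T := by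
    simpa using (hu i).add ((hΔu i).const_mul s)
  obtain ⟨hq0, hqT⟩ := isTrajectory_iff.1 hq
  obtain ⟨y, hy, hys⟩ := hasSmoothVariations hX hT hu hΔu hqT (fun _ => q₀) contMDiffAt_const
    hq0.symm
  refine ⟨?_, fun t ht => ⟨((hq.eqOn_endPoint hX hT hu).2 ht).symm, ?_⟩⟩
  · filter_upwards [hy] with s hs
    exact ⟨((isTrajectory_iff.2 ⟨hs.2, hs.1⟩).eqOn_endPoint hX hT (hus s)).1,
      fun q' hq' => (hq'.eqOn_endPoint hX hT (hus s)).2⟩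
  · refine (hys t ht).2.congr_of_eventuallyEq ?_
    filter_upwards [hy] with s hs
    exact (((isTrajectory_iff.2 ⟨hs.2, hs.1⟩).eqOn_endPoint hX hT (hus s)).2 ht).symm

end EndPoint

/-! ### Taylor expansions in one parameter -/

section Expansions

variable {E F G : Type*} [NormedAddCommGroup E] [NormedSpace ℝ E] [NormedAddCommGroup F]
  [NormedSpace ℝ F] [NormedAddCommGroup G] [NormedSpace ℝ G]

/-- Taylor's formula with integral remainder, where the derivative of order `K + 1` is bounded near
`x₀` by continuity. -/
theorem taylor_isBigO [CompleteSpace F] {f : E → F} {x₀ : E} (hf : ContDiffAt ℝ ∞ f x₀) (K : ℕ) :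
    (fun v => f (x₀ + v) - ∑ r ∈ Finset.range (K + 1),
      ((r.factorial : ℝ)⁻¹) • iteratedFDeriv ℝ r f x₀ fun _ => v) =O[𝓝 0]
        fun v => ‖v‖ ^ (K + 1) := by
  have hK : ContDiffAt ℝ (K + 1 : ℕ) f x₀ := hf.of_le (by exact_mod_cast le_top)
  have h1 : ∀ᶠ x in 𝓝 x₀, ContDiffAt ℝ (K + 1 : ℕ) f x := hK.eventually (by simp)
  have h2 : ContinuousAt (iteratedFDeriv ℝ (K + 1) f) x₀ :=
    (hK.iteratedFDeriv_right (i := K + 1) (m := 0) (by simp)).continuousAt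
  have h3 : ∀ᶠ x in 𝓝 x₀, ‖iteratedFDeriv ℝ (K + 1) f x‖ < ‖iteratedFDeriv ℝ (K + 1) f x₀‖ + 1 :=
    h2.norm.eventually (gt_mem_nhds (lt_add_one _))
  set C := ‖iteratedFDeriv ℝ (K + 1) f x₀‖ + 1 with hC
  obtain ⟨ε, hε, hball⟩ := Metric.eventually_nhds_iff_ball.1 (h1.and h3)
  refine Asymptotics.IsBigO.of_bound ((K.factorial : ℝ)⁻¹ * C) ?_
  filter_upwards [Metric.ball_mem_nhds 0 hε] with v hv
  rw [mem_ball_zero_iff] at hv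
  have hmem : ∀ t ∈ Icc (0 : ℝ) 1, x₀ + t • v ∈ Metric.ball x₀ ε := by
    intro t ht
    rw [mem_ball_iff_norm, add_sub_cancel_left, norm_smul, Real.norm_of_nonneg ht.1]
    exact (mul_le_of_le_one_left (norm_nonneg _) ht.2).trans_lt hv
  have hcd : ∀ t ∈ Icc (0 : ℝ) 1, ContDiffAt ℝ (K + 1) f (x₀ + t • v) := fun t ht =>
    by exact_mod_cast (hball _ (hmem t ht)).1
  rw [map_add_eq_sum_add_integral_iteratedFDeriv hcd, add_sub_cancel_left, norm_smul]
  rw [Real.norm_of_nonneg (by positivity), mul_assoc, Real.norm_of_nonneg (by positivity)]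
  gcongr
  have h4 := intervalIntegral.norm_integral_le_of_norm_le_const (a := (0 : ℝ)) (b := 1)
    (f := fun t => (1 - t) ^ K • iteratedFDeriv ℝ (K + 1) f (x₀ + t • v) fun _ => v)
    (C := C * ‖v‖ ^ (K + 1)) fun t ht => by
      rw [uIoc_of_le zero_le_one] at ht
      have ht' : t ∈ Icc (0 : ℝ) 1 := ⟨ht.1.le, ht.2⟩
      have h5 := (iteratedFDeriv ℝ (K + 1) f (x₀ + t • v)).le_opNorm fun _ => v
      rw [Finset.prod_const, Finset.card_univ, Fintype.card_fin] at h5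
      rw [norm_smul, norm_pow, Real.norm_of_nonneg (by linarith [ht.2])]
      have h6 : (1 - t) ^ K ≤ 1 := pow_le_one₀ (by linarith [ht.2]) (by linarith [ht.1])
      calc _ ≤ 1 * (‖iteratedFDeriv ℝ (K + 1) f (x₀ + t • v)‖ * ‖v‖ ^ (K + 1)) := by gcongr
        _ ≤ _ := by
          rw [one_mul]
          gcongr
          exact (hball _ (hmem t ht')).2.le
  simpa using h4

/-- The `k`-th coefficient of the expansion of `f` at `0`. -/
noncomputable def expansionCoeff (f : ℝ → F) (k : ℕ) : F :=
  ((k.factorial : ℝ)⁻¹) • iteratedDeriv k f 0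

theorem expansionCoeff_zero (f : ℝ → F) : expansionCoeff f 0 = f 0 := by
  simp [expansionCoeff]

theorem Filter.EventuallyEq.expansionCoeff_eq {f g : ℝ → F} (h : f =ᶠ[𝓝 0] g) (k : ℕ) :
    expansionCoeff f k = expansionCoeff g k := by
  rw [expansionCoeff, expansionCoeff, h.iteratedDeriv_eq]

theorem sub_sum_expansionCoeff_isBigO [CompleteSpace F] {f : ℝ → F} (hf : ContDiffAt ℝ ∞ f 0)
    (K : ℕ) :
    (fun s => f s - ∑ r ∈ Finset.range (K + 1), s ^ r • expansionCoeff f r) =O[𝓝 0]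
      fun s => s ^ (K + 1) := by
  have h := taylor_isBigO hf K
  simp only [zero_add, iteratedFDeriv_apply_eq_iteratedDeriv_mul_prod, Finset.prod_const,
    Finset.card_univ, Fintype.card_fin] at h
  refine (h.congr_left fun s => ?_).trans (Asymptotics.isBigO_of_le _ fun s => by simp)
  congr 1
  refine Finset.sum_congr rfl fun r _ => ?_
  rw [expansionCoeff, smul_comm]

/-- Letting `s → 0` kills the constant term; dividing by `s` lowers the degree. The punctured
neighbourhood makes this division possible. -/
theorem eq_zero_of_sum_pow_smul_isBigO {K : ℕ} {a : ℕ → F}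
    (h : (fun s : ℝ => ∑ r ∈ Finset.range (K + 1), s ^ r • a r) =O[𝓝[≠] 0] fun s => s ^ (K + 1)) :
    ∀ r ≤ K, a r = 0 := by
  induction K generalizing a with
  | zero =>
    intro r hr
    obtain rfl : r = 0 := by omega
    have h1 : Tendsto (fun s : ℝ => s ^ 1) (𝓝[≠] 0) (𝓝 0) := by
      have : Tendsto (fun s : ℝ => s ^ 1) (𝓝 0) (𝓝 (0 ^ 1)) := (continuous_pow 1).tendsto 0
      simpa using this.mono_left nhdsWithin_le_nhds
    have h2 := h.trans_tendsto h1
    simp only [zero_add, Finset.range_one, Finset.sum_singleton, pow_zero, one_smul] at h2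
    exact tendsto_const_nhds_iff.1 h2
  | succ K ih =>
    have h0 : a 0 = 0 := by
      have h1 : Tendsto (fun s : ℝ => s ^ (K + 1 + 1)) (𝓝[≠] 0) (𝓝 0) := by
        have : Tendsto (fun s : ℝ => s ^ (K + 1 + 1)) (𝓝 0) (𝓝 (0 ^ (K + 1 + 1))) :=
          (continuous_pow _).tendsto 0
        simpa using this.mono_left nhdsWithin_le_nhds
      have h2 := h.trans_tendsto h1
      have h3 : Tendsto (fun s : ℝ => ∑ r ∈ Finset.range (K + 1 + 1), s ^ r • a r) (𝓝[≠] 0)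
          (𝓝 (∑ r ∈ Finset.range (K + 1 + 1), (0 : ℝ) ^ r • a r)) :=
        ((by fun_prop : Continuous fun s : ℝ => ∑ r ∈ Finset.range (K + 1 + 1), s ^ r • a r).tendsto
          0).mono_left nhdsWithin_le_nhds
      have h4 := tendsto_nhds_unique h3 h2
      rw [Finset.sum_range_succ'] at h4
      simpa using h4
    have hshift : (fun s : ℝ => ∑ r ∈ Finset.range (K + 1), s ^ r • a (r + 1)) =O[𝓝[≠] 0]
        fun s => s ^ (K + 1) := by
      have h5 := (Asymptotics.isBigO_refl (fun s : ℝ => s⁻¹) (𝓝[≠] 0)).smul h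
      refine h5.congr' ?_ ?_
      · filter_upwards [self_mem_nhdsWithin] with s hs
        have hs' : s ≠ 0 := hs
        rw [Finset.sum_range_succ', h0]
        simp only [smul_zero, add_zero, Finset.smul_sum, smul_smul]
        refine Finset.sum_congr rfl fun r _ => ?_
        congr 1
        field_simp
        ring
      · filter_upwards [self_mem_nhdsWithin] with s hs
        have hs' : s ≠ 0 := hs
        rw [smul_eq_mul]
        field_simp
        ring
    intro r hr
    cases r with
    | zero => exact h0
    | succ r => exact ih hshift r (by omega)

theorem pow_isBigO_pow {m k : ℕ} (h : k ≤ m) :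
    (fun s : ℝ => s ^ m) =O[𝓝 0] fun s => s ^ k := by
  obtain ⟨d, rfl⟩ := Nat.exists_eq_add_of_le h
  have h1 : (fun s : ℝ => s ^ d) =O[𝓝 0] fun _ => (1 : ℝ) :=
    ((continuous_pow d).tendsto 0).isBigO_one ℝ
  simpa [pow_add] using (Asymptotics.isBigO_refl (fun s : ℝ => s ^ k) (𝓝 0)).mul h1

/-- Expansion coefficients can be read off from any finite expansion. -/
theorem expansionCoeff_eq_of_isBigO [CompleteSpace F] {f : ℝ → F} (hf : ContDiffAt ℝ ∞ f 0) {K : ℕ}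
    {ι : Type*} (S : Finset ι) (w : ι → ℕ) (c : ι → F)
    (h : (fun s => f s - ∑ i ∈ S, s ^ w i • c i) =O[𝓝 0] fun s => s ^ (K + 1)) {r : ℕ}
    (hr : r ≤ K) : expansionCoeff f r = ∑ i ∈ S with w i = r, c i := by
  have h1 := sub_sum_expansionCoeff_isBigO hf K
  -- Weights may repeat and may exceed `K`: terms of weight above `K` are absorbed in the error, and
  -- the others are grouped by weight before comparison with the Taylor polynomial.
  have h2 : (fun s : ℝ => ∑ i ∈ S with ¬ w i < K + 1, s ^ w i • c i) =O[𝓝 0]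
      fun s => s ^ (K + 1) := by
    refine Asymptotics.IsBigO.fun_sum fun i hi => ?_
    have hw : K + 1 ≤ w i := not_lt.1 (Finset.mem_filter.1 hi).2
    have := (pow_isBigO_pow hw).smul (Asymptotics.isBigO_const_const (c i) (one_ne_zero (α := ℝ))
      (𝓝 0))
    simpa using this
  have h3 : (fun s : ℝ => ∑ r ∈ Finset.range (K + 1), s ^ r •
      (expansionCoeff f r - ∑ i ∈ S with w i = r, c i)) =O[𝓝 0] fun s => s ^ (K + 1) := by
    refine ((h.sub h1).add h2).congr_left fun s => ?_
    have h4 : ∑ i ∈ S, s ^ w i • c i = ∑ r ∈ Finset.range (K + 1), s ^ r •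
        (∑ i ∈ S with w i = r, c i) + ∑ i ∈ S with ¬ w i < K + 1, s ^ w i • c i := by
      rw [← Finset.sum_filter_add_sum_filter_not S (fun i => w i < K + 1)]
      congr 1
      rw [← Finset.sum_fiberwise_of_maps_to (s := S.filter fun i => w i < K + 1)
        (t := Finset.range (K + 1)) (g := w) (by simp)]
      refine Finset.sum_congr rfl fun r hr => ?_
      rw [Finset.smul_sum, Finset.filter_filter]
      refine Finset.sum_congr ?_ fun i hi => by rw [(Finset.mem_filter.1 hi).2]
      ext i
      simp only [Finset.mem_filter, Finset.mem_range] at hr ⊢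
      constructor
      · rintro ⟨a, -, c⟩; exact ⟨a, c⟩
      · rintro ⟨a, c⟩; exact ⟨a, c ▸ hr, c⟩
    simp only [smul_sub, Finset.sum_sub_distrib]
    rw [h4]
    abel
  have := eq_zero_of_sum_pow_smul_isBigO (h3.mono nhdsWithin_le_nhds) r hr
  exact sub_eq_zero.1 this

theorem expansionCoeff_eq_of_sub_isBigO [CompleteSpace F] {f g : ℝ → F} (hf : ContDiffAt ℝ ∞ f 0)
    (hg : ContDiffAt ℝ ∞ g 0) {K : ℕ} (h : (fun s => f s - g s) =O[𝓝 0] fun s => s ^ (K + 1))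
    {r : ℕ} (hr : r ≤ K) : expansionCoeff f r = expansionCoeff g r := by
  have h1 := sub_sum_expansionCoeff_isBigO hg K
  rw [expansionCoeff_eq_of_isBigO hf (K := K) (Finset.range (K + 1)) id (expansionCoeff g)
    ((h.add h1).congr_left fun s => by simp) hr]
  rw [Finset.sum_filter, Finset.sum_eq_single r] <;> simp +contextual
  omega

/-- The Cauchy product: both factors may be replaced by their Taylor polynomials of degree `k`,
since the other factor stays bounded near `0`. -/
theorem expansionCoeff_bilinear [CompleteSpace G] [CompleteSpace E] [CompleteSpace F]
    (B : E →L[ℝ] F →L[ℝ] G) {f : ℝ → E} {g : ℝ → F}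
    (hf : ContDiffAt ℝ ∞ f 0) (hg : ContDiffAt ℝ ∞ g 0) (k : ℕ) :
    expansionCoeff (fun s => B (f s) (g s)) k =
      ∑ w ∈ Finset.HasAntidiagonal.antidiagonal k, B (expansionCoeff f w.1) (expansionCoeff g w.2) := by
  have hB : ContDiffAt ℝ ∞ (fun s => B (f s) (g s)) 0 :=
    (B.contDiff.contDiffAt.comp 0 hf).clm_apply hg
  have h1 := sub_sum_expansionCoeff_isBigO hf k
  have h2 := sub_sum_expansionCoeff_isBigO hg k
  set P : ℝ → E := fun s => ∑ r ∈ Finset.range (k + 1), s ^ r • expansionCoeff f r with hP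
  set Q : ℝ → F := fun s => ∑ r ∈ Finset.range (k + 1), s ^ r • expansionCoeff g r with hQ
  have hPc : Continuous P := by fun_prop
  have e1 : (fun s => B (f s - P s) (g s)) =O[𝓝 0] fun s => s ^ (k + 1) := by
    have hbg : g =O[𝓝 0] fun _ => (1 : ℝ) := hg.continuousAt.tendsto.isBigO_one ℝ
    have := (h1.norm_left.mul hbg.norm_left)
    refine (Asymptotics.IsBigO.of_bound ‖B‖ (Eventually.of_forall fun s => ?_)).trans
      (this.congr_right fun s => mul_one _)
    rw [norm_mul, norm_norm, norm_norm, ← mul_assoc]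
    exact B.le_opNorm₂ _ _
  have e2 : (fun s => B (P s) (g s - Q s)) =O[𝓝 0] fun s => s ^ (k + 1) := by
    have hbP : P =O[𝓝 0] fun _ => (1 : ℝ) := (hPc.tendsto 0).isBigO_one ℝ
    have := (hbP.norm_left.mul h2.norm_left)
    refine (Asymptotics.IsBigO.of_bound ‖B‖ (Eventually.of_forall fun s => ?_)).trans
      (this.congr_right fun s => one_mul _)
    rw [norm_mul, norm_norm, norm_norm, ← mul_assoc]
    exact B.le_opNorm₂ _ _
  rw [expansionCoeff_eq_of_isBigO hB (K := k)
    (Finset.range (k + 1) ×ˢ Finset.range (k + 1)) (fun w => w.1 + w.2)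
    (fun w => B (expansionCoeff f w.1) (expansionCoeff g w.2)) ((e1.add e2).congr_left fun s => ?_)
    le_rfl]
  · refine Finset.sum_congr ?_ fun _ _ => rfl
    ext ⟨i, j⟩
    simp only [Finset.mem_filter, Finset.mem_product, Finset.mem_range, Finset.HasAntidiagonal.mem_antidiagonal]
    omega
  · rw [Finset.sum_product]
    have : ∑ x ∈ Finset.range (k + 1), ∑ y ∈ Finset.range (k + 1),
        s ^ (x + y) • B (expansionCoeff f x) (expansionCoeff g y) = B (P s) (Q s) := by
      simp only [hP, hQ, map_sum, map_smul, sum_apply, smul_apply,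
        Finset.smul_sum, smul_smul, pow_add]
      rw [Finset.sum_comm]
      refine Finset.sum_congr rfl fun x _ => Finset.sum_congr rfl fun y _ => ?_
      rw [mul_comm]
    simp only at this ⊢
    rw [this]
    simp only [map_sub, sub_apply]
    abel

/-- This shift by one is the origin of the weight `k - 1` in the evolution equation. -/
theorem expansionCoeff_id_smul [CompleteSpace F] {f : ℝ → F} (hf : ContDiffAt ℝ ∞ f 0) (k : ℕ) :
    expansionCoeff (fun s => s • f s) (k + 1) = expansionCoeff f k := by
  have h := sub_sum_expansionCoeff_isBigO hf k
  have h1 := (Asymptotics.isBigO_refl (fun s : ℝ => s) (𝓝 0)).smul h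
  have hsf : ContDiffAt ℝ ∞ (fun s => s • f s) 0 := contDiffAt_id.smul hf
  rw [expansionCoeff_eq_of_isBigO hsf (K := k + 1) (Finset.range (k + 1))
    (fun r => r + 1) (expansionCoeff f)
    (h1.congr (fun s => ?_) fun s => by simp only [smul_eq_mul]; ring) le_rfl]
  · rw [Finset.sum_filter, Finset.sum_eq_single k] <;> simp +contextual
  · simp only [smul_sub, Finset.smul_sum, smul_smul, pow_succ']

end Expansions

/-! ### Multinomial combinatorics of multi-indices -/

section MultiIndex

/-- The number of times each value is attained. -/
def fiberCount {m K : ℕ} (r : Fin m → Fin K) (j : Fin K) : ℕ := (Finset.univ.filter (r · = j)).card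

theorem sum_fiberCount {m K : ℕ} (r : Fin m → Fin K) : ∑ j, fiberCount r j = m := by
  have := Finset.card_eq_sum_card_fiberwise (f := r) (s := Finset.univ) (t := Finset.univ) (by simp)
  simpa [fiberCount] using this.symm

/-- The power `(∑ X_j)^m` is expanded once over all words `r` and once by the multinomial theorem;
comparing the coefficients of `X^α` counts the words with content `α`. -/
theorem card_fiberCount_eq {m K : ℕ} {α : Fin K → ℕ} (hα : ∑ j, α j = m) :
    (Finset.univ.filter fun r : Fin m → Fin K => fiberCount r = α).card * multiFactorial α =
      m.factorial := by
  have h1 : (∑ j, (MvPolynomial.X j : MvPolynomial (Fin K) ℕ)) ^ m =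
      ∑ r : Fin m → Fin K, MvPolynomial.monomial (Finsupp.equivFunOnFinite.symm (fiberCount r)) 1 := by
    rw [Fintype.sum_pow]
    refine Finset.sum_congr rfl fun r _ => ?_
    rw [MvPolynomial.monomial_eq, Finsupp.prod_fintype _ _ (by simp),
      Finset.prod_comp (fun j => (MvPolynomial.X j : MvPolynomial (Fin K) ℕ)) r]
    simp only [map_one, one_mul, Finsupp.equivFunOnFinite_symm_apply_apply, fiberCount]
    refine Finset.prod_subset (Finset.subset_univ _) fun j _ hj => ?_
    rw [Finset.card_eq_zero.2, pow_zero]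
    simpa [Finset.filter_eq_empty_iff] using hj
  have h2 := Finset.sum_pow_eq_sum_piAntidiag Finset.univ
    (fun j => (MvPolynomial.X j : MvPolynomial (Fin K) ℕ)) m
  have h3 (β : Fin K → ℕ) : (∏ j, (MvPolynomial.X j : MvPolynomial (Fin K) ℕ) ^ β j) =
      MvPolynomial.monomial (Finsupp.equivFunOnFinite.symm β) 1 := by
    rw [MvPolynomial.monomial_eq, Finsupp.prod_fintype _ _ (by simp)]
    simp
  rw [h1] at h2
  have h4 := congrArg (MvPolynomial.coeff (Finsupp.equivFunOnFinite.symm α)) h2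
  simp only [h3, MvPolynomial.coeff_sum, MvPolynomial.coeff_monomial,
    EmbeddingLike.apply_eq_iff_eq, ← MvPolynomial.C_eq_coe_nat, MvPolynomial.coeff_C_mul,
    mul_ite, mul_one, mul_zero] at h4
  rw [Finset.sum_ite_eq' , if_pos (by simp [hα]), Finset.sum_boole] at h4
  have h5 := Nat.multinomial_spec Finset.univ α
  rw [hα] at h5
  rw [← h5, mul_comm, multiFactorial]
  congr 1

theorem exists_perm_of_fiberCount_eq {m K : ℕ} {r r' : Fin m → Fin K}
    (h : fiberCount r = fiberCount r') : ∃ σ : Equiv.Perm (Fin m), r' ∘ σ = r := by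
  have e (j : Fin K) : { i // r i = j } ≃ { i // r' i = j } := by
    refine Fintype.equivOfCardEq ?_
    rw [Fintype.card_subtype, Fintype.card_subtype]
    exact congrFun h j
  exact ⟨Equiv.ofFiberEquiv e, funext fun i => Equiv.ofFiberEquiv_map e i⟩

theorem fiberCount_finSigmaFinEquiv {K : ℕ} (α : Fin K → ℕ) :
    fiberCount (fun j : Fin (multiAbs α) => (finSigmaFinEquiv.symm j).1) = α := by
  funext i
  rw [fiberCount, ← Fintype.card_subtype]
  rw [Fintype.card_congr (finSigmaFinEquiv.symm.subtypeEquiv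
    (q := fun x : (i : Fin K) × Fin (α i) => x.1 = i) fun _ => Iff.rfl)]
  rw [Fintype.card_congr (Equiv.sigmaSubtype i)]
  simp

theorem prod_pow_multiPow {K : ℕ} (α : Fin K → ℕ) (s : ℝ) :
    ∏ j : Fin (multiAbs α), s ^ (((finSigmaFinEquiv.symm j).1 : ℕ) + 1) = s ^ multiWeight α := by
  rw [← Equiv.prod_comp finSigmaFinEquiv]
  simp only [Equiv.symm_apply_apply]
  rw [Fintype.prod_sigma]
  simp [← pow_mul, Finset.prod_pow_eq_pow_sum, multiWeight]

variable {V W : Type*} [NormedAddCommGroup V] [NormedSpace ℝ V] [NormedAddCommGroup W]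
  [NormedSpace ℝ W]

theorem multiAbs_le_multiWeight {K : ℕ} (α : Fin K → ℕ) : multiAbs α ≤ multiWeight α :=
  Finset.sum_le_sum fun _ _ => Nat.le_mul_of_pos_left _ (Nat.succ_pos _)

/-- Multinomial expansion of a symmetric form along a polynomial curve. -/
theorem inv_factorial_smul_map_sum_pow {m K : ℕ} (f : V [×m]→L[ℝ] W) {Φ : (m : ℕ) → V [×m]→L[ℝ] W}
    (hf : Φ m = f)
    (hsymm : ∀ (σ : Equiv.Perm (Fin m)) (v : Fin m → V), f (v ∘ σ) = f v) (b : Fin K → V) (s : ℝ) :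
    ((m.factorial : ℝ)⁻¹) • f (fun _ => ∑ j : Fin K, s ^ ((j : ℕ) + 1) • b j) =
      ∑ α ∈ Finset.piAntidiag Finset.univ m, s ^ multiWeight α •
        (((multiFactorial α : ℝ)⁻¹) • Φ (multiAbs α) (multiPow b α)) := by
  subst hf
  have h1 : Φ m (fun _ => ∑ j : Fin K, s ^ ((j : ℕ) + 1) • b j) =
      ∑ r : Fin m → Fin K, Φ m fun i => s ^ ((r i : ℕ) + 1) • b (r i) :=
    (Φ m).toMultilinearMap.map_sum (α := fun _ => Fin K) fun _ j => s ^ ((j : ℕ) + 1) • b j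
  -- The words are grouped by content. Words with equal content differ by a permutation, so by
  -- symmetry they contribute equally, and there are `m! / α!` of them.
  rw [h1, ← Finset.sum_fiberwise_of_maps_to (s := Finset.univ)
    (t := Finset.piAntidiag Finset.univ m) (g := fiberCount)
    (fun r _ => by simp [sum_fiberCount r]), Finset.smul_sum]
  refine Finset.sum_congr rfl fun α hα => ?_
  have hα' : ∑ j, α j = m := by simpa using hα
  have h2 : ∀ r ∈ Finset.univ.filter (fun r : Fin m → Fin K => fiberCount r = α),
      (Φ m fun i => s ^ ((r i : ℕ) + 1) • b (r i)) =
        s ^ multiWeight α • Φ (multiAbs α) (multiPow b α) := by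
    intro r hr
    have hr' : fiberCount r = α := (Finset.mem_filter.1 hr).2
    subst hα'
    obtain ⟨σ, hσ⟩ := exists_perm_of_fiberCount_eq (r := r)
      (r' := fun j : Fin (multiAbs α) => (finSigmaFinEquiv.symm j).1)
      (hr'.trans (fiberCount_finSigmaFinEquiv α).symm)
    have h3 := hsymm σ fun j => s ^ (((finSigmaFinEquiv.symm j).1 : ℕ) + 1) •
      b (finSigmaFinEquiv.symm j).1
    have h4 : (fun i => s ^ ((r i : ℕ) + 1) • b (r i)) =
        (fun j : Fin (multiAbs α) => s ^ (((finSigmaFinEquiv.symm j).1 : ℕ) + 1) •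
          b (finSigmaFinEquiv.symm j).1) ∘ σ := by
      rw [← hσ]; rfl
    rw [h4]
    refine h3.trans ?_
    rw [(Φ (multiAbs α)).map_smul_univ, prod_pow_multiPow]
    rfl
  rw [Finset.sum_congr rfl h2, Finset.sum_const, ← Nat.cast_smul_eq_nsmul ℝ, smul_smul, smul_smul,
    smul_smul, ← card_fiberCount_eq hα']
  congr 1
  have h5 : (multiFactorial α : ℝ) ≠ 0 := by
    have : multiFactorial α ≠ 0 := Finset.prod_ne_zero_iff.2 fun i _ => (α i).factorial_ne_zero
    exact_mod_cast this
  have h6 : ((Finset.univ.filter fun r : Fin m → Fin K => fiberCount r = α).card : ℝ) ≠ 0 := by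
    have := card_fiberCount_eq hα'
    intro h0
    have h0' : (Finset.univ.filter fun r : Fin m → Fin K => fiberCount r = α).card = 0 := by
      exact_mod_cast h0
    rw [h0', zero_mul] at this
    exact m.factorial_ne_zero this.symm
  push_cast
  field_simp

/-- The polynomial map `v ↦ ∑_{m ≤ N} (1/m!) Φ^m[v, …, v]`. -/
noncomputable def formsPoly (Φ : (m : ℕ) → V [×m]→L[ℝ] W) (N : ℕ) (v : V) : W :=
  ∑ m ∈ Finset.range (N + 1), ((m.factorial : ℝ)⁻¹) • Φ m fun _ => v

/-- `s ↦ ∑ sⁱ bᵢ`. -/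
noncomputable def jetCurve {K : ℕ} (b : Fin K → V) (s : ℝ) : V := ∑ j : Fin K, s ^ ((j : ℕ) + 1) • b j

theorem contDiff_formsPoly (Φ : (m : ℕ) → V [×m]→L[ℝ] W) (N : ℕ) :
    ContDiff ℝ ∞ (formsPoly Φ N) := by
  refine ContDiff.sum fun m _ => ContDiff.const_smul _ ?_
  exact (Φ m).contDiff.comp (contDiff_pi.2 fun _ => contDiff_id)

theorem contDiff_jetCurve {K : ℕ} (b : Fin K → V) : ContDiff ℝ ∞ (jetCurve b) := by
  unfold jetCurve
  fun_prop

/-- Coefficients of a polynomial along a polynomial curve. -/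
theorem expansionCoeff_formsPoly [CompleteSpace W] {Φ : (m : ℕ) → V [×m]→L[ℝ] W} {K N w : ℕ}
    (hsymm : ∀ m ≤ N, ∀ (σ : Equiv.Perm (Fin m)) (v : Fin m → V), Φ m (v ∘ σ) = Φ m v)
    (b : Fin K → V) (hw : w ≤ N) :
    expansionCoeff (fun s => formsPoly Φ N (jetCurve b s)) w =
      ∑ α ∈ multiIndices K w,
        ((multiFactorial α : ℝ)⁻¹) • Φ (multiAbs α) (multiPow b α) := by
  have hsm : ContDiffAt ℝ ∞ (fun s => formsPoly Φ N (jetCurve b s)) 0 :=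
    ((contDiff_formsPoly Φ N).comp (contDiff_jetCurve b)).contDiffAt
  rw [expansionCoeff_eq_of_isBigO hsm (K := w)
    ((Finset.range (N + 1)).sigma fun m => Finset.piAntidiag (Finset.univ : Finset (Fin K)) m)
    (fun x => multiWeight x.2)
    (fun x => ((multiFactorial x.2 : ℝ)⁻¹) • Φ (multiAbs x.2) (multiPow b x.2)) ?_ le_rfl]
  · refine Finset.sum_bij' (fun x _ => x.2) (fun α _ => ⟨multiAbs α, α⟩) ?_ ?_ ?_ ?_ ?_
    · rintro ⟨m, α⟩ h
      rw [mem_multiIndices]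
      exact (Finset.mem_filter.1 h).2
    -- Since `multiAbs α ≤ multiWeight α = w ≤ N`, truncation at degree `N` loses no multi-index of
    -- weight `w`.
    · intro α h
      rw [mem_multiIndices] at h
      have := multiAbs_le_multiWeight α
      simp only [Finset.mem_filter, Finset.mem_sigma, Finset.mem_range, Finset.mem_piAntidiag]
      exact ⟨⟨by omega, by simp⟩, h⟩
    · rintro ⟨m, α⟩ h
      simp only [Finset.mem_filter, Finset.mem_sigma, Finset.mem_piAntidiag] at h
      simp only [multiAbs]
      rw [Sigma.mk.injEq]
      exact ⟨h.1.2.1, HEq.rfl⟩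
    · intro α _; rfl
    · intro x _; rfl
  · refine (Asymptotics.isBigO_zero _ _).congr_left fun s => ?_
    rw [Finset.sum_sigma, formsPoly, eq_comm, sub_eq_zero]
    refine Finset.sum_congr rfl fun m hm => ?_
    exact inv_factorial_smul_map_sum_pow (Φ m) rfl
      (hsymm m (Nat.lt_succ_iff.1 (Finset.mem_range.1 hm))) b s

end MultiIndex

/-! ### Symmetry of higher derivatives and the formula of Faà di Bruno -/

section FaaDiBruno

variable {E F : Type*} [NormedAddCommGroup E] [NormedSpace ℝ E] [NormedAddCommGroup F]
  [NormedSpace ℝ F]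

/-- The swap of the first two slots is the symmetry of the second derivative of `D^{m-1} f`. Any
other adjacent swap acts inside the lower derivative, where the induction hypothesis holds near `x`
and may be differentiated; for this reason `x` is quantified within the induction. -/
theorem ContDiffAt.iteratedFDeriv_comp_swap_succ {f : E → F} (m : ℕ) :
    ∀ (i : Fin m) {x : E}, ContDiffAt ℝ (m + 1 : ℕ) f x → ∀ v : Fin (m + 1) → E,
      iteratedFDeriv ℝ (m + 1) f x (v ∘ Equiv.swap i.castSucc i.succ) =
        iteratedFDeriv ℝ (m + 1) f x v := by
  induction m with
  | zero => exact fun i => i.elim0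
  | succ m ih =>
    intro i x hf v
    have hev : ∀ᶠ y in 𝓝 x, ContDiffAt ℝ (m + 1 + 1 : ℕ) f y := hf.eventually (by simp)
    have hd {y : E} (hy : ContDiffAt ℝ (m + 1 + 1 : ℕ) f y) :
        DifferentiableAt ℝ (iteratedFDeriv ℝ (m + 1) f) y :=
      hy.differentiableAt_iteratedFDeriv (by exact_mod_cast Nat.lt_succ_self _)
    have key (w : E) (c : Fin (m + 1) → E) :
        fderiv ℝ (fun y => iteratedFDeriv ℝ (m + 1) f y c) x w =
          fderiv ℝ (iteratedFDeriv ℝ (m + 1) f) x w c :=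
      fderiv_continuousMultilinear_apply_const_apply (hd hf) c w
    rw [iteratedFDeriv_succ_apply_left, iteratedFDeriv_succ_apply_left, ← key, ← key]
    refine Fin.cases ?_ (fun i => ?_) i
    · have hD : ContDiffAt ℝ 2 (iteratedFDeriv ℝ m f) x :=
        hf.iteratedFDeriv_right (by norm_cast; omega)
      have hD1 : DifferentiableAt ℝ (fderiv ℝ (iteratedFDeriv ℝ m f)) x :=
        (hD.fderiv_right (m := 1) (by norm_num)).differentiableAt (by simp)
      have h1 (w : E) (c : Fin (m + 1) → E) :
          fderiv ℝ (fun y => iteratedFDeriv ℝ (m + 1) f y c) x w =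
            fderiv ℝ (fderiv ℝ (iteratedFDeriv ℝ m f)) x w (c 0) (Fin.tail c) := by
        simp only [iteratedFDeriv_succ_apply_left]
        rw [fderiv_continuousMultilinear_apply_const_apply
          (hD1.clm_apply (differentiableAt_const _)), fderiv_clm_apply hD1 (differentiableAt_const _)]
        simp
      rw [h1, h1]
      have hsymm := hD.isSymmSndFDerivAt (by simp) (v 1) (v 0)
      have e0 : (v ∘ Equiv.swap (Fin.castSucc (0 : Fin (m + 1))) (Fin.succ 0)) 0 = v 1 := by simp
      have e1 : Fin.tail (v ∘ Equiv.swap (Fin.castSucc (0 : Fin (m + 1))) (Fin.succ 0)) 0 = v 0 := by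
        simp [Fin.tail]
      have e2 : Fin.tail (Fin.tail (v ∘ Equiv.swap (Fin.castSucc (0 : Fin (m + 1))) (Fin.succ 0))) =
          Fin.tail (Fin.tail v) := by
        funext r
        simp only [Fin.tail, Function.comp]
        rw [Equiv.swap_apply_of_ne_of_ne] <;> simp [Fin.ext_iff]
      rw [e0, e1, e2, hsymm]
      rfl
    · have e0 : (v ∘ Equiv.swap i.succ.castSucc i.succ.succ) 0 = v 0 := by
        rw [Function.comp, Equiv.swap_apply_of_ne_of_ne] <;> simp [Fin.ext_iff]
      have e1 : Fin.tail (v ∘ Equiv.swap i.succ.castSucc i.succ.succ) =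
          Fin.tail v ∘ Equiv.swap i.castSucc i.succ := by
        funext r
        simp only [Fin.tail, Function.comp]
        congr 1
        rw [Fin.castSucc_succ, (Fin.succ_injective _).map_swap]
      rw [e0, e1]
      congr 1
      refine Filter.EventuallyEq.fderiv_eq ?_
      filter_upwards [hev] with y hy
      exact ih i (hy.of_le (by norm_cast; omega)) _

/-- The iterated derivatives of a smooth function are symmetric. -/
theorem ContDiffAt.iteratedFDeriv_comp_perm_of_infty {f : E → F} {x : E} (hf : ContDiffAt ℝ ∞ f x)
    {m : ℕ} (σ : Equiv.Perm (Fin m)) (v : Fin m → E) :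
    iteratedFDeriv ℝ m f x (v ∘ σ) = iteratedFDeriv ℝ m f x v := by
  cases m with
  | zero => exact congrArg _ (Subsingleton.elim _ _)
  | succ m =>
    have h : σ ∈ Submonoid.closure
        (range fun i : Fin m => Equiv.swap i.castSucc i.succ) := by
      rw [Equiv.Perm.mclosure_swap_castSucc_succ]; trivial
    induction h using Submonoid.closure_induction generalizing v with
    | mem _ h =>
      obtain ⟨i, rfl⟩ := h
      exact (hf.of_le (by exact_mod_cast le_top)).iteratedFDeriv_comp_swap_succ m i v
    | one => rfl
    | mul σ τ _ _ h1 h2 =>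
      rw [Equiv.Perm.coe_mul, ← Function.comp_assoc, h2, h1]

/-- Coefficients up to order `K` depend only on the `K`-jet of the inner curve, because `f` is
Lipschitz near `γ 0`. -/
theorem expansionCoeff_comp_congr [CompleteSpace F] {f : E → F} {γ δ : ℝ → E}
    (hγ : ContDiffAt ℝ ∞ γ 0) (hδ : ContDiffAt ℝ ∞ δ 0) (h0 : γ 0 = δ 0)
    (hf : ContDiffAt ℝ ∞ f (γ 0)) {K : ℕ}
    (h : (fun s => γ s - δ s) =O[𝓝 0] fun s => s ^ (K + 1)) {r : ℕ} (hr : r ≤ K) :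
    expansionCoeff (fun s => f (γ s)) r = expansionCoeff (fun s => f (δ s)) r := by
  refine expansionCoeff_eq_of_sub_isBigO (hf.comp 0 hγ) ((h0 ▸ hf : ContDiffAt ℝ ∞ f (δ 0)).comp 0 hδ)
    (Asymptotics.IsBigO.trans ?_ h) hr
  have h1 := (hf.hasStrictFDerivAt (by simp)).isBigO_sub
  have h2 : Tendsto (fun s => (γ s, δ s)) (𝓝 0) (𝓝 (γ 0, γ 0)) := by
    have := hγ.continuousAt.prodMk hδ.continuousAt
    rw [ContinuousAt, ← h0] at this
    exact this
  exact h1.comp_tendsto h2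

theorem sub_jetCurve_isBigO [CompleteSpace E] {γ : ℝ → E} (hγ : ContDiffAt ℝ ∞ γ 0) (K : ℕ) :
    (fun s => γ s - γ 0 - jetCurve (fun i : Fin K => expansionCoeff γ (i + 1)) s) =O[𝓝 0]
      fun s => s ^ (K + 1) := by
  refine (sub_sum_expansionCoeff_isBigO hγ K).congr_left fun s => ?_
  rw [Finset.sum_range_succ', jetCurve, Finset.sum_range, expansionCoeff_zero]
  simp only [pow_zero, one_smul]
  abel

/-- Coefficients of a polynomial along a smooth curve. -/
theorem expansionCoeff_formsPoly_comp [CompleteSpace E] [CompleteSpace F]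
    {Φ : (m : ℕ) → E [×m]→L[ℝ] F} {K N w : ℕ}
    (hsymm : ∀ m ≤ N, ∀ (σ : Equiv.Perm (Fin m)) (v : Fin m → E), Φ m (v ∘ σ) = Φ m v)
    {γ : ℝ → E} (hγ : ContDiffAt ℝ ∞ γ 0) (hw : w ≤ N) (hwK : w ≤ K) :
    expansionCoeff (fun s => formsPoly Φ N (γ s - γ 0)) w = ∑ α ∈ multiIndices K w,
      ((multiFactorial α : ℝ)⁻¹) • Φ (multiAbs α)
        (multiPow (fun i : Fin K => expansionCoeff γ (i + 1)) α) := by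
  rw [← expansionCoeff_formsPoly hsymm _ hw]
  refine expansionCoeff_comp_congr (f := formsPoly Φ N) (γ := fun s => γ s - γ 0)
    (hγ.sub contDiffAt_const) (contDiff_jetCurve _).contDiffAt ?_
    (contDiff_formsPoly Φ N).contDiffAt (sub_jetCurve_isBigO hγ K) hwK
  simp [jetCurve]

/-- The formula of Faà di Bruno. -/
theorem expansionCoeff_comp [CompleteSpace E] [CompleteSpace F] {f : E → F} {γ : ℝ → E}
    (hγ : ContDiffAt ℝ ∞ γ 0) (hf : ContDiffAt ℝ ∞ f (γ 0)) {K w : ℕ} (hw : w ≤ K) :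
    expansionCoeff (fun s => f (γ s)) w = ∑ α ∈ multiIndices K w,
      ((multiFactorial α : ℝ)⁻¹) • iteratedFDeriv ℝ (multiAbs α) f (γ 0)
        (multiPow (fun i : Fin K => expansionCoeff γ (i + 1)) α) := by
  -- The function is replaced by its Taylor polynomial of degree `K`, whose coefficients are
  -- symmetric forms. As `γ s - γ 0 = O(s)`, the error is `O(s^{K+1})`.
  rw [← expansionCoeff_formsPoly_comp (Φ := fun m => iteratedFDeriv ℝ m f (γ 0)) (N := K)
    (fun m _ σ v => hf.iteratedFDeriv_comp_perm_of_infty σ v) hγ hw hw]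
  have hγ' : ContDiffAt ℝ ∞ (fun s => γ s - γ 0) 0 := hγ.sub contDiffAt_const
  refine expansionCoeff_eq_of_sub_isBigO (K := K) (hf.comp 0 hγ)
    ((contDiff_formsPoly _ _).contDiffAt.comp 0 hγ') ?_ hw
  have h1 : Tendsto (fun s => γ s - γ 0) (𝓝 0) (𝓝 0) := by
    have := hγ'.continuousAt.tendsto
    rwa [sub_self] at this
  have h2 : (fun s => γ s - γ 0) =O[𝓝 0] fun s : ℝ => s := by
    have := (hγ.differentiableAt (by simp)).isBigO_sub
    simpa using this
  refine (((taylor_isBigO hf K).comp_tendsto h1).trans (h2.norm_left.pow (K + 1))).congr_left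
    fun s => ?_
  simp [formsPoly]

end FaaDiBruno

/-! ### Symmetric forms and polarisation -/

section SymmetricForms

variable {V W : Type*} [NormedAddCommGroup V] [NormedSpace ℝ V] [NormedAddCommGroup W]
  [NormedSpace ℝ W]

theorem expansionCoeff_pow_smul [CompleteSpace W] (k : ℕ) (c : W) :
    expansionCoeff (fun s : ℝ => s ^ k • c) k = c := by
  rw [expansionCoeff_eq_of_isBigO (f := fun s : ℝ => s ^ k • c) (K := k) (by fun_prop) {k} id
    (fun _ => c) ?_ le_rfl]
  · rw [Finset.filter_true_of_mem] <;> simp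
  · refine (Asymptotics.isBigO_zero _ _).congr_left fun s => ?_
    simp

theorem expansionCoeff_line [CompleteSpace W] {f : V → W} {x₀ : V} (hf : ContDiffAt ℝ ∞ f x₀)
    (v : V) (r : ℕ) : expansionCoeff (fun s => f (x₀ + s • v)) r =
      ((r.factorial : ℝ)⁻¹) • iteratedFDeriv ℝ r f x₀ fun _ => v := by
  have hline : ContDiff ℝ ∞ fun s : ℝ => x₀ + s • v := by fun_prop
  have h0 : ContDiffAt ℝ ∞ f (x₀ + (0 : ℝ) • v) := by simpa using hf
  have h1 : Tendsto (fun s : ℝ => s • v) (𝓝 0) (𝓝 0) := by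
    have : Continuous fun s : ℝ => s • v := by fun_prop
    simpa using this.tendsto 0
  rw [expansionCoeff_eq_of_isBigO (f := fun s => f (x₀ + s • v))
    (h0.comp 0 hline.contDiffAt) (K := r) (Finset.range (r + 1)) id
    (fun m => ((m.factorial : ℝ)⁻¹) • iteratedFDeriv ℝ m f x₀ fun _ => v) ?_ le_rfl]
  · rw [Finset.sum_filter, Finset.sum_eq_single r] <;> simp +contextual
  · refine (((taylor_isBigO hf r).comp_tendsto h1).trans
      (Asymptotics.IsBigO.of_bound (‖v‖ ^ (r + 1)) ?_)).congr_left fun s => ?_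
    · refine Eventually.of_forall fun s => ?_
      simp [norm_smul, mul_pow, mul_comm]
    · simp only [Function.comp, id]
      congr 1
      refine Finset.sum_congr rfl fun m _ => ?_
      have := (iteratedFDeriv ℝ m f x₀).map_smul_univ (fun _ => s) fun _ => v
      simp only [Finset.prod_const, Finset.card_univ, Fintype.card_fin] at this
      rw [this, smul_comm]

/-- The symmetric `k`-linear form with diagonal `h`, for a homogeneous polynomial map `h` of degree
`k`. -/
noncomputable def diagForm (k : ℕ) (h : V → W) : V [×k]→L[ℝ] W :=
  ((k.factorial : ℝ)⁻¹) • iteratedFDeriv ℝ k h 0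

theorem diagForm_comp_perm {h : V → W} (hh : ContDiffAt ℝ ∞ h 0) {k : ℕ} (σ : Equiv.Perm (Fin k))
    (v : Fin k → V) : diagForm k h (v ∘ σ) = diagForm k h v := by
  simp only [diagForm, smul_apply, hh.iteratedFDeriv_comp_perm_of_infty σ v]

theorem diagForm_diag [CompleteSpace W] {h : V → W} (hh : ContDiffAt ℝ ∞ h 0) {k : ℕ}
    (hom : ∀ (s : ℝ) v, h (s • v) = s ^ k • h v) (v : V) : diagForm k h (fun _ => v) = h v := by
  rw [diagForm, smul_apply, ← expansionCoeff_line hh v k, ← expansionCoeff_pow_smul k (h v)]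
  simp only [zero_add, hom]

/-- Polarisation: the `k`-th derivative at `0` of the diagonal `x ↦ f(x, …, x)` is the sum of `f`
over all permutations of its arguments, which is `k! f` for symmetric `f`. -/
theorem ContinuousMultilinearMap.eq_of_diag_eq {k : ℕ} {f g : V [×k]→L[ℝ] W}
    (hf : ∀ (σ : Equiv.Perm (Fin k)) v, f (v ∘ σ) = f v)
    (hg : ∀ (σ : Equiv.Perm (Fin k)) v, g (v ∘ σ) = g v)
    (h : ∀ v, f (fun _ => v) = g fun _ => v) : f = g := by
  have key (f : V [×k]→L[ℝ] W) (hf : ∀ (σ : Equiv.Perm (Fin k)) v, f (v ∘ σ) = f v)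
      (v : Fin k → V) : iteratedFDeriv ℝ k (fun x => f fun _ => x) 0 v =
        (k.factorial : ℝ) • f v := by
    rw [f.iteratedFDeriv_comp_diagonal]
    rw [show ∑ σ : Equiv.Perm (Fin k), (f fun i => v (σ i)) = ∑ _σ : Equiv.Perm (Fin k), f v from
      Finset.sum_congr rfl fun σ _ => hf σ v]
    simp [Fintype.card_perm, Nat.cast_smul_eq_nsmul]
  ext v
  have h1 := key f hf v
  rw [funext h, key g hg v] at h1
  exact (smul_right_injective W (Nat.cast_ne_zero.2 k.factorial_ne_zero : (k.factorial : ℝ) ≠ 0)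
    h1).symm

/-- The space of symmetric forms. -/
def symmetricForms (V W : Type*) [NormedAddCommGroup V] [NormedSpace ℝ V] [NormedAddCommGroup W]
    [NormedSpace ℝ W] (k : ℕ) : Submodule ℝ (V [×k]→L[ℝ] W) where
  carrier := {f | ∀ (σ : Equiv.Perm (Fin k)) v, f (v ∘ σ) = f v}
  add_mem' hf hg σ v := by simp [hf σ v, hg σ v]
  zero_mem' _ _ := rfl
  smul_mem' c f hf σ v := by simp [hf σ v]

instance [FiniteDimensional ℝ V] [FiniteDimensional ℝ W] (k : ℕ) :
    FiniteDimensional ℝ (V [×k]→L[ℝ] W) :=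
  FiniteDimensional.of_injective
    (ContinuousMultilinearMap.toMultilinearMapLinear (A := ℝ) (R' := ℝ) (M₁ := fun _ : Fin k => V)
      (M₂ := W)) ContinuousMultilinearMap.toMultilinearMap_injective

/-- Restriction to the diagonal is linear and injective on a finite-dimensional space, hence an
embedding into `V → W` with the product topology. Continuity of every diagonal value therefore gives
continuity of the form. -/
theorem continuousOn_of_diag [FiniteDimensional ℝ V] [FiniteDimensional ℝ W] {k : ℕ} {S : Set ℝ}
    {f : ℝ → V [×k]→L[ℝ] W} (hf : ∀ t ∈ S, f t ∈ symmetricForms V W k)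
    (hd : ∀ v, ContinuousOn (fun t => f t fun _ => v) S) : ContinuousOn f S := by
  let D : symmetricForms V W k →ₗ[ℝ] (V → W) :=
    { toFun := fun f v => f.1 fun _ => v
      map_add' := fun _ _ => rfl
      map_smul' := fun _ _ => rfl }
  have hD : LinearMap.ker D = ⊥ := by
    rw [LinearMap.ker_eq_bot]
    exact fun f g h => Subtype.ext
      (ContinuousMultilinearMap.eq_of_diag_eq f.2 g.2 fun v => congrFun h v)
  have h1 := LinearMap.isClosedEmbedding_of_injective hD
  rw [continuousOn_iff_continuous_domRestrict]
  have h2 : Continuous fun t : S => (⟨f t, hf t t.2⟩ : symmetricForms V W k) := by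
    rw [h1.isInducing.continuous_iff]
    exact continuous_pi fun v => (hd v).domRestrict
  exact continuous_subtype_val.comp h2

/-- The integral of symmetric forms is symmetric, so polarisation recovers the integral equation
from its diagonal. The equations defining adapted forms are stated only on diagonals. -/
theorem SolvesODE.of_diag [CompleteSpace W] {k : ℕ} {a b : ℝ} (hab : a ≤ b) {f g : ℝ → V [×k]→L[ℝ] W}
    (hf : ∀ t ∈ Icc a b, f t ∈ symmetricForms V W k)
    (hgs : ∀ t ∈ Icc a b, g t ∈ symmetricForms V W k)
    (hg : IntervalIntegrable g volume a b)
    (h : ∀ v, SolvesODE (fun t => f t fun _ => v) (fun t => g t fun _ => v) a b) :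
    SolvesODE f g a b := by
  refine ⟨hg, fun t ht => ?_⟩
  have hgt : IntervalIntegrable g volume a t := hg.mono_Icc hab ⟨le_rfl, hab⟩ ht
  have hev (v : Fin k → V) : (∫ τ in a..t, g τ) v = ∫ τ in a..t, g τ v :=
    ((ContinuousMultilinearMap.apply ℝ (fun _ : Fin k => V) W v).intervalIntegral_comp_comm
      hgt).symm
  refine ContinuousMultilinearMap.eq_of_diag_eq (hf t ht)
    ((symmetricForms V W k).add_mem (hf a ⟨le_rfl, hab⟩) fun σ v => ?_) fun v => ?_
  · rw [hev, hev]
    refine intervalIntegral.integral_congr fun τ hτ => ?_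
    rw [uIcc_of_le ht.1] at hτ
    exact hgs τ ⟨hτ.1, hτ.2.trans ht.2⟩ σ v
  · rw [add_apply, hev]
    exact (h v).2 t ht

end SymmetricForms

/-! ### Taylor coefficients depending on a parameter -/

section ParametricExpansion

variable {E W : Type*} [NormedAddCommGroup E] [NormedSpace ℝ E] [NormedAddCommGroup W]
  [NormedSpace ℝ W] [CompleteSpace W]

theorem expansionCoeff_eq_iteratedFDeriv {H : E × ℝ → W} (hH : ContDiff ℝ ∞ H) (k : ℕ) (z : E) :
    expansionCoeff (fun s => H (z, s)) k =
      ((k.factorial : ℝ)⁻¹) • iteratedFDeriv ℝ k H (z, 0) fun _ => (0, 1) := by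
  rw [← expansionCoeff_line hH.contDiffAt]
  simp

theorem contDiff_expansionCoeff {H : E × ℝ → W} (hH : ContDiff ℝ ∞ H) (k : ℕ) :
    ContDiff ℝ ∞ fun z => expansionCoeff (fun s => H (z, s)) k := by
  simp only [expansionCoeff_eq_iteratedFDeriv hH]
  refine ContDiff.const_smul _ ?_
  have h1 : ContDiff ℝ ∞ fun z : E => iteratedFDeriv ℝ k H (z, 0) :=
    (hH.iteratedFDeriv_right (m := ∞) (by exact_mod_cast le_top)).comp (contDiff_id.prodMk contDiff_const)
  exact (ContinuousMultilinearMap.apply ℝ (fun _ : Fin k => E × ℝ) W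
    fun _ => (0, 1)).contDiff.comp h1

/-- Differentiation in `z` commutes with taking a coefficient in `s`, by symmetry of the derivative
of order `k + 1` of `H`. -/
theorem fderiv_expansionCoeff {H : E × ℝ → W} (hH : ContDiff ℝ ∞ H) (k : ℕ) (z z' : E) :
    fderiv ℝ (fun z => expansionCoeff (fun s => H (z, s)) k) z z' =
      expansionCoeff (fun s => fderiv ℝ (fun z => H (z, s)) z z') k := by
  have hp (z : E) (s : ℝ) : HasFDerivAt (fun z : E => (z, s)) (ContinuousLinearMap.inl ℝ E ℝ) z :=
    hasFDerivAt_prodMk_left z s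
  have h1 (s : ℝ) : fderiv ℝ (fun z => H (z, s)) z z' = fderiv ℝ H (z, s) (z', 0) := by
    have := ((hH.differentiable (by simp) (z, s)).hasFDerivAt.comp z (hp z s)).fderiv
    change fderiv ℝ (fun z => H (z, s)) z = _ at this
    rw [this]
    simp
  have hD : ContDiff ℝ ∞ (fderiv ℝ H) := hH.fderiv_right (m := ∞) (by simp)
  have hDv : ContDiff ℝ ∞ fun p => fderiv ℝ H p (z', 0) := hD.clm_apply contDiff_const
  have hK : ContDiff ℝ ∞ (iteratedFDeriv ℝ k H) := hH.iteratedFDeriv_right (m := ∞) (by exact_mod_cast le_top)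
  have hK1 : DifferentiableAt ℝ (fun z : E => iteratedFDeriv ℝ k H (z, 0)) z :=
    ((hK.comp (contDiff_id.prodMk contDiff_const)).differentiable (by simp)) z
  simp only [h1]
  rw [expansionCoeff_eq_iteratedFDeriv hDv]
  simp only [expansionCoeff_eq_iteratedFDeriv hH]
  have h2 : fderiv ℝ (fun z : E => iteratedFDeriv ℝ k H (z, 0)) z z' =
      fderiv ℝ (iteratedFDeriv ℝ k H) (z, 0) (z', 0) := by
    have := ((hK.differentiable (by simp) (z, 0)).hasFDerivAt.comp z (hp z 0)).fderiv
    change fderiv ℝ (fun z : E => iteratedFDeriv ℝ k H (z, 0)) z = _ at this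
    rw [this]
    simp
  set c : Fin k → E × ℝ := fun _ => (0, 1)
  have h3 : DifferentiableAt ℝ (fun z : E => iteratedFDeriv ℝ k H (z, 0) c) z :=
    (ContinuousMultilinearMap.apply ℝ (fun _ : Fin k => E × ℝ) W c).differentiableAt.comp z hK1
  have h4 : iteratedFDeriv ℝ k (fun p => fderiv ℝ H p (z', 0)) (z, 0) c =
      iteratedFDeriv ℝ k (fderiv ℝ H) (z, 0) c (z', 0) := by
    have := (ContinuousLinearMap.apply ℝ W ((z', 0) : E × ℝ)).iteratedFDeriv_comp_left
      (f := fderiv ℝ H) (x := (z, 0)) hD.contDiffAt (i := k) (by exact_mod_cast le_top)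
    change iteratedFDeriv ℝ k (fun p => fderiv ℝ H p (z', 0)) (z, 0) = _ at this
    rw [this]
    rfl
  rw [fderiv_fun_const_smul h3, smul_apply, fderiv_continuousMultilinear_apply_const_apply hK1, h2,
    h4]
  congr 1
  -- The direction `(z', 0)` occupies the first slot on one side and the last on the other; the
  -- cyclic permutation `finRotate` exchanges the two arrangements.
  have h5 := iteratedFDeriv_succ_apply_left (𝕜 := ℝ) (f := H) (x := (z, 0)) (n := k)
    (Fin.cons (z', 0) c)
  have h6 := iteratedFDeriv_succ_apply_right (𝕜 := ℝ) (f := H) (x := (z, 0)) (n := k)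
    (Fin.snoc c (z', 0))
  rw [Fin.cons_zero, Fin.tail_cons] at h5
  rw [Fin.init_snoc, Fin.snoc_last] at h6
  rw [← h5, ← h6, ← hH.contDiffAt.iteratedFDeriv_comp_perm_of_infty (finRotate (k + 1))
    (Fin.cons (z', 0) c)]
  congr 1
  funext i
  refine Fin.lastCases ?_ (fun i => ?_) i
  · simp
  · rw [Function.comp, finRotate_apply, Fin.snoc_castSucc, Fin.coeSucc_eq_succ, Fin.cons_succ]

end ParametricExpansion

/-! ### The equation of the forms as a directional derivative of a polynomial -/

section FormsEquation

variable {V : Type*} [NormedAddCommGroup V] [NormedSpace ℝ V]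

/-- `∑_{s=1}^k (k choose s) Φ^{k-s+1}[D^s_x Y[b, …, b], b, …, b]`. -/
noncomputable def fieldTerm (Y : V → V) (x : V) (Φ : (m : ℕ) → V [×m]→L[ℝ] ℝ) (k : ℕ) (b : V) : ℝ :=
  ∑ s ∈ Finset.Icc 1 k, (k.choose s : ℝ) *
    Φ (k - s + 1) (Matrix.vecCons (iteratedFDeriv ℝ s Y x fun _ => b) fun _ : Fin (k - s) => b)

theorem contDiff_fieldTerm (Y : V → V) (x : V) (Φ : (m : ℕ) → V [×m]→L[ℝ] ℝ) (k : ℕ) :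
    ContDiff ℝ ∞ (fieldTerm Y x Φ k) := by
  refine ContDiff.sum fun s _ => contDiff_const.mul ((Φ (k - s + 1)).contDiff.comp
    (contDiff_pi.2 fun i => ?_))
  refine Fin.cases ?_ (fun i => ?_) i
  · exact (iteratedFDeriv ℝ s Y x).contDiff.comp (contDiff_pi.2 fun _ => contDiff_id)
  · exact contDiff_id

/-- Each summand contains `b` exactly `s + (k - s) = k` times. Homogeneity makes the term the
diagonal of a symmetric `k`-form. -/
theorem fieldTerm_smul (Y : V → V) (x : V) (Φ : (m : ℕ) → V [×m]→L[ℝ] ℝ) (k : ℕ) (c : ℝ) (b : V) :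
    fieldTerm Y x Φ k (c • b) = c ^ k • fieldTerm Y x Φ k b := by
  rw [fieldTerm, fieldTerm, Finset.smul_sum]
  refine Finset.sum_congr rfl fun s hs => ?_
  rw [Finset.mem_Icc] at hs
  have h1 := (iteratedFDeriv ℝ s Y x).map_smul_univ (fun _ => c) fun _ => b
  simp only [Finset.prod_const, Finset.card_univ, Fintype.card_fin] at h1
  have h2 := (Φ (k - s + 1)).map_smul_univ
    (Fin.cons (c ^ s) fun _ => c : Fin (k - s + 1) → ℝ)
    (Matrix.vecCons (iteratedFDeriv ℝ s Y x fun _ => b) fun _ : Fin (k - s) => b)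
  rw [Fin.prod_univ_succ] at h2
  simp only [Fin.cons_zero, Fin.cons_succ, Finset.prod_const, Finset.card_univ,
    Fintype.card_fin, ← pow_add, show s + (k - s) = k by omega] at h2
  rw [h1, smul_eq_mul, mul_left_comm, ← smul_eq_mul (c ^ k), ← h2]
  congr 2
  funext i
  refine Fin.cases ?_ (fun i => ?_) i <;> simp

/-- Only forms of degree `1, …, k` enter the equation of degree `k`: the system is triangular and
never involves degree `0`. -/
theorem fieldTerm_congr (Y : V → V) (x : V) {Φ Φ' : (m : ℕ) → V [×m]→L[ℝ] ℝ} {k : ℕ}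
    (h : ∀ m ≥ 1, m ≤ k → Φ m = Φ' m) (b : V) : fieldTerm Y x Φ k b = fieldTerm Y x Φ' k b := by
  refine Finset.sum_congr rfl fun s hs => ?_
  rw [Finset.mem_Icc] at hs
  rw [h _ (by omega) (by omega)]

theorem continuousOn_fieldTerm {Y : V → V} {x : ℝ → V} {S : Set ℝ}
    (hY : ∀ s : ℕ, ContinuousOn (fun t => iteratedFDeriv ℝ s Y (x t)) S)
    {Φ : (m : ℕ) → ℝ → V [×m]→L[ℝ] ℝ} {k : ℕ}
    (hΦ : ∀ m ≥ 1, m ≤ k → ContinuousOn (Φ m) S) (b : V) :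
    ContinuousOn (fun t => fieldTerm Y (x t) (fun m => Φ m t) k b) S := by
  refine continuousOn_finsetSum _ fun s hs => continuousOn_const.mul ?_
  rw [Finset.mem_Icc] at hs
  refine (hΦ _ (by omega) (by omega)).eval (continuousOn_pi.2 fun i => ?_)
  refine Fin.cases ?_ (fun i => ?_) i
  · exact (hY s).eval continuousOn_const
  · exact continuousOn_const

theorem ContinuousMultilinearMap.map_update_const_of_symm {m : ℕ} {f : V [×(m + 1)]→L[ℝ] ℝ}
    (hf : f ∈ symmetricForms V ℝ (m + 1)) (v w : V) (i : Fin (m + 1)) :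
    f (Function.update (fun _ => v) i w) = f (Fin.cons w fun _ => v) := by
  rw [← hf (Equiv.swap 0 i)]
  congr 1
  funext j
  refine Fin.cases ?_ (fun j => ?_) j
  · simp
  · rw [Function.comp, Fin.cons_succ, Function.update_apply, if_neg]
    intro h
    have : j.succ = 0 := (Equiv.swap 0 i).injective (by rw [h, Equiv.swap_apply_left])
    exact Fin.succ_ne_zero j this

/-- By symmetry the `m + 1` slots of `Φ (m + 1)` contribute equally, and `(m + 1) / (m + 1)! = 1 /
m!`. -/
theorem fderiv_formsPoly {Φ : (m : ℕ) → V [×m]→L[ℝ] ℝ} {N : ℕ}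
    (hΦ : ∀ m ≤ N + 1, Φ m ∈ symmetricForms V ℝ m) (v w : V) :
    fderiv ℝ (formsPoly Φ (N + 1)) v w = formsPoly (fun m => (Φ (m + 1)).curryLeft w) N v := by
  have hdiag (m : ℕ) : HasFDerivAt (fun v => Φ m fun _ => v)
      (((Φ m).linearDeriv fun _ => v).comp (ContinuousLinearMap.pi fun _ => .id ℝ V)) v :=
    ((Φ m).hasFDerivAt fun _ => v).comp v
      (ContinuousLinearMap.pi fun _ : Fin m => .id ℝ V).hasFDerivAt
  have h1 : HasFDerivAt (formsPoly Φ (N + 1)) (∑ m ∈ Finset.range (N + 1 + 1),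
      ((m.factorial : ℝ)⁻¹) • ((Φ m).linearDeriv fun _ => v).comp
        (ContinuousLinearMap.pi fun _ => .id ℝ V)) v :=
    HasFDerivAt.fun_sum fun m _ => (hdiag m).fun_const_smul _
  rw [h1.fderiv, sum_apply, Finset.sum_range_succ', formsPoly]
  simp only [smul_apply, ContinuousLinearMap.comp_apply,
    ContinuousMultilinearMap.linearDeriv_apply, Finset.univ_eq_empty, Finset.sum_empty, smul_zero,
    add_zero]
  refine Finset.sum_congr rfl fun m hm => ?_
  rw [Finset.mem_range] at hm
  rw [Finset.sum_congr rfl fun i _ => ContinuousMultilinearMap.map_update_const_of_symm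
    (hΦ (m + 1) (by omega)) v _ i]
  simp only [ContinuousLinearMap.coe_pi', ContinuousLinearMap.id_apply, Finset.sum_const,
    Finset.card_univ, Fintype.card_fin, ContinuousMultilinearMap.curryLeft_apply, nsmul_eq_mul,
    smul_eq_mul, Nat.factorial_succ]
  have : (m.factorial : ℝ) ≠ 0 := by exact_mod_cast m.factorial_ne_zero
  push_cast
  field_simp

theorem isBigO_map_cons_const {m : ℕ} (f : V [×(m + 1)]→L[ℝ] ℝ) {w : V → V} {r k : ℕ}
    (hw : w =O[𝓝 0] fun v => ‖v‖ ^ r) (hk : k ≤ r + m) :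
    (fun v => f (Fin.cons (w v) fun _ => v)) =O[𝓝 0] fun v => ‖v‖ ^ k := by
  have h1 : (fun v : V => ‖v‖ ^ (r + m)) =O[𝓝 0] fun v => ‖v‖ ^ k :=
    (pow_isBigO_pow hk).comp_tendsto (by simpa using (continuous_norm (E := V)).tendsto 0)
  have h2 : (fun v => ‖w v‖ * ‖v‖ ^ m) =O[𝓝 0] fun v => ‖v‖ ^ (r + m) :=
    (hw.norm_left.mul (Asymptotics.isBigO_refl (fun v : V => ‖v‖ ^ m) _)).congr_right
      fun v => (pow_add _ _ _).symm
  refine (Asymptotics.IsBigO.of_bound ‖f‖ (Eventually.of_forall fun v => ?_)).trans (h2.trans h1)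
  refine (f.le_opNorm _).trans_eq ?_
  rw [Fin.prod_univ_succ]
  simp

/-- Reindexing by `y = (m - s, s)`, with `(m choose s) / m! = 1 / ((m - s)! s!)`, turns the sum into
part of a product of two Taylor expansions. -/
theorem sum_fieldTerm_eq (Y : V → V) (x : V) (Φ : (m : ℕ) → V [×m]→L[ℝ] ℝ) (N : ℕ) (v : V) :
    ∑ m ∈ Finset.range (N + 1 + 1), ((m.factorial : ℝ)⁻¹) • fieldTerm Y x Φ m v =
      ∑ y ∈ Finset.range (N + 1) ×ˢ Finset.Icc 1 (N + 1) with y.1 + y.2 ≤ N + 1,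
        ((y.1.factorial : ℝ)⁻¹) * ((y.2.factorial : ℝ)⁻¹) *
          Φ (y.1 + 1) (Fin.cons (iteratedFDeriv ℝ y.2 Y x fun _ => v) fun _ => v) := by
  simp only [fieldTerm, Finset.smul_sum]
  rw [Finset.sum_sigma']
  refine Finset.sum_bij' (fun y _ => (y.1 - y.2, y.2)) (fun y _ => ⟨y.1 + y.2, y.2⟩) ?_ ?_ ?_ ?_ ?_
  · rintro ⟨d, s⟩ h
    simp only [Finset.mem_sigma, Finset.mem_range, Finset.mem_Icc, Finset.mem_filter,
      Finset.mem_product] at h ⊢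
    omega
  · rintro ⟨m, s⟩ h
    simp only [Finset.mem_sigma, Finset.mem_range, Finset.mem_Icc, Finset.mem_filter,
      Finset.mem_product] at h ⊢
    omega
  · rintro ⟨d, s⟩ h
    simp only [Finset.mem_sigma, Finset.mem_range, Finset.mem_Icc] at h
    simp only [Sigma.mk.injEq, heq_eq_eq, and_true]
    omega
  · rintro ⟨m, s⟩ h
    simp
  · rintro ⟨d, s⟩ h
    simp only [Finset.mem_sigma, Finset.mem_range, Finset.mem_Icc] at h
    rw [smul_eq_mul, ← mul_assoc]
    congr 1
    rw [Nat.cast_choose ℝ h.2.2]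
    have : (d.factorial : ℝ) ≠ 0 := by exact_mod_cast d.factorial_ne_zero
    field_simp

/-- With `P = formsPoly Φ (N + 1)`, the terms in the equation of the forms are the Taylor terms of
degree at most `N + 1` of `DP(v)[Y(x + v) - Y(x)]`. The value `Y(x)` is subtracted because the base
point moves with the reference trajectory, which is why the sum over `s` starts at `1`. -/
theorem sum_fieldTerm_sub_isBigO [CompleteSpace V] {Y : V → V} {x : V} (hY : ContDiffAt ℝ ∞ Y x)
    {Φ : (m : ℕ) → V [×m]→L[ℝ] ℝ} {N : ℕ} (hΦ : ∀ m ≤ N + 1, Φ m ∈ symmetricForms V ℝ m) :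
    (fun v => ∑ m ∈ Finset.range (N + 1 + 1), ((m.factorial : ℝ)⁻¹) • fieldTerm Y x Φ m v -
      fderiv ℝ (formsPoly Φ (N + 1)) v (Y (x + v) - Y x)) =O[𝓝 0] fun v => ‖v‖ ^ (N + 1 + 1) := by
  set R : V → V := fun v => Y (x + v) - ∑ r ∈ Finset.range (N + 1 + 1),
      ((r.factorial : ℝ)⁻¹) • iteratedFDeriv ℝ r Y x fun _ => v with hR
  have hRO : R =O[𝓝 0] fun v => ‖v‖ ^ (N + 1 + 1) := taylor_isBigO hY (N + 1)
  set c : ℕ × ℕ → V → ℝ := fun y v => ((y.1.factorial : ℝ)⁻¹) * ((y.2.factorial : ℝ)⁻¹) *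
    Φ (y.1 + 1) (Fin.cons (iteratedFDeriv ℝ y.2 Y x fun _ => v) fun _ => v) with hc
  have h1 (v : V) : fderiv ℝ (formsPoly Φ (N + 1)) v (Y (x + v) - Y x) =
      ∑ y ∈ Finset.range (N + 1) ×ˢ Finset.Icc 1 (N + 1), c y v +
      ∑ m ∈ Finset.range (N + 1), ((m.factorial : ℝ)⁻¹) *
        Φ (m + 1) (Fin.cons (R v) fun _ => v) := by
    have e : Y (x + v) - Y x = ∑ r ∈ Finset.Icc 1 (N + 1),
        ((r.factorial : ℝ)⁻¹) • (iteratedFDeriv ℝ r Y x fun _ => v) + R v := by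
      rw [hR]
      simp only
      rw [Finset.range_eq_Ico, Finset.sum_eq_sum_Ico_succ_bot (Nat.succ_pos _)]
      have : Finset.Icc 1 (N + 1) = Finset.Ico (0 + 1) (N + 1 + 1) := by
        ext; simp only [Finset.mem_Icc, Finset.mem_Ico]; omega
      rw [this]
      simp only [Nat.factorial_zero, Nat.cast_one, inv_one, one_smul, iteratedFDeriv_zero_apply]
      abel
    rw [e, fderiv_formsPoly hΦ, formsPoly, Finset.sum_product, ← Finset.sum_add_distrib]
    refine Finset.sum_congr rfl fun m _ => ?_
    rw [map_add, map_sum, add_apply, sum_apply, smul_add, Finset.smul_sum]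
    simp only [map_smul, smul_apply, smul_eq_mul, ← mul_assoc]
    rfl
  -- The product of the two expansions also contains terms of total degree above `N + 1`; these and
  -- the Taylor remainder `R` form the error.
  have h2 : (fun v => ∑ y ∈ Finset.range (N + 1) ×ˢ Finset.Icc 1 (N + 1) with
      ¬ y.1 + y.2 ≤ N + 1, c y v) =O[𝓝 0] fun v => ‖v‖ ^ (N + 1 + 1) := by
    refine Asymptotics.IsBigO.fun_sum fun y hy => ?_
    have hy' := (Finset.mem_filter.1 hy).2
    refine Asymptotics.IsBigO.const_mul_left (isBigO_map_cons_const _ (r := y.2)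
      (Asymptotics.IsBigO.of_bound ‖iteratedFDeriv ℝ y.2 Y x‖
        (Eventually.of_forall fun v => ?_)) (by omega)) _
    refine ((iteratedFDeriv ℝ y.2 Y x).le_opNorm _).trans_eq ?_
    simp
  have h3 : (fun v => ∑ m ∈ Finset.range (N + 1), ((m.factorial : ℝ)⁻¹) *
        Φ (m + 1) (Fin.cons (R v) fun _ => v)) =O[𝓝 0] fun v => ‖v‖ ^ (N + 1 + 1) :=
    Asymptotics.IsBigO.fun_sum fun m _ =>
      Asymptotics.IsBigO.const_mul_left (isBigO_map_cons_const _ hRO (by omega)) _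
  refine (h2.add h3).neg_left.congr_left fun v => ?_
  rw [h1, sum_fieldTerm_eq, ← Finset.sum_filter_add_sum_filter_not
    (Finset.range (N + 1) ×ˢ Finset.Icc 1 (N + 1)) (fun y => y.1 + y.2 ≤ N + 1)]
  ring

end FormsEquation

/-! ### Joint dependence on the forms, the jet and the parameter -/

section EvolutionIdentity

variable {V : Type*} [NormedAddCommGroup V] [NormedSpace ℝ V]

/-- `∑_{m ≤ k} (1/m!) φ^m[v, …, v]` at `v = ∑ sⁱ bᵢ`, as a function of the forms, of `b` and of
`s`. -/
noncomputable def formsEval (k : ℕ)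
    (z : ((∀ m : Fin (k + 1), V [×(m : ℕ)]→L[ℝ] ℝ) × (Fin k → V)) × ℝ) : ℝ :=
  ∑ m : Fin (k + 1), (((m : ℕ).factorial : ℝ)⁻¹) • z.1.1 m fun _ => jetCurve z.1.2 z.2

theorem formsEval_eq (k : ℕ) (Φ : (m : ℕ) → V [×m]→L[ℝ] ℝ) (b : Fin k → V) (s : ℝ) :
    formsEval k ((fun m => Φ m, b), s) = formsPoly Φ k (jetCurve b s) :=
  Fin.sum_univ_eq_sum_range
    (fun m => ((m.factorial : ℝ)⁻¹) • Φ m fun _ => jetCurve b s) (k + 1)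

theorem contDiff_map_diag (m : ℕ) :
    ContDiff ℝ ∞ fun p : (V [×m]→L[ℝ] ℝ) × V => p.1 fun _ => p.2 := by
  have h := (ContinuousLinearMap.id ℝ (V [×m]→L[ℝ] ℝ)).analyticOnNhd_uncurry_of_multilinear
    (s := univ)
  have h' : ContDiff ℝ ∞ fun p : (V [×m]→L[ℝ] ℝ) × (Fin m → V) => p.1 p.2 :=
    contDiff_iff_contDiffAt.2 fun p => (h p trivial).contDiffAt
  exact h'.comp (contDiff_fst.prodMk (contDiff_pi.2 fun _ => contDiff_snd))

theorem hasFDerivAt_map_diag {m : ℕ} (φ φ' : V [×m]→L[ℝ] ℝ) (v v' : V) :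
    fderiv ℝ (fun p : (V [×m]→L[ℝ] ℝ) × V => p.1 fun _ => p.2) (φ, v) (φ', v') =
      (φ' fun _ => v) + fderiv ℝ (fun v => φ fun _ => v) v v' := by
  have hd : DifferentiableAt ℝ (fun p : (V [×m]→L[ℝ] ℝ) × V => p.1 fun _ => p.2) (φ, v) :=
    (contDiff_map_diag m).differentiable (by simp) _
  have h1 := (hd.hasFDerivAt.comp (f := fun e => (e, v)) φ (hasFDerivAt_prodMk_left φ v)).fderiv
  have h2 := (hd.hasFDerivAt.comp (f := fun e => (φ, e)) v (hasFDerivAt_prodMk_right φ v)).fderiv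
  have h3 : fderiv ℝ (fun φ : V [×m]→L[ℝ] ℝ => φ fun _ => v) φ =
      ContinuousMultilinearMap.apply ℝ (fun _ : Fin m => V) ℝ fun _ => v :=
    (ContinuousMultilinearMap.apply ℝ (fun _ : Fin m => V) ℝ fun _ => v).fderiv
  have h4 : ((φ', v') : (V [×m]→L[ℝ] ℝ) × V) = (φ', 0) + (0, v') := by simp
  rw [h4, map_add]
  congr 1
  · have := congrArg (fun L => L φ') (h1.symm.trans h3)
    exact this
  · exact (congrArg (fun L => L v') h2).symm

variable (V) in
/-- `b ↦ ∑ sⁱ bᵢ` as a linear map. -/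
noncomputable def jetCurveCLM (k : ℕ) (s : ℝ) : (Fin k → V) →L[ℝ] V :=
  ∑ j : Fin k, s ^ ((j : ℕ) + 1) • ContinuousLinearMap.proj j

theorem jetCurveCLM_apply {k : ℕ} (s : ℝ) (b : Fin k → V) : jetCurveCLM V k s b = jetCurve b s := by
  simp [jetCurveCLM, jetCurve, sum_apply]

/-- Joint smoothness allows the chain rule to be applied to the forms and the jet together, both of
which are merely absolutely continuous in time. -/
theorem contDiff_formsEval (k : ℕ) : ContDiff ℝ ∞ (formsEval (V := V) k) := by
  have hj : ContDiff ℝ ∞ fun z : ((∀ m : Fin (k + 1), V [×(m : ℕ)]→L[ℝ] ℝ) × (Fin k → V)) × ℝ =>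
      jetCurve z.1.2 z.2 := by
    unfold jetCurve
    fun_prop
  have hm (m : Fin (k + 1)) : ContDiff ℝ ∞
      fun z : ((∀ m : Fin (k + 1), V [×(m : ℕ)]→L[ℝ] ℝ) × (Fin k → V)) × ℝ => z.1.1 m :=
    (ContinuousLinearMap.proj (R := ℝ) (φ := fun m : Fin (k + 1) => V [×(m : ℕ)]→L[ℝ] ℝ)
      m).contDiff.comp (contDiff_fst.comp contDiff_fst)
  exact ContDiff.sum fun m _ => ((contDiff_map_diag m).comp ((hm m).prodMk hj)).const_smul _

/-- The evaluation is linear in the forms, which gives the first term; `jetCurve` is linear in `b`,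
which gives the second. -/
theorem fderiv_formsEval (k : ℕ) (Φ Φ' : (m : ℕ) → V [×m]→L[ℝ] ℝ) (b b' : Fin k → V) (s : ℝ) :
    fderiv ℝ (fun z => formsEval k (z, s)) (fun m : Fin (k + 1) => Φ m, b)
        (fun m : Fin (k + 1) => Φ' m, b') =
      formsPoly Φ' k (jetCurve b s) +
        fderiv ℝ (formsPoly Φ k) (jetCurve b s) (jetCurve b' s) := by
  let A (m : Fin (k + 1)) : ((∀ m : Fin (k + 1), V [×(m : ℕ)]→L[ℝ] ℝ) × (Fin k → V)) →L[ℝ]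
      (V [×(m : ℕ)]→L[ℝ] ℝ) × V :=
    ((ContinuousLinearMap.proj m).comp (.fst ℝ _ _)).prod ((jetCurveCLM V k s).comp (.snd ℝ _ _))
  have hA (m : Fin (k + 1)) (Φ : (m : ℕ) → V [×m]→L[ℝ] ℝ) (b : Fin k → V) :
      A m (fun m => Φ m, b) = (Φ m, jetCurve b s) := by
    simp [A, jetCurveCLM_apply]
  have hd (m : Fin (k + 1)) (z) := (((contDiff_map_diag (V := V) m).differentiable (by simp)
    (A m z)).hasFDerivAt.comp z (A m).hasFDerivAt).fun_const_smul (((m : ℕ).factorial : ℝ)⁻¹)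
  have hsum := HasFDerivAt.fun_sum (u := Finset.univ) fun m _ =>
    hd m ((fun m : Fin (k + 1) => Φ m, b))
  have hfun : (fun z => formsEval (V := V) k (z, s)) = fun z => ∑ m : Fin (k + 1),
      (((m : ℕ).factorial : ℝ)⁻¹) • ((fun p : (V [×(m : ℕ)]→L[ℝ] ℝ) × V => p.1 fun _ => p.2) ∘
        A m) z := by
    funext z
    simp [formsEval, A, jetCurveCLM_apply]
  rw [hfun, hsum.fderiv, sum_apply]
  simp only [smul_apply, ContinuousLinearMap.comp_apply]
  have h1 : formsPoly Φ k = fun v => ∑ m ∈ Finset.range (k + 1),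
      ((m.factorial : ℝ)⁻¹) • Φ m fun _ => v := rfl
  have hdiag (m : ℕ) : DifferentiableAt ℝ (fun v => Φ m fun _ => v) (jetCurve b s) :=
    (((Φ m).contDiff (n := ∞)).comp (contDiff_pi.2 fun _ => contDiff_id)).differentiable
      (by simp) _
  rw [h1, fderiv_fun_sum fun m _ => (hdiag m).fun_const_smul _, sum_apply, formsPoly,
    ← Finset.sum_add_distrib, ← Fin.sum_univ_eq_sum_range
      (fun m => ((m.factorial : ℝ)⁻¹) • (Φ' m fun _ => jetCurve b s) +
        (fderiv ℝ (fun v => ((m.factorial : ℝ)⁻¹) • Φ m fun _ => v) (jetCurve b s))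
          (jetCurve b' s))]
  refine Finset.sum_congr rfl fun m _ => ?_
  rw [hA m Φ' b', fderiv_fun_const_smul (hdiag m), smul_apply, ← smul_add]
  congr 1
  have := hasFDerivAt_map_diag (Φ m) (Φ' m) (jetCurve b s) (jetCurve b' s)
  rw [← hA m Φ b] at this
  exact this

theorem expansionCoeff_clm_comp {E F : Type*} [NormedAddCommGroup E] [NormedSpace ℝ E]
    [NormedAddCommGroup F] [NormedSpace ℝ F] (A : E →L[ℝ] F) {f : ℝ → E}
    (hf : ContDiffAt ℝ ∞ f 0) (k : ℕ) :
    expansionCoeff (fun s => A (f s)) k = A (expansionCoeff f k) := by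
  have h := A.iteratedFDeriv_comp_left (f := f) (x := 0) hf (i := k) (by exact_mod_cast le_top)
  rw [expansionCoeff, expansionCoeff, map_smul, iteratedDeriv_eq_iteratedFDeriv,
    iteratedDeriv_eq_iteratedFDeriv]
  change (_ : ℝ) • (iteratedFDeriv ℝ k (A ∘ f) 0) _ = _
  rw [h]
  rfl

theorem expansionCoeff_add {F : Type*} [NormedAddCommGroup F] [NormedSpace ℝ F] {f g : ℝ → F}
    (hf : ContDiffAt ℝ ∞ f 0) (hg : ContDiffAt ℝ ∞ g 0) (k : ℕ) :
    expansionCoeff (fun s => f s + g s) k = expansionCoeff f k + expansionCoeff g k := by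
  have hk : ((k : ℕ) : WithTop ℕ∞) ≤ ∞ := by exact_mod_cast le_top
  rw [expansionCoeff, iteratedDeriv_fun_add (hf.of_le hk) (hg.of_le hk), smul_add]
  rfl

theorem expansionCoeff_sum {F ι : Type*} [NormedAddCommGroup F] [NormedSpace ℝ F] {S : Finset ι}
    {f : ι → ℝ → F} (hf : ∀ i ∈ S, ContDiffAt ℝ ∞ (f i) 0) (k : ℕ) :
    expansionCoeff (fun s => ∑ i ∈ S, f i s) k = ∑ i ∈ S, expansionCoeff (f i) k := by
  have hk : ((k : ℕ) : WithTop ℕ∞) ≤ ∞ := by exact_mod_cast le_top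
  rw [expansionCoeff, iteratedDeriv_fun_sum fun i hi => (hf i hi).of_le hk, Finset.smul_sum]
  rfl

theorem expansionCoeff_const_smul {F : Type*} [NormedAddCommGroup F] [NormedSpace ℝ F] (c : ℝ)
    {f : ℝ → F} (hf : ContDiffAt ℝ ∞ f 0) (k : ℕ) :
    expansionCoeff (fun s => c • f s) k = c • expansionCoeff f k :=
  expansionCoeff_clm_comp (c • ContinuousLinearMap.id ℝ F) hf k

end EvolutionIdentity

/-! ### Cancellation of the reference control -/

section GradedDerivative

variable {n l : ℕ}

local notation "𝔼" => EuclideanSpace ℝ (Fin n)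

theorem expansionCoeff_fderiv_formsPoly {V : Type*} [NormedAddCommGroup V] [NormedSpace ℝ V]
    [CompleteSpace V] {Φ : (m : ℕ) → V [×m]→L[ℝ] ℝ} {N : ℕ}
    (hΦ : ∀ m ≤ N + 1, Φ m ∈ symmetricForms V ℝ m) {ξ : ℝ → V} (hξ : ContDiffAt ℝ ∞ ξ 0) {w K : ℕ}
    (hw : w ≤ N) (hwK : w ≤ K) (c : V) :
    expansionCoeff (fun s => fderiv ℝ (formsPoly Φ (N + 1)) (ξ s - ξ 0)) w c =
      ∑ α ∈ multiIndices K w, ((multiFactorial α : ℝ)⁻¹) *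
        (Φ (multiAbs α + 1)).curryLeft c
          (multiPow (fun i : Fin K => expansionCoeff ξ (i + 1)) α) := by
  have hD : ContDiffAt ℝ ∞ (fun s => fderiv ℝ (formsPoly Φ (N + 1)) (ξ s - ξ 0)) 0 :=
    (((contDiff_formsPoly Φ (N + 1)).fderiv_right (m := ∞) (by simp)).contDiffAt).comp 0
      (hξ.sub contDiffAt_const)
  have h1 := expansionCoeff_clm_comp (ContinuousLinearMap.apply ℝ ℝ c) hD w
  rw [ContinuousLinearMap.apply_apply] at h1
  rw [← h1]
  simp only [ContinuousLinearMap.apply_apply, fderiv_formsPoly hΦ]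
  rw [expansionCoeff_formsPoly_comp (K := K) (fun m hm σ v => ?_) hξ hw hwK]
  · rfl
  · simp only [ContinuousMultilinearMap.curryLeft_apply]
    -- The permutation that fixes slot `0` and acts as `σ` on the others shows that filling the
    -- first slot by `c` preserves symmetry.
    rw [← hΦ (m + 1) (by omega) (Equiv.Perm.decomposeFin.symm (0, σ)) (Fin.cons c v)]
    congr 1
    funext i
    refine Fin.cases ?_ (fun i => ?_) i <;> simp

/-- The derivative of the graded polynomial along the equations of the forms and of the variations
of a curve. -/
theorem fderiv_expansionCoeff_formsEval_eq_coordsRHS {Y : Fin l → 𝔼 → 𝔼} {u Δu : Fin l → ℝ} {N : ℕ}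
    {ξ : ℝ → 𝔼} (hξ : ContDiffAt ℝ ∞ ξ 0) (hY : ∀ i, ContDiffAt ℝ ∞ (Y i) (ξ 0))
    {Φ Φ' : (m : ℕ) → 𝔼 [×m]→L[ℝ] ℝ} (hΦ : ∀ m ≤ N + 1, Φ m ∈ symmetricForms 𝔼 ℝ m)
    (hd : ∀ m ≤ N + 1, ∀ v, (Φ' m fun _ => v) = -∑ i, u i * fieldTerm (Y i) (ξ 0) Φ m v)
    {b' : Fin (N + 1) → 𝔼}
    (hb' : ∀ r, b' r = ∑ i, (u i • expansionCoeff (fun s => Y i (ξ s)) (r + 1) +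
      Δu i • expansionCoeff (fun s => Y i (ξ s)) r)) :
    fderiv ℝ (fun z => expansionCoeff (fun s => formsEval (N + 1) (z, s)) (N + 1))
        (fun m : Fin (N + 1 + 1) => Φ m, fun r : Fin (N + 1) => expansionCoeff ξ (r + 1))
        (fun m : Fin (N + 1 + 1) => Φ' m, b') =
      coordsRHS Y Δu (ξ 0) Φ (N + 1) fun r : Fin (N + 1) => expansionCoeff ξ (r + 1) := by
  set b : Fin (N + 1) → 𝔼 := fun r => expansionCoeff ξ (r + 1) with hb
  set D : 𝔼 → 𝔼 →L[ℝ] ℝ := fderiv ℝ (formsPoly Φ (N + 1)) with hDdef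
  have hDs : ContDiff ℝ ∞ D := (contDiff_formsPoly Φ (N + 1)).fderiv_right (m := ∞) (by simp)
  have hξ0 : ContDiffAt ℝ ∞ (fun s => ξ s - ξ 0) 0 := hξ.sub contDiffAt_const
  have hjb : ContDiffAt ℝ ∞ (jetCurve b) 0 := (contDiff_jetCurve b).contDiffAt
  have hjb' : ContDiffAt ℝ ∞ (jetCurve b') 0 := (contDiff_jetCurve b').contDiffAt
  have hDξ : ContDiffAt ℝ ∞ (fun s => D (ξ s - ξ 0)) 0 := hDs.contDiffAt.comp 0 hξ0
  have hDb : ContDiffAt ℝ ∞ (fun s => D (jetCurve b s)) 0 := hDs.contDiffAt.comp 0 hjb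
  have hYξ (i : Fin l) : ContDiffAt ℝ ∞ (fun s => Y i (ξ s)) 0 := (hY i).comp 0 hξ
  have hYξ0 (i : Fin l) : ContDiffAt ℝ ∞ (fun s => Y i (ξ s) - Y i (ξ 0)) 0 :=
    (hYξ i).sub contDiffAt_const
  have hjet : (fun s => ξ s - ξ 0 - jetCurve b s) =O[𝓝 0] fun s => s ^ (N + 1 + 1) :=
    sub_jetCurve_isBigO hξ (N + 1)
  have hj0 : ξ 0 - ξ 0 = jetCurve b 0 := by simp [jetCurve]
  rw [fderiv_expansionCoeff (contDiff_formsEval (N + 1))]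
  simp only [fderiv_formsEval]
  have hT1 : ContDiffAt ℝ ∞ (fun s => formsPoly Φ' (N + 1) (jetCurve b s)) 0 :=
    (contDiff_formsPoly _ _).contDiffAt.comp 0 hjb
  rw [expansionCoeff_add hT1 (hDb.clm_apply hjb')]
  -- The motion of the forms: up to `O(s^{N+2})` it equals minus the derivative of the polynomial
  -- along the reference fields, relative to the base point.
  have e1 : expansionCoeff (fun s => formsPoly Φ' (N + 1) (jetCurve b s)) (N + 1) =
      expansionCoeff (fun s => ∑ i, (-u i) • D (ξ s - ξ 0) (Y i (ξ s) - Y i (ξ 0))) (N + 1) := by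
    rw [← expansionCoeff_comp_congr (f := formsPoly Φ' (N + 1)) hξ0 hjb hj0
      (contDiff_formsPoly _ _).contDiffAt hjet le_rfl]
    refine expansionCoeff_eq_of_sub_isBigO (K := N + 1)
      ((contDiff_formsPoly _ _).contDiffAt.comp 0 hξ0)
      (ContDiffAt.sum fun i _ => (hDξ.clm_apply (hYξ0 i)).const_smul _) ?_ le_rfl
    have h1 : Tendsto (fun s => ξ s - ξ 0) (𝓝 0) (𝓝 0) := by
      have := hξ0.continuousAt.tendsto
      rwa [sub_self] at this
    have h2 : (fun s => ξ s - ξ 0) =O[𝓝 0] fun s : ℝ => s := by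
      simpa using (hξ.differentiableAt (by simp)).isBigO_sub
    have h3 (i : Fin l) := ((sum_fieldTerm_sub_isBigO (hY i) hΦ).comp_tendsto h1).trans
      (h2.norm_left.pow (N + 1 + 1))
    refine (Asymptotics.IsBigO.fun_sum (s := Finset.univ) fun i _ =>
      (h3 i).const_mul_left (-u i)).congr_left fun s => ?_
    simp only [Function.comp, add_sub_cancel]
    have h4 : formsPoly Φ' (N + 1) (ξ s - ξ 0) = ∑ m ∈ Finset.range (N + 1 + 1),
        ((m.factorial : ℝ)⁻¹) * -∑ i, u i * fieldTerm (Y i) (ξ 0) Φ m (ξ s - ξ 0) :=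
      Finset.sum_congr rfl fun m hm => by
        rw [hd m (Nat.lt_succ_iff.1 (Finset.mem_range.1 hm)), smul_eq_mul]
    rw [h4]
    simp only [smul_eq_mul, mul_sub, Finset.sum_sub_distrib, Finset.mul_sum, mul_neg, neg_mul,
      Finset.sum_neg_distrib]
    rw [Finset.sum_comm]
    congr 2
    refine Finset.sum_congr rfl fun m _ => Finset.sum_congr rfl fun i _ => ?_
    ring
  -- The vector `δ s` is the velocity of `ξ(s) - ξ(0)` when `ξ(s)` moves with control `u + s Δu` and
  -- `ξ(0)` with control `u`. The prescribed `b'` is its jet through order `N + 1`.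
  set δ : ℝ → 𝔼 := fun s => ∑ i, u i • (Y i (ξ s) - Y i (ξ 0)) + s • ∑ i, Δu i • Y i (ξ s)
    with hδdef
  have hδ1 : ContDiffAt ℝ ∞ (fun s => ∑ i, u i • (Y i (ξ s) - Y i (ξ 0))) 0 :=
    ContDiffAt.sum fun i _ => (hYξ0 i).const_smul _
  have hδ2 : ContDiffAt ℝ ∞ (fun s => ∑ i, Δu i • Y i (ξ s)) 0 :=
    ContDiffAt.sum fun i _ => (hYξ i).const_smul _
  have hδ3 : ContDiffAt ℝ ∞ (fun s : ℝ => s • ∑ i, Δu i • Y i (ξ s)) 0 := contDiffAt_id.smul hδ2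
  have hδ : ContDiffAt ℝ ∞ δ 0 := hδ1.add hδ3
  have hδc (r : ℕ) (hr : r ≤ N + 1) : expansionCoeff (jetCurve b') r = expansionCoeff δ r := by
    have hjc : expansionCoeff (jetCurve b') r =
        ∑ j ∈ Finset.univ.filter fun j : Fin (N + 1) => (j : ℕ) + 1 = r, b' j := by
      refine expansionCoeff_eq_of_isBigO hjb' (K := N + 1) Finset.univ
        (fun j : Fin (N + 1) => (j : ℕ) + 1) b' ?_ hr
      refine (Asymptotics.isBigO_zero _ _).congr_left fun s => ?_
      simp [jetCurve]
    rw [hjc]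
    cases r with
    | zero =>
      rw [expansionCoeff_zero]
      simp [hδdef]
    | succ r =>
      have hcs (i : Fin l) : expansionCoeff (fun s => Y i (ξ s) - Y i (ξ 0)) (r + 1) =
          expansionCoeff (fun s => Y i (ξ s)) (r + 1) := by
        simp only [sub_eq_add_neg]
        rw [expansionCoeff_add (hYξ i) contDiffAt_const]
        simp [expansionCoeff, iteratedDeriv_const]
      rw [hδdef, expansionCoeff_add hδ1 hδ3, expansionCoeff_id_smul hδ2,
        expansionCoeff_sum fun i _ => (hYξ0 i).const_smul _,
        expansionCoeff_sum fun i _ => (hYξ i).const_smul _, ← Finset.sum_add_distrib]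
      rw [Finset.sum_eq_single (⟨r, by omega⟩ : Fin (N + 1))]
      · rw [hb']
        refine Finset.sum_congr rfl fun i _ => ?_
        rw [expansionCoeff_const_smul _ (hYξ0 i), expansionCoeff_const_smul _ (hYξ i), hcs]
      · intro j hj hne
        refine absurd (Fin.ext ?_) hne
        simpa using (Finset.mem_filter.1 hj).2
      · simp
  have e2 : expansionCoeff (fun s => D (jetCurve b s) (jetCurve b' s)) (N + 1) =
      expansionCoeff (fun s => D (ξ s - ξ 0) (δ s)) (N + 1) := by
    have h1 := expansionCoeff_bilinear (ContinuousLinearMap.id ℝ (𝔼 →L[ℝ] ℝ)) hDb hjb' (N + 1)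
    have h2 := expansionCoeff_bilinear (ContinuousLinearMap.id ℝ (𝔼 →L[ℝ] ℝ)) hDξ hδ (N + 1)
    simp only [ContinuousLinearMap.id_apply] at h1 h2
    rw [h1, h2]
    refine Finset.sum_congr rfl fun w hw => ?_
    rw [Finset.HasAntidiagonal.mem_antidiagonal] at hw
    rw [hδc w.2 (by omega), expansionCoeff_comp_congr (f := D) hξ0 hjb hj0 hDs.contDiffAt hjet
      (show w.1 ≤ N + 1 by omega)]
  have hDY (i : Fin l) : ContDiffAt ℝ ∞ (fun s => D (ξ s - ξ 0) (Y i (ξ s))) 0 :=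
    hDξ.clm_apply (hYξ i)
  -- Here the control `u` drops out and an overall factor `s` remains; it moves the coefficient from
  -- order `N + 1` to order `N`.
  have e3 (s : ℝ) : ∑ i, (-u i) • D (ξ s - ξ 0) (Y i (ξ s) - Y i (ξ 0)) + D (ξ s - ξ 0) (δ s) =
      s • ∑ i, Δu i • D (ξ s - ξ 0) (Y i (ξ s)) := by
    simp only [hδdef, map_add, map_sum, map_smul, neg_smul, Finset.sum_neg_distrib]
    abel
  rw [e1, e2, ← expansionCoeff_add
    (ContDiffAt.sum fun i _ => (hDξ.clm_apply (hYξ0 i)).const_smul _) (hDξ.clm_apply hδ)]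
  simp only [e3]
  rw [expansionCoeff_id_smul (ContDiffAt.sum fun i _ => (hDY i).const_smul _),
    expansionCoeff_sum fun i _ => (hDY i).const_smul _, coordsRHS]
  refine Finset.sum_congr rfl fun i _ => ?_
  rw [expansionCoeff_const_smul _ (hDY i), smul_eq_mul]
  congr 1
  have h2 := expansionCoeff_bilinear (ContinuousLinearMap.id ℝ (𝔼 →L[ℝ] ℝ)) hDξ (hYξ i) N
  simp only [ContinuousLinearMap.id_apply] at h2
  rw [h2, Nat.add_sub_cancel]
  refine Finset.sum_congr rfl fun w hw => ?_
  rw [Finset.HasAntidiagonal.mem_antidiagonal] at hw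
  rw [expansionCoeff_fderiv_formsPoly hΦ hξ (K := N + 1) (by omega) (by omega)]
  refine Finset.sum_congr rfl fun α _ => ?_
  rw [expansionCoeff_comp (K := N + 1) hξ (hY i) (by omega), map_sum, sum_apply, Finset.mul_sum]
  refine Finset.sum_congr rfl fun β _ => ?_
  rw [map_smul, smul_apply, smul_eq_mul, ← mul_assoc]
  rfl

end GradedDerivative

/-! ### Equations of the variations of the trajectory -/

section JetEquations

theorem ContMDiffAt.contDiffAt_chart {n : ℕ} {M : Type*} [TopologicalSpace M]
    [ChartedSpace (EuclideanSpace ℝ (Fin n)) M] [IsManifold (𝓡 n) ∞ M]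
    {e : OpenPartialHomeomorph M (EuclideanSpace ℝ (Fin n))}
    (he : e ∈ IsManifold.maximalAtlas (𝓡 n) ∞ M) {γ : ℝ → M}
    (hγ : ContMDiffAt 𝓘(ℝ, ℝ) (𝓡 n) ∞ γ 0) (h : γ 0 ∈ e.source) :
    ContDiffAt ℝ ∞ (fun s => e (γ s)) 0 := by
  rw [← contMDiffAt_iff_contDiffAt]
  exact ContMDiffAt.comp (0 : ℝ) (g := e) (contMDiffAt_of_mem_maximalAtlas he h) hγ

theorem expansionCoeff_continuousMap_apply {K : Type*} [TopologicalSpace K] [CompactSpace K]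
    {E : Type*} [NormedAddCommGroup E] [NormedSpace ℝ E] {f : ℝ → C(K, E)}
    (hf : ContDiffAt ℝ ∞ f 0) (k : ℕ) (t : K) :
    expansionCoeff (fun s => f s t) k = expansionCoeff f k t :=
  expansionCoeff_clm_comp (E := C(K, E)) (F := E) (ContinuousMap.evalCLM ℝ t) hf k

theorem solvesODE_of_eq_integralOperator {l : ℕ} {E : Type*} [NormedAddCommGroup E]
    [NormedSpace ℝ E] {a b : ℝ} (hab : a ≤ b) {u v : ℝ → Fin l → ℝ}
    (hu : ∀ i, IntervalIntegrable (fun t => u t i) volume a b)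
    (hv : ∀ i, IntervalIntegrable (fun t => v t i) volume a b) {f : C(Icc a b, E)} {c : E}
    {g h : Fin l → C(Icc a b, E)}
    (hf : f = ContinuousMap.const _ c + ∑ i, (integralOperator hab (fun t => u t i) (hu i) (g i) +
      integralOperator hab (fun t => v t i) (hv i) (h i))) :
    SolvesODE (IccExtend hab f)
      (fun t => ∑ i, (u t i • IccExtend hab (g i) t + v t i • IccExtend hab (h i) t)) a b := by
  have hi (i : Fin l) : IntervalIntegrable (fun τ => u τ i • IccExtend hab (g i) τ) volume a b :=
    (hu i).smul_continuousOn (g i).continuous.Icc_extend'.continuousOn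
  have hi' (i : Fin l) : IntervalIntegrable (fun τ => v τ i • IccExtend hab (h i) τ) volume a b :=
    (hv i).smul_continuousOn (h i).continuous.Icc_extend'.continuousOn
  have ha : a ∈ Icc a b := ⟨le_rfl, hab⟩
  have hval (t : Icc a b) : f t = c +
      ∫ τ in a..t, ∑ i, (u τ i • IccExtend hab (g i) τ + v τ i • IccExtend hab (h i) τ) := by
    rw [intervalIntegral.integral_finsetSum fun i _ =>
      ((hi i).add (hi' i)).mono_Icc hab ha t.2]
    conv_lhs => rw [hf]
    simp only [ContinuousMap.add_apply, ContinuousMap.const_apply, ContinuousMap.sum_apply,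
      integralOperator_apply]
    congr 1
    refine Finset.sum_congr rfl fun i _ => ?_
    rw [intervalIntegral.integral_add ((hi i).mono_Icc hab ha t.2) ((hi' i).mono_Icc hab ha t.2)]
  refine ⟨?_, fun t ht => ?_⟩
  · have := IntervalIntegrable.sum (μ := volume) (a := a) (b := b) Finset.univ
      fun i _ => (hi i).add (hi' i)
    convert! this using 1
    funext t
    simp
  · rw [IccExtend_of_mem hab _ ht, IccExtend_of_mem hab _ ha, hval, hval ⟨a, ha⟩]
    simp

variable {n l : ℕ} {M : Type*} [TopologicalSpace M] [T2Space M]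
  [ChartedSpace (EuclideanSpace ℝ (Fin n)) M] [IsManifold (𝓡 n) ∞ M]
  {X : Fin l → (p : M) → TangentSpace (𝓡 n) p}

/-- The equations of the variations of the trajectory, in a chart. -/
theorem solvesODE_expansionCoeff_endPoint
    (hX : ∀ i, ContMDiff (𝓡 n) (𝓡 n).tangent ∞ (fun p => (⟨p, X i p⟩ : TangentBundle (𝓡 n) M)))
    {T : ℝ} (hT : 0 ≤ T) {u Δu : ℝ → Fin l → ℝ} {q₀ : M} {q : ℝ → M}
    (hu : ∀ i, IntervalIntegrable (fun t => u t i) volume 0 T)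
    (hΔu : ∀ i, IntervalIntegrable (fun t => Δu t i) volume 0 T) (hq : IsTrajectory X u q₀ T q)
    {a b : ℝ} (ha0 : 0 ≤ a) (hab : a ≤ b) (hbT : b ≤ T)
    {e : OpenPartialHomeomorph M (EuclideanSpace ℝ (Fin n))}
    (he : e ∈ IsManifold.maximalAtlas (𝓡 n) ∞ M) (hqe : ∀ t ∈ Icc a b, q t ∈ e.source) (r : ℕ) :
    SolvesODE
      (fun t => expansionCoeff (fun s => e (endPoint X q₀ T (u + s • Δu) t)) (r + 1))
      (fun t => ∑ i, (u t i • expansionCoeff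
          (fun s => localField (X i) e (e (endPoint X q₀ T (u + s • Δu) t))) (r + 1) +
        Δu t i • expansionCoeff
          (fun s => localField (X i) e (e (endPoint X q₀ T (u + s • Δu) t))) r)) a b := by
  obtain ⟨hev, hsm⟩ := endPoint_smooth hX hT hu hΔu hq
  have ha : a ∈ Icc 0 T := ⟨ha0, hab.trans hbT⟩
  have hb : b ∈ Icc 0 T := ⟨ha0.trans hab, hbT⟩
  have haI : a ∈ Icc a b := ⟨le_rfl, hab⟩
  have hu' i := (hu i).mono_Icc hT ha hb
  have hΔu' i := (hΔu i).mono_Icc hT ha hb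
  have hus (s : ℝ) (i : Fin l) : IntervalIntegrable (fun t => (u + s • Δu) t i) volume a b := by
    simpa using (hu' i).add ((hΔu' i).const_mul s)
  set γ : ℝ → M := fun s => endPoint X q₀ T (u + s • Δu) a with hγdef
  have hγ : ContMDiffAt 𝓘(ℝ, ℝ) (𝓡 n) ∞ γ 0 := (hsm a ha).2
  have hγ0 : γ 0 = q a := by
    have := (hsm a ha).1
    simpa [hγdef] using this
  obtain ⟨Y, V, x, hY, hVo, hV, hYV, hx, hx0, hxV, hxs⟩ := exists_local_family hX hab hu' hΔu' he
    ((isTrajectory_iff.1 hq).2.mono ha0 hbT) hqe hγ hγ0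
  have hγe := hγ.contDiffAt_chart he (by rw [hγ0]; exact hqe a haI)
  have hγs : ∀ᶠ s in 𝓝 0, γ s ∈ e.source := by
    refine hγ.continuousAt (e.open_source.mem_nhds ?_)
    rw [hγ0]
    exact hqe a haI
  -- The bound on `s` is uniform in `t`: by uniqueness the end-point map agrees with the Banach
  -- space curve `x s` at all times at once.
  have hend : ∀ᶠ s in 𝓝 0, ∀ t : Icc a b, e (endPoint X q₀ T (u + s • Δu) t) = x s t := by
    filter_upwards [hev, hxV, hxs, hγs] with s h1 h2 h3 h4 t
    have h5 := isTrajectoryOn_of_integral_eq hab hu' hΔu' he hV hYV h2 h3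
    have h6 := ((isTrajectory_iff.1 h1.1).2.mono ha0 hbT).eqOn hX hab (hus s) h5.1 (by
      rw [h5.2, e.left_inv h4]) t.2
    rw [h6]
    simp only
    rw [IccExtend_of_mem hab _ t.2, e.right_inv (hV (h2 t))]
  have hYx (i : Fin l) : ContDiffAt ℝ ∞ (fun s => (Y i).comp (x s)) 0 :=
    ContDiffAt.comp (0 : ℝ) (E := ℝ) (F := C(Icc a b, EuclideanSpace ℝ (Fin n)))
      (G := C(Icc a b, EuclideanSpace ℝ (Fin n)))
      (contDiff_continuousMap_comp (Y i) (hY i)).contDiffAt hx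
  have hβ (t : Icc a b) (r : ℕ) :
      expansionCoeff (fun s => e (endPoint X q₀ T (u + s • Δu) t)) r = expansionCoeff x r t := by
    rw [← expansionCoeff_continuousMap_apply hx]
    exact Filter.EventuallyEq.expansionCoeff_eq (hend.mono fun s hs => hs t) r
  have hc (i : Fin l) (t : Icc a b) (r : ℕ) :
      expansionCoeff (fun s => localField (X i) e (e (endPoint X q₀ T (u + s • Δu) t))) r =
        expansionCoeff (fun s => (Y i).comp (x s)) r t := by
    rw [← expansionCoeff_continuousMap_apply (hYx i)]
    refine Filter.EventuallyEq.expansionCoeff_eq ?_ r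
    filter_upwards [hend, hxV] with s h1 h2
    rw [h1, ← hYV i (h2 t)]
    rfl
  -- Taking the coefficient of order `r + 1` in `C([a, b], ℝⁿ)` commutes with the continuous linear
  -- integral operators, so no separate differentiation under the integral sign is involved. The
  -- factor `s` on the `Δu` term lowers its order to `r`.
  have hcoeff : expansionCoeff x (r + 1) =
      ContinuousMap.const _ (expansionCoeff (fun s => e (γ s)) (r + 1)) +
        ∑ i, (integralOperator hab (fun t => u t i) (hu' i)
            (expansionCoeff (fun s => (Y i).comp (x s)) (r + 1)) +
          integralOperator hab (fun t => Δu t i) (hΔu' i)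
            (expansionCoeff (fun s => (Y i).comp (x s)) r)) := by
    set J := fun i => integralOperator (E := EuclideanSpace ℝ (Fin n)) hab (fun t => u t i) (hu' i)
    set J' := fun i =>
      integralOperator (E := EuclideanSpace ℝ (Fin n)) hab (fun t => Δu t i) (hΔu' i)
    have d1 (i : Fin l) : ContDiffAt ℝ ∞ (fun s => J i ((Y i).comp (x s))) 0 :=
      (J i).contDiff.contDiffAt.comp (0 : ℝ) (hYx i)
    have d2 (i : Fin l) : ContDiffAt ℝ ∞ (fun s => J' i ((Y i).comp (x s))) 0 :=
      (J' i).contDiff.contDiffAt.comp (0 : ℝ) (hYx i)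
    have d3 (i : Fin l) : ContDiffAt ℝ ∞ (fun s : ℝ => s • J' i ((Y i).comp (x s))) 0 :=
      contDiffAt_id.smul (d2 i)
    let cst : EuclideanSpace ℝ (Fin n) →L[ℝ] C(Icc a b, EuclideanSpace ℝ (Fin n)) :=
      ContinuousLinearMap.const ℝ (Icc a b)
    have d4 : ContDiffAt ℝ ∞ (fun s => cst (e (γ s))) 0 :=
      cst.contDiff.contDiffAt.comp (0 : ℝ) hγe
    rw [Filter.EventuallyEq.expansionCoeff_eq hxs]
    change expansionCoeff (fun s => cst (e (γ s)) +
      ∑ i, (J i ((Y i).comp (x s)) + s • J' i ((Y i).comp (x s)))) (r + 1) = _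
    rw [expansionCoeff_add d4 (ContDiffAt.sum fun i _ => (d1 i).add (d3 i)),
      expansionCoeff_sum fun i _ => (d1 i).add (d3 i), expansionCoeff_clm_comp cst hγe]
    congr 1
    refine Finset.sum_congr rfl fun i _ => ?_
    rw [expansionCoeff_add (d1 i) (d3 i), expansionCoeff_id_smul (d2 i),
      expansionCoeff_clm_comp (J i) (hYx i), expansionCoeff_clm_comp (J' i) (hYx i)]
  refine (solvesODE_of_eq_integralOperator hab hu' hΔu' hcoeff).congr hab (fun t ht => ?_)
    (Eventually.of_forall fun t ht => Finset.sum_congr rfl fun i _ => ?_)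
  · rw [IccExtend_of_mem hab _ ht]
    exact hβ ⟨t, ht⟩ (r + 1)
  · rw [IccExtend_of_mem hab _ ht, IccExtend_of_mem hab _ ht]
    rw [← hc i ⟨t, ht⟩, ← hc i ⟨t, ht⟩]

end JetEquations

/-! ### Evolution equation of the adapted coordinates in one chart -/

section Evolution

variable {n l : ℕ}

local notation "𝔼" => EuclideanSpace ℝ (Fin n)

theorem gradedPoly_eq_expansionCoeff {Φ : (m : ℕ) → 𝔼 [×m]→L[ℝ] ℝ} {k : ℕ}
    (hΦ : ∀ m ≤ k, Φ m ∈ symmetricForms 𝔼 ℝ m) (b : Fin k → 𝔼) :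
    gradedPoly Φ k b =
      expansionCoeff (fun s => formsEval k ((fun m : Fin (k + 1) => Φ m, b), s)) k := by
  simp only [formsEval_eq]
  rw [expansionCoeff_formsPoly hΦ b le_rfl]
  rfl

theorem multiAbs_ne_zero {K w : ℕ} {α : Fin K → ℕ} (hw : w ≠ 0) (hα : α ∈ multiIndices K w) :
    multiAbs α ≠ 0 := by
  rw [mem_multiIndices] at hα
  intro h
  rw [multiAbs, Finset.sum_eq_zero_iff] at h
  refine hw (hα ▸ ?_)
  exact Finset.sum_eq_zero fun i hi => by rw [h i hi, mul_zero]

theorem gradedPoly_congr {Φ Φ' : (m : ℕ) → 𝔼 [×m]→L[ℝ] ℝ} {k : ℕ} (hk : k ≠ 0)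
    (h : ∀ m ≥ 1, m ≤ k → Φ m = Φ' m) (b : Fin k → 𝔼) : gradedPoly Φ k b = gradedPoly Φ' k b := by
  refine Finset.sum_congr rfl fun α hα => ?_
  rw [h _ (Nat.one_le_iff_ne_zero.2 (multiAbs_ne_zero hk hα))]
  rw [mem_multiIndices] at hα
  exact (multiAbs_le_multiWeight α).trans_eq hα

theorem coordsRHS_congr {Φ Φ' : (m : ℕ) → 𝔼 [×m]→L[ℝ] ℝ} (h : ∀ m ≥ 1, Φ m = Φ' m)
    (Y : Fin l → 𝔼 → 𝔼) (Δu : Fin l → ℝ) (x : 𝔼) (k : ℕ) (b : Fin k → 𝔼) :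
    coordsRHS Y Δu x Φ k b = coordsRHS Y Δu x Φ' k b := by
  simp only [coordsRHS, h _ (Nat.succ_pos _)]

/-- The right-hand side of the equation of the forms. -/
noncomputable def formsDeriv (Y : Fin l → 𝔼 → 𝔼) (u : Fin l → ℝ) (x : 𝔼)
    (Φ : (m : ℕ) → 𝔼 [×m]→L[ℝ] ℝ) (k : ℕ) : 𝔼 [×k]→L[ℝ] ℝ :=
  -∑ i, u i • diagForm k (fieldTerm (Y i) x Φ k)

theorem formsDeriv_diag (Y : Fin l → 𝔼 → 𝔼) (u : Fin l → ℝ) (x : 𝔼)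
    (Φ : (m : ℕ) → 𝔼 [×m]→L[ℝ] ℝ) (k : ℕ) (b : 𝔼) :
    (formsDeriv Y u x Φ k fun _ => b) = -formsRHS Y u x Φ k b := by
  rw [formsDeriv, neg_apply, sum_apply, formsRHS]
  congr 1
  refine Finset.sum_congr rfl fun i _ => ?_
  rw [smul_apply, diagForm_diag (contDiff_fieldTerm _ _ _ _).contDiffAt (fieldTerm_smul _ _ _ _)]
  rfl

theorem diagForm_fieldTerm_mem (Y : 𝔼 → 𝔼) (x : 𝔼) (Φ : (m : ℕ) → 𝔼 [×m]→L[ℝ] ℝ) (k : ℕ) :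
    diagForm k (fieldTerm Y x Φ k) ∈ symmetricForms 𝔼 ℝ k :=
  fun σ v => diagForm_comp_perm (contDiff_fieldTerm _ _ _ _).contDiffAt σ v

theorem formsDeriv_mem (Y : Fin l → 𝔼 → 𝔼) (u : Fin l → ℝ) (x : 𝔼)
    (Φ : (m : ℕ) → 𝔼 [×m]→L[ℝ] ℝ) (k : ℕ) : formsDeriv Y u x Φ k ∈ symmetricForms 𝔼 ℝ k :=
  Submodule.neg_mem _ (Submodule.sum_mem _ fun _ _ =>
    Submodule.smul_mem _ _ (diagForm_fieldTerm_mem _ _ _ _))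

theorem continuousOn_diagForm_fieldTerm {Y : 𝔼 → 𝔼} {x : ℝ → 𝔼} {S : Set ℝ}
    (hY : ∀ s : ℕ, ContinuousOn (fun t => iteratedFDeriv ℝ s Y (x t)) S)
    {Φ : (m : ℕ) → ℝ → 𝔼 [×m]→L[ℝ] ℝ} {k : ℕ}
    (hΦ : ∀ m ≥ 1, m ≤ k → ContinuousOn (Φ m) S) :
    ContinuousOn (fun t => diagForm k (fieldTerm Y (x t) (fun m => Φ m t) k)) S := by
  refine continuousOn_of_diag (fun t _ => diagForm_fieldTerm_mem _ _ _ _) fun v => ?_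
  simp only [diagForm_diag (contDiff_fieldTerm _ _ _ _).contDiffAt (fieldTerm_smul _ _ _ _)]
  exact continuousOn_fieldTerm hY hΦ v

theorem intervalIntegrable_formsDeriv {Y : Fin l → 𝔼 → 𝔼} {x : ℝ → 𝔼} {u : ℝ → Fin l → ℝ} {a b : ℝ}
    (hab : a ≤ b) (hu : ∀ i, IntervalIntegrable (fun t => u t i) volume a b)
    (hY : ∀ i, ∀ s : ℕ, ContinuousOn (fun t => iteratedFDeriv ℝ s (Y i) (x t)) (Icc a b))
    {Φ : (m : ℕ) → ℝ → 𝔼 [×m]→L[ℝ] ℝ} {k : ℕ}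
    (hΦ : ∀ m ≥ 1, m ≤ k → ContinuousOn (Φ m) (Icc a b)) :
    IntervalIntegrable (fun t => formsDeriv Y (u t) (x t) (fun m => Φ m t) k) volume a b := by
  have := IntervalIntegrable.sum (μ := volume) (a := a) (b := b) Finset.univ fun i _ =>
    (hu i).smul_continuousOn (g := fun t => diagForm k (fieldTerm (Y i) (x t) (fun m => Φ m t) k))
      (by rw [uIcc_of_le hab]; exact continuousOn_diagForm_fieldTerm (hY i) hΦ)
  convert! this.neg using 1
  funext t
  simp [formsDeriv]

/-- The equations of the diagonals of the forms give the equations of the forms. -/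
theorem solvesODE_formsDeriv {Y : Fin l → 𝔼 → 𝔼} {x : ℝ → 𝔼} {u : ℝ → Fin l → ℝ} {a b : ℝ}
    (hab : a ≤ b) (hu : ∀ i, IntervalIntegrable (fun t => u t i) volume a b)
    (hY : ∀ i, ∀ s : ℕ, ContinuousOn (fun t => iteratedFDeriv ℝ s (Y i) (x t)) (Icc a b))
    {Φ : (m : ℕ) → ℝ → 𝔼 [×m]→L[ℝ] ℝ}
    (hsymm : ∀ k ≥ 1, ∀ t ∈ Icc a b, Φ k t ∈ symmetricForms 𝔼 ℝ k)
    (hode : ∀ k ≥ 1, ∀ v, SolvesODE (fun t => Φ k t fun _ => v)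
      (fun t => -formsRHS Y (u t) (x t) (fun m => Φ m t) k v) a b) {k : ℕ} (hk : 1 ≤ k) :
    SolvesODE (Φ k) (fun t => formsDeriv Y (u t) (x t) (fun m => Φ m t) k) a b := by
  have hc (m : ℕ) (hm : m ≥ 1) : ContinuousOn (Φ m) (Icc a b) :=
    continuousOn_of_diag (hsymm m hm) fun v => (hode m hm v).continuousOn hab
  refine SolvesODE.of_diag hab (hsymm k hk) (fun t _ => formsDeriv_mem _ _ _ _ _)
    (intervalIntegrable_formsDeriv hab hu hY fun m hm _ => hc m hm) fun v => ?_
  simp only [formsDeriv_diag]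
  exact hode k hk v

/-- The forms and the jet are assembled into one Carathéodory solution, to which a smooth map is
applied; `fderiv_expansionCoeff_formsEval_eq_coordsRHS` evaluates its derivative. -/
theorem solvesODE_gradedPoly {Y : Fin l → 𝔼 → 𝔼} {u Δu : ℝ → Fin l → ℝ} {a b : ℝ}
    (hab : a ≤ b) {Φ : (m : ℕ) → ℝ → 𝔼 [×m]→L[ℝ] ℝ} {ξ : ℝ → ℝ → 𝔼}
    (hξ : ∀ t ∈ Icc a b, ContDiffAt ℝ ∞ (ξ t) 0)
    (hY : ∀ i, ∀ t ∈ Icc a b, ContDiffAt ℝ ∞ (Y i) (ξ t 0))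
    (hsymm : ∀ k ≥ 1, ∀ t ∈ Icc a b, Φ k t ∈ symmetricForms 𝔼 ℝ k)
    (hode : ∀ k ≥ 1, SolvesODE (Φ k)
      (fun t => formsDeriv Y (u t) (ξ t 0) (fun m => Φ m t) k) a b)
    (hb : ∀ r, SolvesODE (fun t => expansionCoeff (ξ t) (r + 1))
      (fun t => ∑ i, (u t i • expansionCoeff (fun s => Y i (ξ t s)) (r + 1) +
        Δu t i • expansionCoeff (fun s => Y i (ξ t s)) r)) a b) {k : ℕ} (hk : 1 ≤ k) :
    SolvesODE
      (fun t => gradedPoly (fun m => Φ m t) k fun r : Fin k => expansionCoeff (ξ t) (r + 1))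
      (fun t => coordsRHS Y (Δu t) (ξ t 0) (fun m => Φ m t) k
        fun r : Fin k => expansionCoeff (ξ t) (r + 1)) a b := by
  obtain ⟨N, rfl⟩ : ∃ N, k = N + 1 := ⟨k - 1, by omega⟩
  -- Nothing is known about the degree-zero form. It is replaced by `0`, which solves its trivial
  -- equation and does not affect the coordinates of order `k ≥ 1`.
  set Ψ : (m : ℕ) → ℝ → 𝔼 [×m]→L[ℝ] ℝ := Function.update Φ 0 0 with hΨ
  have hΨm (m : ℕ) (hm : m ≥ 1) : Ψ m = Φ m := Function.update_of_ne (by omega) _ _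
  have hΨ0 : Ψ 0 = 0 := Function.update_self _ _ _
  have hΨs (m : ℕ) (t : ℝ) (ht : t ∈ Icc a b) : Ψ m t ∈ symmetricForms 𝔼 ℝ m := by
    rcases Nat.eq_zero_or_pos m with rfl | hm
    · rw [hΨ0]; exact Submodule.zero_mem _
    · rw [hΨm m hm]; exact hsymm m hm t ht
  have hd (m : ℕ) (t : ℝ) : formsDeriv Y (u t) (ξ t 0) (fun m => Ψ m t) m =
      formsDeriv Y (u t) (ξ t 0) (fun m => Φ m t) m := by
    have (i : Fin l) : fieldTerm (Y i) (ξ t 0) (fun m => Ψ m t) m =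
        fieldTerm (Y i) (ξ t 0) (fun m => Φ m t) m :=
      funext fun v => fieldTerm_congr _ _ (fun m hm _ => by rw [hΨm m hm]) v
    simp only [formsDeriv, this]
  have hΨode (m : ℕ) :
      SolvesODE (Ψ m) (fun t => formsDeriv Y (u t) (ξ t 0) (fun m => Ψ m t) m) a b := by
    simp only [hd]
    rcases Nat.eq_zero_or_pos m with rfl | hm
    · have (t : ℝ) : formsDeriv Y (u t) (ξ t 0) (fun m => Φ m t) 0 = 0 := by
        have h0 (i : Fin l) : fieldTerm (Y i) (ξ t 0) (fun m => Φ m t) 0 = 0 := by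
          funext v
          simp [fieldTerm]
        have h1 : diagForm 0 (0 : 𝔼 → ℝ) = 0 := by
          ext v
          simp [diagForm]
        simp [formsDeriv, h0, h1]
      simp only [this, hΨ0]
      exact ⟨by simp, fun t _ => by simp⟩
    · rw [hΨm m hm]; exact hode m hm
  have hz := (SolvesODE.pi hab (f := fun t (m : Fin (N + 1 + 1)) => Ψ m t)
      (g := fun t m => formsDeriv Y (u t) (ξ t 0) (fun m => Ψ m t) m) fun m => hΨode m).prodMk hab
    (SolvesODE.pi hab (f := fun t (r : Fin (N + 1)) => expansionCoeff (ξ t) (r + 1))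
      (g := fun t r => ∑ i, (u t i • expansionCoeff (fun s => Y i (ξ t s)) (r + 1) +
        Δu t i • expansionCoeff (fun s => Y i (ξ t s)) r)) fun r => hb r)
  have hG := hz.comp_contDiff hab ((contDiff_expansionCoeff (contDiff_formsEval (V := 𝔼) (N + 1))
    (N + 1)).of_le (by exact_mod_cast le_top))
  refine hG.congr hab (fun t ht => ?_) (Eventually.of_forall fun t ht => ?_)
  · rw [← gradedPoly_eq_expansionCoeff (Φ := fun m => Ψ m t) fun m _ => hΨs m t ht]
    exact gradedPoly_congr (Nat.succ_ne_zero N) (fun m hm _ => by rw [hΨm m hm]) _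
  · rw [fderiv_expansionCoeff_formsEval_eq_coordsRHS (Φ := fun m => Ψ m t) (Δu := Δu t) (u := u t)
      (Φ' := fun m => formsDeriv Y (u t) (ξ t 0) (fun m => Ψ m t) m) (hξ t ht)
      (fun i => hY i t ht) (fun m _ => hΨs m t ht)
      (fun m _ v => formsDeriv_diag _ _ _ _ _ _) fun r => rfl]
    exact coordsRHS_congr (fun m hm => by rw [hΨm m hm]) _ _ _ _ _

end Evolution

/-! ### Triangularity and inversion of the adapted coordinates -/

section Reversibility

variable {n : ℕ}

local notation "𝔼" => EuclideanSpace ℝ (Fin n)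

theorem multiPow_eq_of_eq {V : Type*} {K : ℕ} {α : Fin K → ℕ} {b b' : Fin K → V}
    (h : ∀ i, α i ≠ 0 → b i = b' i) : multiPow b α = multiPow b' α := by
  funext j
  refine h _ fun h0 => ?_
  have := (finSigmaFinEquiv.symm j).2.2
  omega

theorem gradedPoly_zero (Φ : (m : ℕ) → 𝔼 [×m]→L[ℝ] ℝ) {k : ℕ} (hk : k ≠ 0) :
    gradedPoly Φ k 0 = 0 := by
  refine Finset.sum_eq_zero fun α hα => ?_
  have : Nonempty (Fin (multiAbs α)) :=
    Fin.pos_iff_nonempty.1 (Nat.pos_of_ne_zero (multiAbs_ne_zero hk hα))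
  have h : multiPow (0 : Fin k → 𝔼) α = 0 := rfl
  rw [h, ContinuousMultilinearMap.map_zero, mul_zero]

theorem map_const_eq_of_eq {V : Type*} [NormedAddCommGroup V] [NormedSpace ℝ V]
    (Φ : (m : ℕ) → V [×m]→L[ℝ] ℝ) {m m' : ℕ} (h : m = m') (v : V) :
    (Φ m fun _ => v) = Φ m' fun _ => v := by
  subst h
  rfl

/-- The polynomial depends on the last variable only through the linear form. -/
theorem gradedPoly_succ (Φ : (m : ℕ) → 𝔼 [×m]→L[ℝ] ℝ) (k : ℕ) (b : Fin (k + 1) → 𝔼) :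
    gradedPoly Φ (k + 1) b = (Φ 1 fun _ => b (Fin.last k)) +
      gradedPoly Φ (k + 1) (Fin.snoc (α := fun _ => 𝔼) (Fin.init b) 0) := by
  -- The last entry carries weight `k + 1`, so `α₀` is the only multi-index of that weight in which
  -- the last variable occurs.
  set α₀ : Fin (k + 1) → ℕ := Pi.single (Fin.last k) 1 with hα₀
  have hmem : α₀ ∈ multiIndices (k + 1) (k + 1) := by
    rw [mem_multiIndices, multiWeight, Finset.sum_eq_single (Fin.last k)]
    · simp [hα₀]
    · intro i _ hi
      simp [hα₀, hi]
    · simp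
  have habs : multiAbs α₀ = 1 := by simp [hα₀, multiAbs]
  have hfac : multiFactorial α₀ = 1 := by
    refine Finset.prod_eq_one fun i _ => ?_
    by_cases hi : i = Fin.last k
    · simp [hα₀, hi]
    · simp [hα₀, hi]
  have hterm (c : Fin (k + 1) → 𝔼) : ((multiFactorial α₀ : ℝ)⁻¹) * Φ (multiAbs α₀) (multiPow c α₀) =
      Φ 1 fun _ => c (Fin.last k) := by
    have h1 : multiPow c α₀ = fun _ => c (Fin.last k) :=
      multiPow_eq_of_eq (b' := fun _ => c (Fin.last k)) fun i hi => by
        by_cases h : i = Fin.last k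
        · rw [h]
        · simp [hα₀, h] at hi
    rw [h1, hfac, Nat.cast_one, inv_one, one_mul, map_const_eq_of_eq Φ habs]
  rw [gradedPoly, gradedPoly, ← Finset.add_sum_erase _ _ hmem, ← Finset.add_sum_erase _ _ hmem,
    hterm, hterm, Fin.snoc_last]
  have h0 : (Φ 1 fun _ => (0 : 𝔼)) = 0 := (Φ 1).map_zero
  rw [h0, zero_add]
  congr 1
  refine Finset.sum_congr rfl fun α hα => ?_
  congr 2
  refine multiPow_eq_of_eq fun i hi => ?_
  refine Fin.lastCases (fun hi => ?_) (fun i _ => by rw [Fin.snoc_castSucc]; rfl) i hi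
  exfalso
  obtain ⟨hne, hα⟩ := Finset.mem_erase.1 hα
  rw [mem_multiIndices, multiWeight, Fin.sum_univ_castSucc] at hα
  simp only [Fin.val_last] at hα
  have h1 : α (Fin.last k) = 1 := by
    by_contra h
    have h2 : 2 ≤ α (Fin.last k) := by omega
    have h3 : (k + 1) * 2 ≤ (k + 1) * α (Fin.last k) := Nat.mul_le_mul_left _ h2
    omega
  rw [h1, mul_one] at hα
  have h4 : ∑ i : Fin k, ((i.castSucc : ℕ) + 1) * α i.castSucc = 0 := by omega
  rw [Finset.sum_eq_zero_iff] at h4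
  refine hne (funext fun i => ?_)
  refine Fin.lastCases ?_ (fun i => ?_) i
  · rw [h1, hα₀, Pi.single_eq_same]
  · have := h4 i (Finset.mem_univ i)
    rw [hα₀, Pi.single_eq_of_ne (Fin.castSucc_lt_last i).ne]
    simpa using this

theorem contDiff_gradedPoly (Φ : (m : ℕ) → 𝔼 [×m]→L[ℝ] ℝ) (k : ℕ) :
    ContDiff ℝ ∞ (gradedPoly Φ k) := by
  refine ContDiff.sum fun α _ => contDiff_const.mul ((Φ _).contDiff.comp
    (contDiff_pi.2 fun i => ?_))
  exact contDiff_apply ℝ 𝔼 _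

theorem jetMap_castSucc (Φ : (m : ℕ) → Fin n → 𝔼 [×m]→L[ℝ] ℝ) (k : ℕ) (b : Fin (k + 1) → 𝔼)
    (m : Fin k) : jetMap Φ (k + 1) b m.castSucc = jetMap Φ k (Fin.init b) m := rfl

/-- The map is triangular with the invertible linear map `A` of the one-forms on the diagonal.
Knowing the lower `b`, the top one is recovered by subtracting the polynomial `R` and applying the
inverse `B` of `A`. -/
theorem exists_smooth_inverse_jetMap {Φ : (m : ℕ) → Fin n → 𝔼 [×m]→L[ℝ] ℝ}
    (h : ∀ y : Fin n → ℝ, ∃ v, ∀ a, (Φ 1 a fun _ => v) = y a) (k : ℕ) :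
    ∃ Ψ : (Fin k → Fin n → ℝ) → (Fin k → 𝔼), ContDiff ℝ ∞ Ψ ∧
      Function.LeftInverse Ψ (jetMap Φ k) ∧ Function.RightInverse Ψ (jetMap Φ k) := by
  let A : 𝔼 →ₗ[ℝ] (Fin n → ℝ) :=
    { toFun := fun v a => Φ 1 a fun _ => v
      map_add' := fun v w => by
        funext a
        exact (continuousMultilinearCurryFin1 ℝ 𝔼 ℝ (Φ 1 a)).map_add v w
      map_smul' := fun c v => by
        funext a
        exact (continuousMultilinearCurryFin1 ℝ 𝔼 ℝ (Φ 1 a)).map_smul c v }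
  have hsurj : Function.Surjective A := fun y => (h y).imp fun v hv => funext hv
  have hinj : Function.Injective A :=
    (LinearMap.injective_iff_surjective_of_finrank_eq_finrank (by simp)).2 hsurj
  let B : (Fin n → ℝ) →L[ℝ] 𝔼 :=
    LinearMap.toContinuousLinearMap (LinearEquiv.ofBijective A ⟨hinj, hsurj⟩).symm.toLinearMap
  have hAB (y : Fin n → ℝ) : A (B y) = y :=
    (LinearEquiv.ofBijective A ⟨hinj, hsurj⟩).apply_symm_apply y
  have hBA (v : 𝔼) : B (A v) = v := (LinearEquiv.ofBijective A ⟨hinj, hsurj⟩).symm_apply_apply v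
  induction k with
  | zero =>
    exact ⟨fun _ => 0, contDiff_const, fun _ => Subsingleton.elim _ _,
      fun _ => Subsingleton.elim _ _⟩
  | succ k ih =>
    obtain ⟨Ψ, hΨ, hl, hr⟩ := ih
    let R : (Fin k → 𝔼) → Fin n → ℝ := fun b a =>
      gradedPoly (fun r => Φ r a) (k + 1) (Fin.snoc (α := fun _ => 𝔼) b 0)
    have hsplit (b : Fin (k + 1) → 𝔼) :
        jetMap Φ (k + 1) b (Fin.last k) = A (b (Fin.last k)) + R (Fin.init b) :=
      funext fun a => gradedPoly_succ (fun r => Φ r a) k b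
    have hR : ContDiff ℝ ∞ R := by
      refine contDiff_pi.2 fun a => (contDiff_gradedPoly _ _).comp (contDiff_pi.2 fun i => ?_)
      refine Fin.lastCases ?_ (fun i => ?_) i
      · simp only [Fin.snoc_last]
        exact contDiff_const
      · simp only [Fin.snoc_castSucc]
        exact contDiff_apply ℝ 𝔼 i
    have hinit : ContDiff ℝ ∞ fun y : Fin (k + 1) → Fin n → ℝ => Fin.init y :=
      contDiff_pi.2 fun i => contDiff_apply ℝ (Fin n → ℝ) i.castSucc
    have hΨi := hΨ.comp hinit
    refine ⟨fun y => Fin.snoc (α := fun _ => 𝔼) (Ψ (Fin.init y))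
      (B (y (Fin.last k) - R (Ψ (Fin.init y)))), ?_, fun b => ?_, fun y => ?_⟩
    · refine contDiff_pi.2 fun i => ?_
      refine Fin.lastCases ?_ (fun i => ?_) i
      · simp only [Fin.snoc_last]
        exact B.contDiff.comp ((contDiff_apply ℝ (Fin n → ℝ) (Fin.last k)).sub (hR.comp hΨi))
      · simp only [Fin.snoc_castSucc]
        exact (contDiff_apply ℝ 𝔼 i).comp hΨi
    · have h1 : Fin.init (jetMap Φ (k + 1) b) = jetMap Φ k (Fin.init b) := rfl
      simp only
      rw [h1, hl, hsplit, add_sub_cancel_right, hBA]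
      exact Fin.snoc_init_self b
    · funext m
      refine Fin.lastCases ?_ (fun m => ?_) m
      · rw [hsplit]
        simp only
        rw [Fin.snoc_last, Fin.init_snoc, hAB, sub_add_cancel]
      · rw [jetMap_castSucc]
        simp only
        rw [Fin.init_snoc, hr]
        rfl

end Reversibility

/-! ### Linear equations and persistence of the basis of one-forms -/

section LinearEquations

variable {l : ℕ}

/-- Solvability of inhomogeneous linear equations with integrable coefficients. -/
theorem exists_solvesODE_linear {E : Type*} [NormedAddCommGroup E] [NormedSpace ℝ E]
    [CompleteSpace E] {a b : ℝ} (hab : a ≤ b) {u : ℝ → Fin l → ℝ}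
    (hu : ∀ i, IntervalIntegrable (fun t => u t i) volume a b) {A : Fin l → ℝ → E →L[ℝ] E}
    (hA : ∀ i, ContinuousOn (A i) (Icc a b)) {h : ℝ → E} (hh : IntervalIntegrable h volume a b)
    (c : E) : ∃ f : ℝ → E, f a = c ∧ SolvesODE f (fun t => ∑ i, u t i • A i t (f t) + h t) a b := by
  let Ac (i : Fin l) : C(Icc a b, E →L[ℝ] E) := ⟨fun t => A i t, (hA i).domRestrict⟩
  let K := ∑ i, (integralOperator hab (fun t => u t i) (hu i)).comp
      (pointwiseApply (Icc a b) E E (Ac i))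
  have ha : a ∈ Icc a b := ⟨le_rfl, hab⟩
  let H : C(Icc a b, E) := ⟨fun t => c + ∫ τ in a..t, h τ,
    continuous_const.add (continuousOn_integral hab hh).domRestrict⟩
  obtain ⟨U, hU⟩ := isUnit_one_sub_sum_integralOperator hab hu Ac
  let f : C(Icc a b, E) := (↑U⁻¹ : C(Icc a b, E) →L[ℝ] C(Icc a b, E)) H
  have hf : f = H + K f := by
    have h1 : (U : C(Icc a b, E) →L[ℝ] C(Icc a b, E)) f = H := by
      change ((U : C(Icc a b, E) →L[ℝ] C(Icc a b, E)) *
        (↑U⁻¹ : C(Icc a b, E) →L[ℝ] C(Icc a b, E))) H = H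
      rw [U.mul_inv]
      rfl
    rw [hU] at h1
    rw [← h1]
    change f = f - K f + K f
    rw [sub_add_cancel]
  have hi (i : Fin l) : IntervalIntegrable
      (fun τ => u τ i • IccExtend hab (pointwiseApply (Icc a b) E E (Ac i) f) τ) volume a b :=
    (hu i).smul_continuousOn
      (pointwiseApply (Icc a b) E E (Ac i) f).continuous.Icc_extend'.continuousOn
  have hi' : IntervalIntegrable (fun τ => ∑ i,
      u τ i • IccExtend hab (pointwiseApply (Icc a b) E E (Ac i) f) τ + h τ) volume a b := by
    have := (IntervalIntegrable.sum (μ := volume) (a := a) (b := b) Finset.univ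
      fun i _ => hi i).add hh
    convert! this using 1
    funext t
    simp
  have hval (t : Icc a b) : f t = c + ∫ τ in a..t, (∑ i,
      u τ i • IccExtend hab (pointwiseApply (Icc a b) E E (Ac i) f) τ + h τ) := by
    conv_lhs => rw [hf]
    have hs : IntervalIntegrable (fun τ => ∑ i,
        u τ i • IccExtend hab (pointwiseApply (Icc a b) E E (Ac i) f) τ) volume a b := by
      simpa using hi'.sub hh
    rw [intervalIntegral.integral_add (hs.mono_Icc hab ha t.2) (hh.mono_Icc hab ha t.2),
      intervalIntegral.integral_finsetSum fun i _ => (hi i).mono_Icc hab ha t.2]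
    have hK : K f t = ∑ i, ∫ τ in a..t,
        u τ i • IccExtend hab (pointwiseApply (Icc a b) E E (Ac i) f) τ := by
      simp only [K, sum_apply, ContinuousMap.sum_apply]
      rfl
    rw [ContinuousMap.add_apply, hK]
    change c + _ + _ = _
    abel
  have hfa : f ⟨a, ha⟩ = c := by
    rw [hval]
    simp
  have hode : SolvesODE (IccExtend hab f) (fun τ => ∑ i,
      u τ i • IccExtend hab (pointwiseApply (Icc a b) E E (Ac i) f) τ + h τ) a b := by
    refine ⟨hi', fun t ht => ?_⟩
    rw [IccExtend_of_mem hab _ ht, IccExtend_of_mem hab _ ha, hfa, hval]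
  refine ⟨IccExtend hab f, by rw [IccExtend_of_mem hab _ ha, hfa],
    hode.congr hab (fun _ _ => rfl) (Eventually.of_forall fun t ht => ?_)⟩
  congr 1
  refine Finset.sum_congr rfl fun i _ => ?_
  rw [IccExtend_of_mem hab _ ht, IccExtend_of_mem hab _ ht]
  rfl

theorem fieldTerm_one {V : Type*} [NormedAddCommGroup V] [NormedSpace ℝ V] (Y : V → V) (x : V)
    (Φ : (m : ℕ) → V [×m]→L[ℝ] ℝ) (v : V) :
    fieldTerm Y x Φ 1 v = Φ 1 fun _ => fderiv ℝ Y x v := by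
  rw [fieldTerm, Finset.Icc_self, Finset.sum_singleton]
  change ((1 : ℕ) : ℝ) * Φ 1 _ = _
  rw [Nat.cast_one, one_mul]
  congr 1
  funext i
  obtain rfl : i = 0 := Subsingleton.elim (α := Fin 1) i 0
  change iteratedFDeriv ℝ 1 Y x (fun _ => v) = _
  simp

variable {n : ℕ}

local notation "𝔼" => EuclideanSpace ℝ (Fin n)

/-- The linear forms stay a basis. -/
theorem exists_forall_eq_of_solvesODE {Y : Fin l → 𝔼 → 𝔼} {x : ℝ → 𝔼} {u : ℝ → Fin l → ℝ} {a b : ℝ}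
    (hab : a ≤ b) (hu : ∀ i, IntervalIntegrable (fun t => u t i) volume a b)
    (hY : ∀ i, ContinuousOn (fun t => fderiv ℝ (Y i) (x t)) (Icc a b))
    {Φ : (m : ℕ) → Fin n → ℝ → 𝔼 [×m]→L[ℝ] ℝ}
    (hode : ∀ j, SolvesODE (Φ 1 j)
      (fun t => formsDeriv Y (u t) (x t) (fun m => Φ m j t) 1) a b)
    (ha : ∀ y : Fin n → ℝ, ∃ v, ∀ j, (Φ 1 j a fun _ => v) = y j) {t : ℝ} (ht : t ∈ Icc a b)
    (y : Fin n → ℝ) : ∃ v, ∀ j, (Φ 1 j t fun _ => v) = y j := by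
  obtain ⟨v, hv⟩ := ha y
  -- The vector `v` is transported by the linearised equation `β' = ∑ uᵢ DYᵢ β`. The degree-one
  -- forms obey the adjoint equation, so each pairing with `β` is constant in time.
  obtain ⟨β, hβa, hβ⟩ := exists_solvesODE_linear hab hu hY (h := fun _ => 0)
    intervalIntegrable_const v
  refine ⟨β t, fun j => ?_⟩
  have h1 := ((hode j).prodMk hab hβ).comp_contDiff hab
    ((contDiff_map_diag 1).of_le (by exact_mod_cast le_top))
  have h2 (τ : ℝ) : fderiv ℝ (fun p : (𝔼 [×1]→L[ℝ] ℝ) × 𝔼 => p.1 fun _ => p.2) (Φ 1 j τ, β τ)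
      (formsDeriv Y (u τ) (x τ) (fun m => Φ m j τ) 1,
        ∑ i, u τ i • fderiv ℝ (Y i) (x τ) (β τ) + (0 : 𝔼)) = 0 := by
    let L := continuousMultilinearCurryFin1 ℝ 𝔼 ℝ (Φ 1 j τ)
    have h3 : fderiv ℝ (fun v => Φ 1 j τ fun _ => v) (β τ) = L := L.fderiv
    have h4 (v : 𝔼) : (Φ 1 j τ fun _ => v) = L v := rfl
    have h5 : formsRHS Y (u τ) (x τ) (fun m => Φ m j τ) 1 (β τ) =
        ∑ i, u τ i * fieldTerm (Y i) (x τ) (fun m => Φ m j τ) 1 (β τ) := rfl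
    rw [hasFDerivAt_map_diag, formsDeriv_diag, h3, h5]
    simp only [fieldTerm_one, h4, add_zero, map_sum, map_smul, smul_eq_mul,
      neg_add_cancel]
  simp only [h2] at h1
  have h3 := h1.2 t ht
  simp only [intervalIntegral.integral_zero, add_zero, hβa, hv j] at h3
  exact h3

/-- A vector killed by all `ξ a` is killed by every linear form, in particular by its own inner
product, so it vanishes; equality of dimensions turns injectivity into surjectivity. -/
theorem exists_forall_eq_of_span_eq_top {ξ : Fin n → 𝔼 [×1]→L[ℝ] ℝ}
    (h : Submodule.span ℝ (range ξ) = ⊤) (y : Fin n → ℝ) : ∃ v, ∀ a, (ξ a fun _ => v) = y a := by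
  let A : 𝔼 →ₗ[ℝ] (Fin n → ℝ) :=
    LinearMap.pi fun a => (continuousMultilinearCurryFin1 ℝ 𝔼 ℝ (ξ a)).toLinearMap
  have hinj : Function.Injective A := by
    rw [← LinearMap.ker_eq_bot, LinearMap.ker_eq_bot']
    intro v hv
    have h1 : ∀ f ∈ Submodule.span ℝ (range ξ), (f fun _ => v) = 0 := by
      intro f hf
      induction hf using Submodule.span_induction with
      | mem f hf =>
        obtain ⟨a, rfl⟩ := hf
        exact congrFun hv a
      | zero => rfl
      | add f g _ _ hf hg => rw [add_apply, hf, hg, add_zero]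
      | smul c f _ hf => rw [smul_apply, hf, smul_zero]
    have h2 := h1 ((continuousMultilinearCurryFin1 ℝ 𝔼 ℝ).symm (innerSL ℝ v)) (by rw [h]; trivial)
    have h3 : inner ℝ v v = (0 : ℝ) := by simpa using h2
    exact inner_self_eq_zero.1 h3
  obtain ⟨v, hv⟩ := (LinearMap.injective_iff_surjective_of_finrank_eq_finrank (by simp)).1 hinj y
  exact ⟨v, fun a => congrFun hv a⟩

end LinearEquations

/-! ### Existence of the forms in one chart -/

section FormsExistence

variable {n l : ℕ}

local notation "𝔼" => EuclideanSpace ℝ (Fin n)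

theorem fieldTerm_add (Y : 𝔼 → 𝔼) (x : 𝔼) (Φ Φ' : (m : ℕ) → 𝔼 [×m]→L[ℝ] ℝ) (k : ℕ) :
    fieldTerm Y x (Φ + Φ') k = fieldTerm Y x Φ k + fieldTerm Y x Φ' k := by
  funext v
  simp only [fieldTerm, Pi.add_apply, add_apply, mul_add, Finset.sum_add_distrib]

theorem fieldTerm_const_smul (Y : 𝔼 → 𝔼) (x : 𝔼) (c : ℝ) (Φ : (m : ℕ) → 𝔼 [×m]→L[ℝ] ℝ) (k : ℕ) :
    fieldTerm Y x (c • Φ) k = c • fieldTerm Y x Φ k := by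
  funext v
  simp only [fieldTerm, Pi.smul_apply, smul_apply, smul_eq_mul, Finset.mul_sum]
  exact Finset.sum_congr rfl fun s _ => by ring

theorem diagForm_add {f g : 𝔼 → ℝ} (hf : ContDiff ℝ ∞ f) (hg : ContDiff ℝ ∞ g) (k : ℕ) :
    diagForm k (f + g) = diagForm k f + diagForm k g := by
  have hk : ((k : ℕ) : WithTop ℕ∞) ≤ ∞ := by exact_mod_cast le_top
  rw [diagForm, iteratedFDeriv_add (hf.of_le hk) (hg.of_le hk), Pi.add_apply,
    smul_add]
  rfl

theorem diagForm_const_smul {f : 𝔼 → ℝ} (hf : ContDiff ℝ ∞ f) (c : ℝ) (k : ℕ) :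
    diagForm k (c • f) = c • diagForm k f := by
  have hk : ((k : ℕ) : WithTop ℕ∞) ≤ ∞ := by exact_mod_cast le_top
  rw [diagForm, iteratedFDeriv_const_smul_apply (hf.of_le hk).contDiffAt, smul_comm]
  rfl

theorem formsDeriv_add (Y : Fin l → 𝔼 → 𝔼) (u : Fin l → ℝ) (x : 𝔼)
    (Φ Φ' : (m : ℕ) → 𝔼 [×m]→L[ℝ] ℝ) (k : ℕ) :
    formsDeriv Y u x (Φ + Φ') k = formsDeriv Y u x Φ k + formsDeriv Y u x Φ' k := by
  simp only [formsDeriv, fieldTerm_add, diagForm_add (contDiff_fieldTerm _ _ _ _)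
    (contDiff_fieldTerm _ _ _ _), smul_add, Finset.sum_add_distrib, neg_add]

theorem formsDeriv_congr (Y : Fin l → 𝔼 → 𝔼) (u : Fin l → ℝ) (x : 𝔼)
    {Φ Φ' : (m : ℕ) → 𝔼 [×m]→L[ℝ] ℝ} {k : ℕ} (h : ∀ m ≥ 1, m ≤ k → Φ m = Φ' m) :
    formsDeriv Y u x Φ k = formsDeriv Y u x Φ' k := by
  have (i : Fin l) : fieldTerm (Y i) x Φ k = fieldTerm (Y i) x Φ' k :=
    funext fun v => fieldTerm_congr _ _ h v
  simp only [formsDeriv, this]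

/-- The linear part of the equation of the forms of degree `k`. -/
noncomputable def fieldTermCLM (Y : 𝔼 → 𝔼) (x : 𝔼) (k : ℕ) :
    (𝔼 [×k]→L[ℝ] ℝ) →L[ℝ] (𝔼 [×k]→L[ℝ] ℝ) :=
  LinearMap.toContinuousLinearMap
    { toFun := fun φ => diagForm k (fieldTerm Y x (Pi.single k φ) k)
      map_add' := fun φ φ' => by
        rw [Pi.single_add, fieldTerm_add, diagForm_add (contDiff_fieldTerm _ _ _ _)
          (contDiff_fieldTerm _ _ _ _)]
      map_smul' := fun c φ => by
        rw [Pi.single_smul, fieldTerm_const_smul, diagForm_const_smul (contDiff_fieldTerm _ _ _ _)]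
        rfl }

theorem fieldTermCLM_apply (Y : 𝔼 → 𝔼) (x : 𝔼) (k : ℕ) (φ : 𝔼 [×k]→L[ℝ] ℝ) :
    fieldTermCLM Y x k φ = diagForm k (fieldTerm Y x (Pi.single k φ) k) := rfl

theorem SolvesODE.mem_symmetricForms {k : ℕ} {a b : ℝ} (hab : a ≤ b) {f g : ℝ → 𝔼 [×k]→L[ℝ] ℝ}
    (h : SolvesODE f g a b) (ha : f a ∈ symmetricForms 𝔼 ℝ k)
    (hg : ∀ t ∈ Icc a b, g t ∈ symmetricForms 𝔼 ℝ k) {t : ℝ} (ht : t ∈ Icc a b) :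
    f t ∈ symmetricForms 𝔼 ℝ k := by
  intro σ v
  have h1 (v : Fin k → 𝔼) : f t v = f a v + ∫ τ in a..t, g τ v :=
    (h.clm hab (ContinuousMultilinearMap.apply ℝ (fun _ : Fin k => 𝔼) ℝ v)).2 t ht
  rw [h1, h1, ha σ v]
  congr 1
  refine intervalIntegral.integral_congr fun τ hτ => ?_
  rw [uIcc_of_le ht.1] at hτ
  exact hg τ ⟨hτ.1, hτ.2.trans ht.2⟩ σ v

/-- Given the lower degrees, the equation of degree `k` is linear and inhomogeneous. The conclusion
holds for every family `Φ'` that extends these data, since higher degrees do not enter; the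
recursion over degrees relies on this. -/
theorem exists_forms_step {Y : Fin l → 𝔼 → 𝔼} {x : ℝ → 𝔼} {u : ℝ → Fin l → ℝ} {a b : ℝ}
    (hab : a ≤ b) (hu : ∀ i, IntervalIntegrable (fun t => u t i) volume a b)
    (hY : ∀ i, ∀ s : ℕ, ContinuousOn (fun t => iteratedFDeriv ℝ s (Y i) (x t)) (Icc a b))
    (Φ : (m : ℕ) → ℝ → 𝔼 [×m]→L[ℝ] ℝ) (k : ℕ)
    (hΦ : ∀ m ≥ 1, m < k → ContinuousOn (Φ m) (Icc a b)) {φ₀ : 𝔼 [×k]→L[ℝ] ℝ}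
    (hφ₀ : φ₀ ∈ symmetricForms 𝔼 ℝ k) :
    ∃ φ : ℝ → 𝔼 [×k]→L[ℝ] ℝ, φ a = φ₀ ∧ (∀ t ∈ Icc a b, φ t ∈ symmetricForms 𝔼 ℝ k) ∧
      ∀ Φ' : (m : ℕ) → ℝ → 𝔼 [×m]→L[ℝ] ℝ, (∀ m ≥ 1, m < k → Φ' m = Φ m) → Φ' k = φ →
        SolvesODE φ (fun t => formsDeriv Y (u t) (x t) (fun m => Φ' m t) k) a b := by
  -- With degree `k` set to zero, the right-hand side for `Ξ` is the inhomogeneous part of the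
  -- equation.
  obtain ⟨Ξ, hΞk, hΞ⟩ : ∃ Ξ : (m : ℕ) → ℝ → 𝔼 [×m]→L[ℝ] ℝ, Ξ k = 0 ∧ ∀ m ≠ k, Ξ m = Φ m :=
    ⟨Function.update Φ k 0, Function.update_self _ _ _, fun m hm => Function.update_of_ne hm _ _⟩
  have hA (i : Fin l) : ContinuousOn (fun t => -fieldTermCLM (Y i) (x t) k) (Icc a b) := by
    refine ContinuousOn.neg (continuousOn_clm_apply.2 fun φ => ?_)
    simp only [fieldTermCLM_apply]
    exact continuousOn_diagForm_fieldTerm (hY i)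
      (Φ := fun m _ => (Pi.single k φ : (m : ℕ) → 𝔼 [×m]→L[ℝ] ℝ) m) fun m _ _ => continuousOn_const
  have hh : IntervalIntegrable
      (fun t => formsDeriv Y (u t) (x t) (fun m => Ξ m t) k) volume a b := by
    refine intervalIntegrable_formsDeriv hab hu hY fun m hm hmk => ?_
    rcases eq_or_lt_of_le hmk with rfl | hlt
    · rw [hΞk]
      exact continuousOn_const
    · rw [hΞ m hlt.ne]
      exact hΦ m hm hlt
  obtain ⟨φ, hφa, hφ⟩ := exists_solvesODE_linear hab hu hA hh φ₀
  have hT (t : ℝ) : ∑ i, u t i • (-fieldTermCLM (Y i) (x t) k) (φ t) =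
      formsDeriv Y (u t) (x t) (Pi.single k (φ t)) k := by
    simp only [formsDeriv, neg_apply, fieldTermCLM_apply, smul_neg, Finset.sum_neg_distrib]
  have hmem : ∀ t ∈ Icc a b, φ t ∈ symmetricForms 𝔼 ℝ k := by
    intro t ht
    refine hφ.mem_symmetricForms hab (hφa ▸ hφ₀) (fun t _ => ?_) ht
    rw [hT]
    exact Submodule.add_mem _ (formsDeriv_mem _ _ _ _ _) (formsDeriv_mem _ _ _ _ _)
  refine ⟨φ, hφa, hmem, fun Φ' h1 h2 => ?_⟩
  have hg (t : ℝ) : formsDeriv Y (u t) (x t) (fun m => Φ' m t) k =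
      ∑ i, u t i • (-fieldTermCLM (Y i) (x t) k) (φ t) +
          formsDeriv Y (u t) (x t) (fun m => Ξ m t) k := by
      rw [hT, ← formsDeriv_add]
      refine formsDeriv_congr _ _ _ fun m hm hmk => ?_
      rw [Pi.add_apply]
      rcases eq_or_lt_of_le hmk with rfl | hlt
      · rw [Pi.single_eq_same, hΞk, h2, Pi.zero_apply, add_zero]
      · rw [Pi.single_eq_of_ne hlt.ne, hΞ m hlt.ne, h1 m hm hlt, zero_add]
  simp only [hg]
  exact hφ

/-- The equations of the forms are solvable for any symmetric initial values. -/
theorem exists_forms {Y : Fin l → 𝔼 → 𝔼} {x : ℝ → 𝔼} {u : ℝ → Fin l → ℝ} {a b : ℝ}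
    (hab : a ≤ b) (hu : ∀ i, IntervalIntegrable (fun t => u t i) volume a b)
    (hY : ∀ i, ∀ s : ℕ, ContinuousOn (fun t => iteratedFDeriv ℝ s (Y i) (x t)) (Icc a b))
    {Φ₀ : (m : ℕ) → 𝔼 [×m]→L[ℝ] ℝ} (hΦ₀ : ∀ m ≥ 1, Φ₀ m ∈ symmetricForms 𝔼 ℝ m) :
    ∃ Φ : (m : ℕ) → ℝ → 𝔼 [×m]→L[ℝ] ℝ, ∀ k ≥ 1, Φ k a = Φ₀ k ∧
      (∀ t ∈ Icc a b, Φ k t ∈ symmetricForms 𝔼 ℝ k) ∧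
      SolvesODE (Φ k) (fun t => formsDeriv Y (u t) (x t) (fun m => Φ m t) k) a b := by
  -- The hypotheses stand behind the existential quantifier, so that choice yields a total function
  -- `S` on which well-founded recursion over the degree can run.
  have hstep : ∀ (k : ℕ) (Φ : (m : ℕ) → ℝ → 𝔼 [×m]→L[ℝ] ℝ), ∃ φ : ℝ → 𝔼 [×k]→L[ℝ] ℝ, 1 ≤ k →
      (∀ m ≥ 1, m < k → ContinuousOn (Φ m) (Icc a b)) →
      φ a = Φ₀ k ∧ (∀ t ∈ Icc a b, φ t ∈ symmetricForms 𝔼 ℝ k) ∧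
      ∀ Φ' : (m : ℕ) → ℝ → 𝔼 [×m]→L[ℝ] ℝ, (∀ m ≥ 1, m < k → Φ' m = Φ m) → Φ' k = φ →
        SolvesODE φ (fun t => formsDeriv Y (u t) (x t) (fun m => Φ' m t) k) a b := by
    intro k Φ
    by_cases h : 1 ≤ k ∧ ∀ m ≥ 1, m < k → ContinuousOn (Φ m) (Icc a b)
    · obtain ⟨φ, hφ⟩ := exists_forms_step hab hu hY Φ k h.2 (hΦ₀ k h.1)
      exact ⟨φ, fun _ _ => hφ⟩
    · exact ⟨0, fun h1 h2 => absurd ⟨h1, h2⟩ h⟩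
  choose S hS using hstep
  let F : (k : ℕ) → ((m : ℕ) → m < k → ℝ → 𝔼 [×m]→L[ℝ] ℝ) → ℝ → 𝔼 [×k]→L[ℝ] ℝ :=
    fun k ih => S k fun m => if h : m < k then ih m h else 0
  let Φ : (m : ℕ) → ℝ → 𝔼 [×m]→L[ℝ] ℝ := Nat.lt_wfRel.wf.fix F
  have hΦ (k : ℕ) : Φ k = S k fun m => if m < k then Φ m else 0 := by
    have : Φ k = F k fun m _ => Φ m := Nat.lt_wfRel.wf.fix_eq F k
    rw [this]
    simp only [F, dite_eq_ite]
  refine ⟨Φ, fun k => ?_⟩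
  induction k using Nat.strong_induction_on with
  | _ k ih =>
    intro hk
    obtain ⟨h1, h2, h3⟩ := hS k (fun m => if m < k then Φ m else 0) hk fun m hm hmk => by
      rw [if_pos hmk]
      exact (ih m hmk hm).2.2.continuousOn hab
    rw [← hΦ k] at h1 h2 h3
    exact ⟨h1, h2, h3 Φ (fun m _ hmk => (if_pos hmk).symm) rfl⟩

end FormsExistence

/-! ### Pullback of jets of functions -/

section ChartTransport

variable {V W : Type*} [NormedAddCommGroup V] [NormedSpace ℝ V] [NormedAddCommGroup W]
  [NormedSpace ℝ W]

theorem contDiffAt_formsPoly_sub (Φ : (m : ℕ) → V [×m]→L[ℝ] W) (k : ℕ) {ψ : V → V} {x : V}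
    (hψ : ContDiffAt ℝ ∞ ψ x) : ContDiffAt ℝ ∞ (fun y => formsPoly Φ k (ψ y - ψ x)) x :=
  (contDiff_formsPoly Φ k).contDiffAt.comp x (hψ.sub contDiffAt_const)

/-- The derivatives at `x` of the function whose derivatives at `ψ x` are the forms `Φ m`,
pulled back by `ψ`. -/
noncomputable def formsPullback (Φ : (m : ℕ) → V [×m]→L[ℝ] W) (ψ : V → V) (x : V) (m : ℕ) :
    V [×m]→L[ℝ] W :=
  iteratedFDeriv ℝ m (fun y => formsPoly Φ m (ψ y - ψ x)) x

theorem formsPullback_mem (Φ : (m : ℕ) → V [×m]→L[ℝ] W) {ψ : V → V} {x : V}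
    (hψ : ContDiffAt ℝ ∞ ψ x) (m : ℕ) : formsPullback Φ ψ x m ∈ symmetricForms V W m :=
  fun σ v => (contDiffAt_formsPoly_sub Φ m hψ).iteratedFDeriv_comp_perm_of_infty σ v

variable [CompleteSpace V] [CompleteSpace W]

/-- The truncation degree is immaterial once it is at least `m`: on the diagonal both derivatives
have the same expansion over multi-indices of weight `m`. -/
theorem iteratedFDeriv_formsPoly_sub {Φ : (m : ℕ) → V [×m]→L[ℝ] W}
    (hΦ : ∀ m, Φ m ∈ symmetricForms V W m) {ψ : V → V} {x : V} (hψ : ContDiffAt ℝ ∞ ψ x) {m k : ℕ}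
    (hmk : m ≤ k) :
    iteratedFDeriv ℝ m (fun y => formsPoly Φ k (ψ y - ψ x)) x = formsPullback Φ ψ x m := by
  refine ContinuousMultilinearMap.eq_of_diag_eq
    (fun σ v => (contDiffAt_formsPoly_sub Φ k hψ).iteratedFDeriv_comp_perm_of_infty σ v)
    (formsPullback_mem Φ hψ m) fun v => ?_
  have key (N : ℕ) (hN : m ≤ N) :
      ((m.factorial : ℝ)⁻¹) • (iteratedFDeriv ℝ m (fun y => formsPoly Φ N (ψ y - ψ x)) x
        fun _ => v) = ∑ α ∈ multiIndices m m, ((multiFactorial α : ℝ)⁻¹) • Φ (multiAbs α)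
        (multiPow (fun i : Fin m => expansionCoeff (fun s : ℝ => ψ (x + s • v)) (i + 1)) α) := by
    have hline : ContDiffAt ℝ ∞ (fun s : ℝ => ψ (x + s • v)) 0 := by
      refine ContDiffAt.comp (0 : ℝ) (g := ψ) ?_ (by fun_prop)
      simpa using hψ
    rw [← expansionCoeff_line (contDiffAt_formsPoly_sub Φ N hψ),
      ← expansionCoeff_formsPoly_comp (N := N) (fun m _ => hΦ m) hline hN le_rfl]
    simp
  exact smul_right_injective W
    (inv_ne_zero (Nat.cast_ne_zero.2 m.factorial_ne_zero) : ((m.factorial : ℝ)⁻¹) ≠ 0)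
    ((key k hmk).trans (key m le_rfl).symm)

/-- Both sides are the `k`-th coefficient of `formsPoly Φ k (ψ (δ s) - ψ (δ 0))`, read as a function
along `δ` or as a polynomial along `ψ ∘ δ`. -/
theorem sum_formsPullback_expansionCoeff {Φ : (m : ℕ) → V [×m]→L[ℝ] W}
    (hΦ : ∀ m, Φ m ∈ symmetricForms V W m) {ψ : V → V} {δ : ℝ → V} (hδ : ContDiffAt ℝ ∞ δ 0)
    (hψ : ContDiffAt ℝ ∞ ψ (δ 0)) (k : ℕ) :
    ∑ α ∈ multiIndices k k, ((multiFactorial α : ℝ)⁻¹) •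
        formsPullback Φ ψ (δ 0) (multiAbs α)
          (multiPow (fun i : Fin k => expansionCoeff δ (i + 1)) α) =
      ∑ α ∈ multiIndices k k, ((multiFactorial α : ℝ)⁻¹) • Φ (multiAbs α)
        (multiPow (fun i : Fin k => expansionCoeff (fun s => ψ (δ s)) (i + 1)) α) := by
  have hψδ : ContDiffAt ℝ ∞ (fun s => ψ (δ s)) 0 := hψ.comp (0 : ℝ) hδ
  rw [← expansionCoeff_formsPoly_comp (N := k) (fun m _ => hΦ m) hψδ le_rfl le_rfl]
  rw [expansionCoeff_comp (f := fun y => formsPoly Φ k (ψ y - ψ (δ 0))) hδ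
    (contDiffAt_formsPoly_sub Φ k hψ) le_rfl]
  refine Finset.sum_congr rfl fun α hα => ?_
  rw [mem_multiIndices] at hα
  rw [iteratedFDeriv_formsPoly_sub hΦ hψ ((multiAbs_le_multiWeight α).trans_eq hα)]

end ChartTransport

/-! ### Change of chart for the forms -/

section ChartTransportManifold

variable {n : ℕ} {M : Type*} [TopologicalSpace M]
  [ChartedSpace (EuclideanSpace ℝ (Fin n)) M]

local notation "𝔼" => EuclideanSpace ℝ (Fin n)

theorem contDiffAt_chart_change {e e' : OpenPartialHomeomorph M (EuclideanSpace ℝ (Fin n))}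
    (he : e ∈ IsManifold.maximalAtlas (𝓡 n) ∞ M) (he' : e' ∈ IsManifold.maximalAtlas (𝓡 n) ∞ M)
    {p : M} (hp : p ∈ e.source) (hp' : p ∈ e'.source) :
    ContDiffAt ℝ ∞ (fun x => e' (e.symm x)) (e p) := by
  refine (contDiffOn_chart_change he he').contDiffAt
    ((e.symm.trans e').open_source.mem_nhds ⟨e.map_source hp, ?_⟩)
  simpa [e.left_inv hp] using hp'

/-- Forms at a point can be rewritten in another chart. -/
theorem exists_forms_chart_change [IsManifold (𝓡 n) ∞ M]
    {e e' : OpenPartialHomeomorph M (EuclideanSpace ℝ (Fin n))}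
    (he : e ∈ IsManifold.maximalAtlas (𝓡 n) ∞ M) (he' : e' ∈ IsManifold.maximalAtlas (𝓡 n) ∞ M)
    {p : M} (hp : p ∈ e.source) (hp' : p ∈ e'.source) {Φ : (m : ℕ) → 𝔼 [×m]→L[ℝ] ℝ}
    (hΦ : ∀ m ≥ 1, Φ m ∈ symmetricForms 𝔼 ℝ m) :
    ∃ Φ' : (m : ℕ) → 𝔼 [×m]→L[ℝ] ℝ, (∀ m, Φ' m ∈ symmetricForms 𝔼 ℝ m) ∧
      ∀ (k : ℕ) (γ : ℝ → M), γ 0 = p → ContMDiffAt 𝓘(ℝ, ℝ) (𝓡 n) ∞ γ 0 →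
        gradedPoly Φ' k (jetCoeffs e' γ k) = gradedPoly Φ k (jetCoeffs e γ k) := by
  have hψ := contDiffAt_chart_change he' he hp' hp
  have hΦ' (m : ℕ) : Φ m ∈ symmetricForms 𝔼 ℝ m := by
    rcases Nat.eq_zero_or_pos m with rfl | hm
    · exact fun σ v => congrArg _ (Subsingleton.elim _ _)
    · exact hΦ m hm
  refine ⟨formsPullback Φ (fun x => e (e'.symm x)) (e' p), formsPullback_mem Φ hψ,
    fun k γ h0 hγ => ?_⟩
  subst h0
  have h1 := sum_formsPullback_expansionCoeff (δ := fun s => e' (γ s)) hΦ'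
    (hγ.contDiffAt_chart he' hp') hψ k
  have h2 : (fun s => e (e'.symm (e' (γ s)))) =ᶠ[𝓝 0] fun s => e (γ s) := by
    filter_upwards [hγ.continuousAt (e'.open_source.mem_nhds hp')] with s hs
    rw [e'.left_inv hs]
  simp only [h2.expansionCoeff_eq] at h1
  exact h1

/-- A vector in a chart is the velocity of a smooth curve. -/
theorem exists_curve_of_velocity {e : OpenPartialHomeomorph M (EuclideanSpace ℝ (Fin n))}
    (he : e ∈ IsManifold.maximalAtlas (𝓡 n) ∞ M) {p : M} (hp : p ∈ e.source) (v : 𝔼) :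
    ∃ γ : ℝ → M, γ 0 = p ∧ ContMDiffAt 𝓘(ℝ, ℝ) (𝓡 n) ∞ γ 0 ∧ jetCoeffs e γ 1 = fun _ => v := by
  have hline : ContDiff ℝ ∞ fun s : ℝ => e p + s • v := by fun_prop
  have h0 : e p + (0 : ℝ) • v ∈ e.target := by simpa using e.map_source hp
  refine ⟨fun s => e.symm (e p + s • v), by simp [e.left_inv hp], ?_, ?_⟩
  · exact ContMDiffAt.comp (0 : ℝ) (g := e.symm)
      ((contMDiffOn_symm_of_mem_maximalAtlas he).contMDiffAt (e.open_target.mem_nhds h0))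
      hline.contMDiff.contMDiffAt
  · funext i
    have h1 : (fun s : ℝ => e (e.symm (e p + s • v))) =ᶠ[𝓝 0] fun s => e p + s • v := by
      filter_upwards [hline.continuous.continuousAt (e.open_target.mem_nhds h0)] with s hs
      rw [e.right_inv hs]
    change expansionCoeff (fun s => e (e.symm (e p + s • v))) (i + 1) = v
    rw [h1.expansionCoeff_eq]
    have : (i : ℕ) = 0 := by omega
    rw [this]
    have hd : deriv (fun s : ℝ => e p + s • v) 0 = v := by
      simpa using (((hasDerivAt_id (0 : ℝ)).smul_const v).const_add (e p)).deriv
    simp only [expansionCoeff, zero_add, iteratedDeriv_one, hd]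
    simp

theorem gradedPoly_one (Φ : (m : ℕ) → 𝔼 [×m]→L[ℝ] ℝ) (v : 𝔼) :
    (gradedPoly Φ 1 fun _ => v) = Φ 1 fun _ => v := by
  rw [gradedPoly_succ]
  have : (Fin.snoc (Fin.init fun _ : Fin 1 => v) 0 : Fin 1 → 𝔼) = 0 := by
    funext i
    rw [show i = Fin.last 0 from Fin.ext (by simp), Fin.snoc_last]
    rfl
  rw [this, gradedPoly_zero Φ (Nat.succ_ne_zero 0), add_zero]

end ChartTransportManifold

/-! ### Adapted forms along the whole trajectory -/

section AdaptedForms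

variable {n l : ℕ} {M : Type*} [TopologicalSpace M]
  [ChartedSpace (EuclideanSpace ℝ (Fin n)) M]

local notation "𝔼" => EuclideanSpace ℝ (Fin n)

namespace CoordinatesAlong

variable {q : ℝ → M} {T : ℝ}

theorem τ_mem (C : CoordinatesAlong n q T) {j : ℕ} (hj : j ≤ C.N) : C.τ j ∈ Icc 0 T := by
  constructor
  · induction j with
    | zero => exact C.τ_zero.ge
    | succ j ih => exact (ih (by omega)).trans (C.τ_le j (by omega))
  · induction hj using Nat.decreasingInduction with
    | self => exact C.τ_last.le
    | of_succ j hj ih => exact (C.τ_le j hj).trans ih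

theorem mem_Icc (C : CoordinatesAlong n q T) {j : ℕ} (hj : j < C.N) {t : ℝ}
    (ht : t ∈ Icc (C.τ j) (C.τ (j + 1))) : t ∈ Icc 0 T :=
  ⟨(C.τ_mem hj.le).1.trans ht.1, ht.2.trans (C.τ_mem hj).2⟩

theorem intervalIntegrable (C : CoordinatesAlong n q T) {g : ℝ → ℝ}
    (hT : 0 ≤ T) (hg : IntervalIntegrable g volume 0 T) {j : ℕ} (hj : j < C.N) :
    IntervalIntegrable g volume (C.τ j) (C.τ (j + 1)) :=
  hg.mono_Icc hT (C.τ_mem hj.le) (C.τ_mem hj)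

theorem N_pos (C : CoordinatesAlong n q T) (hT : 0 < T) : 0 < C.N := by
  refine Nat.pos_of_ne_zero fun h => ?_
  have := C.τ_last
  rw [h, C.τ_zero] at this
  exact hT.ne this

end CoordinatesAlong

theorem continuousOn_iteratedFDeriv_localField [IsManifold (𝓡 n) ∞ M]
    {X : (p : M) → TangentSpace (𝓡 n) p}
    (hX : ContMDiff (𝓡 n) (𝓡 n).tangent ∞ (fun p => (⟨p, X p⟩ : TangentBundle (𝓡 n) M)))
    {e : OpenPartialHomeomorph M (EuclideanSpace ℝ (Fin n))}
    (he : e ∈ IsManifold.maximalAtlas (𝓡 n) ∞ M) {q : ℝ → M} {S : Set ℝ} (hq : ContinuousOn q S)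
    (hqe : ∀ t ∈ S, q t ∈ e.source) (s : ℕ) :
    ContinuousOn (fun t => iteratedFDeriv ℝ s (localField X e) (e (q t))) S := by
  intro t ht
  have h1 : ContDiffAt ℝ ∞ (localField X e) (e (q t)) :=
    (contDiffOn_localField hX he).contDiffAt (e.open_target.mem_nhds (e.map_source (hqe t ht)))
  have h2 : ContinuousAt (iteratedFDeriv ℝ s (localField X e)) (e (q t)) :=
    (h1.iteratedFDeriv_right (m := 0) (by rw [zero_add]; exact_mod_cast le_top)).continuousAt
  exact ContinuousAt.comp_continuousWithinAt (f := fun t => e (q t)) h2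
    ((e.continuousOn.comp hq hqe) t ht)

variable [IsManifold (𝓡 n) ∞ M] {X : Fin l → (p : M) → TangentSpace (𝓡 n) p} {T : ℝ}
  {u : ℝ → Fin l → ℝ} {q : ℝ → M} {C : CoordinatesAlong n q T}

theorem CoordinatesAlong.continuousOn_iteratedFDeriv_localField (C : CoordinatesAlong n q T)
    (hX : ∀ i, ContMDiff (𝓡 n) (𝓡 n).tangent ∞ (fun p => (⟨p, X i p⟩ : TangentBundle (𝓡 n) M)))
    (hq : ContinuousOn q (Icc 0 T)) {j : ℕ} (hj : j < C.N) (i : Fin l) (s : ℕ) :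
    ContinuousOn (fun t => iteratedFDeriv ℝ s (localField (X i) (C.e j)) (C.e j (q t)))
      (Icc (C.τ j) (C.τ (j + 1))) :=
  _root_.continuousOn_iteratedFDeriv_localField (hX i) (C.e_mem j hj)
    (hq.mono fun _ ht => C.mem_Icc hj ht) (C.q_mem j hj) s

/-- The equation of the forms can be solved in each chart in turn. -/
theorem exists_isAdaptedForms
    (hX : ∀ i, ContMDiff (𝓡 n) (𝓡 n).tangent ∞ (fun p => (⟨p, X i p⟩ : TangentBundle (𝓡 n) M)))
    (hT : 0 < T) (hu : ∀ i, IntervalIntegrable (fun t => u t i) volume 0 T)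
    (hq : ContinuousOn q (Icc 0 T)) (C : CoordinatesAlong n q T) {ξ : Fin n → 𝔼 [×1]→L[ℝ] ℝ}
    (hξ : LinearIndependent ℝ ξ) (hξ' : Submodule.span ℝ (range ξ) = ⊤) :
    ∃ Φ : ℕ → (k : ℕ) → Fin n → ℝ → 𝔼 [×k]→L[ℝ] ℝ,
      IsAdaptedForms X u q C Φ ∧ ∀ a, Φ 0 1 a 0 = ξ a := by
  -- The condition is vacuous for `j ≥ C.N`, so the recursion over charts can run over all natural
  -- numbers.
  let Good (j : ℕ) (Φ : (k : ℕ) → Fin n → ℝ → 𝔼 [×k]→L[ℝ] ℝ) : Prop :=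
    j < C.N → ∀ k ≥ 1, ∀ a,
      (∀ t ∈ Icc (C.τ j) (C.τ (j + 1)), Φ k a t ∈ symmetricForms 𝔼 ℝ k) ∧
      SolvesODE (Φ k a) (fun t => formsDeriv (fun i => localField (X i) (C.e j)) (u t)
        (C.e j (q t)) (fun m => Φ m a t) k) (C.τ j) (C.τ (j + 1))
  have hsolve (j : ℕ) (hj : j < C.N) {Φ₀ : (m : ℕ) → Fin n → 𝔼 [×m]→L[ℝ] ℝ}
      (hΦ₀ : ∀ m ≥ 1, ∀ a, Φ₀ m a ∈ symmetricForms 𝔼 ℝ m) :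
      ∃ Φ, Good j Φ ∧ ∀ k ≥ 1, ∀ a, Φ k a (C.τ j) = Φ₀ k a := by
    have := fun a : Fin n => exists_forms (C.τ_le j hj)
      (fun i => C.intervalIntegrable hT.le (hu i) hj)
      (fun i s => C.continuousOn_iteratedFDeriv_localField hX hq hj i s)
      (Φ₀ := fun m => Φ₀ m a) fun m hm => hΦ₀ m hm a
    choose Φ hΦ using this
    exact ⟨fun k a => Φ a k, fun _ k hk a => (hΦ a k hk).2, fun k hk a => (hΦ a k hk).1⟩
  let Step (j : ℕ) (Φ Φ' : (k : ℕ) → Fin n → ℝ → 𝔼 [×k]→L[ℝ] ℝ) : Prop :=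
    j + 1 < C.N → ∀ k ≥ 1, ∀ a, ∀ γ : ℝ → M, γ 0 = q (C.τ (j + 1)) →
      ContMDiffAt 𝓘(ℝ, ℝ) (𝓡 n) ∞ γ 0 →
      gradedPoly (fun m => Φ' m a (C.τ (j + 1))) k (jetCoeffs (C.e (j + 1)) γ k) =
        gradedPoly (fun m => Φ m a (C.τ (j + 1))) k (jetCoeffs (C.e j) γ k)
  have hstep (j : ℕ) (Φ) (hΦ : Good j Φ) : ∃ Φ', Good (j + 1) Φ' ∧ Step j Φ Φ' := by
    by_cases hj : j + 1 < C.N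
    · have hj' : j < C.N := by omega
      have := fun a : Fin n => exists_forms_chart_change (C.e_mem j hj') (C.e_mem (j + 1) hj)
        (C.q_mem j hj' (C.τ (j + 1)) ⟨C.τ_le j hj', le_rfl⟩)
        (C.q_mem (j + 1) hj (C.τ (j + 1)) ⟨le_rfl, C.τ_le (j + 1) hj⟩)
        (Φ := fun m => Φ m a (C.τ (j + 1)))
        fun m hm => (hΦ hj' m hm a).1 _ ⟨C.τ_le j hj', le_rfl⟩
      choose Φ₀ hΦ₀ hγ using this
      obtain ⟨Φ', hΦ', hΦ'₀⟩ := hsolve (j + 1) hj (Φ₀ := fun m a => Φ₀ a m) fun m _ a => hΦ₀ a m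
      refine ⟨Φ', hΦ', fun _ k hk a γ h0 hγs => ?_⟩
      rw [← hγ a k γ h0 hγs]
      exact gradedPoly_congr (by omega) (fun m hm _ => hΦ'₀ m hm a) _
    · exact ⟨0, fun h => absurd h hj, fun h => absurd h hj⟩
  obtain ⟨ξ', hξ'1, hξ'k⟩ : ∃ ξ' : (m : ℕ) → Fin n → 𝔼 [×m]→L[ℝ] ℝ, ξ' 1 = ξ ∧
      ∀ m ≠ 1, ξ' m = 0 :=
    ⟨Function.update 0 1 ξ, Function.update_self _ _ _, fun m hm => Function.update_of_ne hm _ _⟩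
  obtain ⟨Φ₀, hΦ₀, hΦ₀ξ⟩ := hsolve 0 (C.N_pos hT) (Φ₀ := ξ') fun m _ a => by
    by_cases h : m = 1
    · subst h
      exact fun σ v => congrArg _ (funext fun i => congrArg v (Subsingleton.elim _ _))
    · rw [hξ'k m h]
      exact Submodule.zero_mem _
  choose next hnext hnext' using hstep
  let seq (j : ℕ) : {Φ // Good j Φ} :=
    Nat.rec ⟨Φ₀, hΦ₀⟩ (fun j Φ => ⟨next j Φ.1 Φ.2, hnext j Φ.1 Φ.2⟩) j
  have h0 (k : ℕ) (hk : k ≥ 1) (a : Fin n) : (seq 0).1 k a 0 = ξ' k a := by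
    have := hΦ₀ξ k hk a
    rwa [C.τ_zero] at this
  have h1 : (fun a => (seq 0).1 1 a 0) = ξ := by
    funext a
    rw [h0 1 le_rfl, hξ'1]
  refine ⟨fun j => (seq j).1, ⟨?_, ?_, ?_, ?_, ?_, ?_⟩, fun a => congrFun h1 a⟩
  · exact fun j hj k hk a t ht => ((seq j).2 hj k hk a).1 t ht
  · rw [h1]; exact hξ
  · rw [h1]; exact hξ'
  · intro k hk a
    rw [h0 k (by omega), hξ'k k (by omega)]
    rfl
  · intro j hj k hk a b
    have h2 := ((seq j).2 hj k hk a).2.clm (C.τ_le j hj)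
      (ContinuousMultilinearMap.apply ℝ (fun _ : Fin k => 𝔼) ℝ fun _ => b)
    simpa [formsDeriv_diag] using h2
  · exact fun j hj => hnext' j (seq j).1 (seq j).2 hj

namespace IsAdaptedForms

variable {Φ : ℕ → (k : ℕ) → Fin n → ℝ → EuclideanSpace ℝ (Fin n) [×k]→L[ℝ] ℝ}

theorem solvesODE_formsDeriv (h : IsAdaptedForms X u q C Φ)
    (hX : ∀ i, ContMDiff (𝓡 n) (𝓡 n).tangent ∞ (fun p => (⟨p, X i p⟩ : TangentBundle (𝓡 n) M)))
    (hT : 0 ≤ T) (hu : ∀ i, IntervalIntegrable (fun t => u t i) volume 0 T)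
    (hq : ContinuousOn q (Icc 0 T)) {j : ℕ} (hj : j < C.N) {k : ℕ} (hk : 1 ≤ k) (a : Fin n) :
    SolvesODE (Φ j k a) (fun t => formsDeriv (fun i => localField (X i) (C.e j)) (u t)
      (C.e j (q t)) (fun m => Φ j m a t) k) (C.τ j) (C.τ (j + 1)) :=
  _root_.solvesODE_formsDeriv (Φ := fun m => Φ j m a) (C.τ_le j hj)
    (fun i => C.intervalIntegrable hT (hu i) hj)
    (fun i s => C.continuousOn_iteratedFDeriv_localField hX hq hj i s)
    (fun k hk => h.symm j hj k hk a) (fun k hk => h.ode j hj k hk a) hk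

/-- The linear forms of the family are a basis at all times. -/
theorem exists_forall_eq (h : IsAdaptedForms X u q C Φ)
    (hX : ∀ i, ContMDiff (𝓡 n) (𝓡 n).tangent ∞ (fun p => (⟨p, X i p⟩ : TangentBundle (𝓡 n) M)))
    (hT : 0 ≤ T) (hu : ∀ i, IntervalIntegrable (fun t => u t i) volume 0 T)
    (hq : ContinuousOn q (Icc 0 T)) {j : ℕ} (hj : j < C.N) :
    ∀ t ∈ Icc (C.τ j) (C.τ (j + 1)), ∀ y : Fin n → ℝ, ∃ v, ∀ a, (Φ j 1 a t fun _ => v) = y a := by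
  have hmain (j : ℕ) (hj : j < C.N)
      (h0 : ∀ y : Fin n → ℝ, ∃ v, ∀ a, (Φ j 1 a (C.τ j) fun _ => v) = y a) :
      ∀ t ∈ Icc (C.τ j) (C.τ (j + 1)), ∀ y : Fin n → ℝ, ∃ v, ∀ a,
        (Φ j 1 a t fun _ => v) = y a := by
    intro t ht y
    refine exists_forall_eq_of_solvesODE (Φ := Φ j) (C.τ_le j hj)
      (fun i => C.intervalIntegrable hT (hu i) hj) (fun i => ?_)
      (fun a => h.solvesODE_formsDeriv hX hT hu hq hj le_rfl a) h0 ht y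
    have h1 := C.continuousOn_iteratedFDeriv_localField hX hq hj i 1
    refine ((continuousMultilinearCurryFin1 ℝ 𝔼 𝔼).continuous.comp_continuousOn h1).congr
      fun t _ => ?_
    ext v
    simp
  induction j with
  | zero =>
    refine hmain 0 hj fun y => ?_
    rw [C.τ_zero]
    exact exists_forall_eq_of_span_eq_top h.init_span y
  | succ j ih =>
    have hj' : j < C.N := by omega
    refine hmain (j + 1) hj fun y => ?_
    have hτ : C.τ (j + 1) ∈ Icc (C.τ j) (C.τ (j + 1)) := ⟨C.τ_le j hj', le_rfl⟩
    obtain ⟨v, hv⟩ := ih hj' _ hτ y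
    -- A vector in the old chart is realised as the velocity of a curve. The case `k = 1` of
    -- `change_chart` says that its velocity in the new chart has the same values under the
    -- one-forms.
    obtain ⟨γ, h0, hγ, hγv⟩ := exists_curve_of_velocity (C.e_mem j hj') (C.q_mem j hj' _ hτ) v
    refine ⟨jetCoeffs (C.e (j + 1)) γ 1 0, fun a => ?_⟩
    have h1 := h.change_chart j hj 1 le_rfl a γ h0 hγ
    rw [hγv, gradedPoly_one, hv a] at h1
    rw [← h1, ← gradedPoly_one (fun m => Φ (j + 1) m a (C.τ (j + 1)))]
    congr 1
    funext i
    rw [Subsingleton.elim i 0]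

end IsAdaptedForms

end AdaptedForms

/-! ### Assembly of the theorem -/

theorem theorem1 {n l : ℕ} {M : Type*} [TopologicalSpace M] [T2Space M]
    [ChartedSpace (EuclideanSpace ℝ (Fin n)) M] [IsManifold (𝓡 n) ∞ M]
    (X : Fin l → (p : M) → TangentSpace (𝓡 n) p)
    (hX : ∀ i, ContMDiff (𝓡 n) (𝓡 n).tangent ∞
      (fun p => (⟨p, X i p⟩ : TangentBundle (𝓡 n) M)))
    (T : ℝ) (hT : 0 < T) (u Δu : ℝ → Fin l → ℝ)
    (hu : IntegrableOn u (Icc 0 T)) (hΔu : IntegrableOn Δu (Icc 0 T))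
    (q₀ : M) (q : ℝ → M) (hq : IsTrajectory X u q₀ T q) :
    -- the end-point map is well defined at `u + s Δu` for small `s`, equals `q` at `s = 0`,
    -- and is smooth in `s` there
    (∀ᶠ s : ℝ in 𝓝 0,
      IsTrajectory X (u + s • Δu) q₀ T (endPoint X q₀ T (u + s • Δu)) ∧
      ∀ q', IsTrajectory X (u + s • Δu) q₀ T q' →
        EqOn q' (endPoint X q₀ T (u + s • Δu)) (Icc 0 T)) ∧
    (∀ t ∈ Icc 0 T, endPoint X q₀ T u t = q t ∧
      ContMDiffAt 𝓘(ℝ, ℝ) (𝓡 n) ∞ (fun s : ℝ => endPoint X q₀ T (u + s • Δu) t) 0) ∧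
    ∀ C : CoordinatesAlong n q T,
      -- forms with any prescribed initial basis exist
      (∀ ξ : Fin n → EuclideanSpace ℝ (Fin n) [×1]→L[ℝ] ℝ, LinearIndependent ℝ ξ →
        Submodule.span ℝ (range ξ) = ⊤ →
        ∃ Φ : ℕ → (k : ℕ) → Fin n → ℝ → EuclideanSpace ℝ (Fin n) [×k]→L[ℝ] ℝ,
          IsAdaptedForms X u q C Φ ∧ ∀ a, Φ 0 1 a 0 = ξ a) ∧
      ∀ Φ : ℕ → (k : ℕ) → Fin n → ℝ → EuclideanSpace ℝ (Fin n) [×k]→L[ℝ] ℝ,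
        IsAdaptedForms X u q C Φ →
        -- reversibility, at every time and for every order
        (∀ j < C.N, ∀ t ∈ Icc (C.τ j) (C.τ (j + 1)), ∀ k ≥ 1,
          ∃ Ψ : (Fin k → Fin n → ℝ) → (Fin k → EuclideanSpace ℝ (Fin n)),
            ContDiff ℝ ∞ Ψ ∧
            Function.LeftInverse Ψ (jetMap (fun m a => Φ j m a t) k) ∧
            Function.RightInverse Ψ (jetMap (fun m a => Φ j m a t) k)) ∧
        -- the evolution equations of the adapted coordinates
        (∀ j < C.N, ∀ k ≥ 1, ∀ a,
          SolvesODE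
            (fun t => gradedPoly (fun m => Φ j m a t) k
              (jetCoeffs (C.e j) (fun s : ℝ => endPoint X q₀ T (u + s • Δu) t) k))
            (fun t => coordsRHS (fun i => localField (X i) (C.e j)) (Δu t) (C.e j (q t))
              (fun m => Φ j m a t) k
              (jetCoeffs (C.e j) (fun s : ℝ => endPoint X q₀ T (u + s • Δu) t) k))
            (C.τ j) (C.τ (j + 1))) ∧
        -- the adapted coordinates do not jump where the chart changes
        (∀ j, j + 1 < C.N → ∀ k ≥ 1, ∀ a,
          gradedPoly (fun m => Φ j m a (C.τ (j + 1))) k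
              (jetCoeffs (C.e j)
                (fun s : ℝ => endPoint X q₀ T (u + s • Δu) (C.τ (j + 1))) k) =
            gradedPoly (fun m => Φ (j + 1) m a (C.τ (j + 1))) k
              (jetCoeffs (C.e (j + 1))
                (fun s : ℝ => endPoint X q₀ T (u + s • Δu) (C.τ (j + 1))) k)) := by
  have hui (i : Fin l) : IntervalIntegrable (fun t => u t i) volume 0 T :=
    (intervalIntegrable_iff_integrableOn_Icc_of_le hT.le).2 (Integrable.eval hu i)
  have hΔui (i : Fin l) : IntervalIntegrable (fun t => Δu t i) volume 0 T :=
    (intervalIntegrable_iff_integrableOn_Icc_of_le hT.le).2 (Integrable.eval hΔu i)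
  obtain ⟨hev, hsm⟩ := endPoint_smooth hX hT.le hui hΔui hq
  refine ⟨hev, hsm, fun C => ⟨fun ξ hξ hξ' =>
    exists_isAdaptedForms hX hT hui hq.1 C hξ hξ', fun Φ hΦ => ⟨?_, ?_, ?_⟩⟩⟩
  · intro j hj t ht k _
    exact exists_smooth_inverse_jetMap (hΦ.exists_forall_eq hX hT.le hui hq.1 hj t ht) k
  · intro j hj k hk a
    have hmem {t : ℝ} (ht : t ∈ Icc (C.τ j) (C.τ (j + 1))) := C.mem_Icc hj ht
    -- The chart lemmas are phrased at the base point `ξ t 0`; this identifies it with the chart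
    -- image of `q t`.
    have h0 {t : ℝ} (ht : t ∈ Icc (C.τ j) (C.τ (j + 1))) :
        endPoint X q₀ T (u + (0 : ℝ) • Δu) t = q t := by
      rw [zero_smul, add_zero]
      exact (hsm t (hmem ht)).1
    have hode (k : ℕ) (hk : k ≥ 1) : SolvesODE (Φ j k a)
        (fun t => formsDeriv (fun i => localField (X i) (C.e j)) (u t)
          (C.e j (endPoint X q₀ T (u + (0 : ℝ) • Δu) t)) (fun m => Φ j m a t) k)
        (C.τ j) (C.τ (j + 1)) :=
      (hΦ.solvesODE_formsDeriv hX hT.le hui hq.1 hj hk a).congr (C.τ_le j hj) (fun _ _ => rfl)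
        (Eventually.of_forall fun t ht => by rw [h0 ht])
    have key := solvesODE_gradedPoly (Φ := fun m => Φ j m a) (C.τ_le j hj)
      (ξ := fun t s => C.e j (endPoint X q₀ T (u + s • Δu) t))
      (fun t ht => (hsm t (hmem ht)).2.contDiffAt_chart (C.e_mem j hj)
        (by rw [h0 ht]; exact C.q_mem j hj t ht))
      (fun i t ht => (contDiffOn_localField (hX i) (C.e_mem j hj)).contDiffAt
        ((C.e j).open_target.mem_nhds
          (by rw [h0 ht]; exact (C.e j).map_source (C.q_mem j hj t ht))))
      (fun k hk => hΦ.symm j hj k hk a) hode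
      (solvesODE_expansionCoeff_endPoint hX hT.le hui hΔui hq (C.τ_mem hj.le).1 (C.τ_le j hj)
        (C.τ_mem hj).2 (C.e_mem j hj) (C.q_mem j hj)) hk
    exact key.congr (C.τ_le j hj) (fun _ _ => rfl)
      (Eventually.of_forall fun t ht => by rw [h0 ht]; rfl)
  · intro j hj k hk a
    -- The transition rule of the forms is applied to the curve `s ↦ End^τ[u + s Δu]`, which is
    -- smooth and passes through `q(τ)` at `s = 0`.
    have hτ := hsm _ (C.τ_mem hj.le)
    refine (hΦ.change_chart j hj k hk a _ ?_ hτ.2).symm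
    rw [zero_smul, add_zero]
    exact hτ.1
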